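/- **Setting.** Let $\Omega\subset\mathbb R^3$ be a nonempty, bounded, connected open set with smooth boundary, $H:=L^2(\Omega)$ with norm $\|\cdot\|$ and inner product $(\cdot,\cdot)$, and $T>0$. Let $A:D(A)\subset H\to H$ and $B:D(B)\subset H\to H$ be unbounded monotone self-adjoint linear operators with compact resolvents. Let $0\le\lambda_1\le\lambda_2\le\dots\to+\infty$ be the eigenvalues of $A$ and $\{e_j\}$ a complete orthonormal system of corresponding eigenvectors; for $r>0$ let $$V_A^r:=D(A^r)=\Bigl\{v\in H:\ \sum_j|\lambda_j^r(v,e_j)|^2<\infty\Bigr\},\qquad A^rv=\sum_j\lambda_j^r(v,e_j)e_j ,$$ and define $B^\sigma$, $\sigma>0$, and $V_B^\sigma:=D(B^\sigma)$ in the same way; $V_B^\sigma$ carries the norm $\|v\|_{B,\sigma}^2=\|v\|^2+\|B^\sigma v\|^2$. Fix $r,\sigma>0$ and assume that * either $\lambda_1>0$, or $0=\lambda_1<\lambda_2$ and $e_1$ is a constant function; * if $\lambda_1=0$, the constant functions belong to $V_B^\sigma$. $V_A^r$ carries the norm $\|v\|_{A,r}^2=\|A^rv\|^2$ if $\lambda_1>0$,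 and $\|v\|_{A,r}^2=|(v,e_1)|^2+\|A^rv\|^2$ if $\lambda_1=0$; $V_A^{-r}:=(V_A^r)^*$ carries the dual norm, $\langle\cdot,\cdot\rangle_{A,r}$ is the duality pairing, and $H\subset V_A^{-r}$ through $\langle v,w\rangle_{A,r}=(v,w)$. Let $\tau\ge0$; let $\hat\beta:\mathbb R\to[0,+\infty]$ be convex and lower semicontinuous with $\hat\beta(0)=0$, let $\hat\pi\in C^1(\mathbb R)$ have a Lipschitz continuous derivative $\pi:=\hat\pi'$ with Lipschitz constant $L_\pi$, and let $\liminf_{|s|\to\infty}(\hat\beta(s)+\hat\pi(s))/s^2>0$. Put $\beta:=\partial\hat\beta$, with domain $D(\beta)$. The data satisfy $u\in H^1(0,T;H)$, $y_0\in V_B^\sigma$, $\hat\beta(y_0)\in L^1(\Omega)$ and, if $\lambda_1=0$, the mean value $m_0:=|\Omega|^{-1}\int_\Omega y_0$ lies in the interior of $D(\beta)$. A *solution* is a pair $(y,\mu)$ with $$y\in H^1(0,T;V_A^{-r})\cap L^\infty(0,T;V_B^\sigma),\quad \tau\partial_ty\in L^2(0,T;H),\quad \mu\in L^2(0,T;V_A^r),\quad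 \hat\beta(y)\in L^1(\Omega\times(0,T)),$$ $y(0)=y_0$, and, for a.e. $t\in(0,T)$, $$\langle\partial_ty(t),v\rangle_{A,r}+(A^r\mu(t),A^rv)=0\quad\text{for every }v\in V_A^r,$$ $$\tau(\partial_ty(t),y(t)-v)+(B^\sigma y(t),B^\sigma(y(t)-v))+\int_\Omega\hat\beta(y(t))+(\pi(y(t))-u(t),y(t)-v)\le(\mu(t),y(t)-v)+\int_\Omega\hat\beta(v)\quad\text{for every }v\in V_B^\sigma,$$ where $\int_\Omega\hat\beta(v):=+\infty$ if $\hat\beta(v)\notin L^1(\Omega)$. **Theorem 2.1 (Wellposedness).** 1. There exists at least one solution $(y,\mu)$ that satisfies $$\|y\|_{H^1(0,T;V_A^{-r})\cap L^\infty(0,T;V_B^\sigma)}+\|\mu\|_{L^2(0,T;V_A^r)}+\|\hat\beta(y)\|_{L^1(\Omega\times(0,T))}+\|\tau^{1/2}\partial_ty\|_{L^2(0,T;H)}\le K_1,$$ where $K_1$ depends only on $\Omega,A,B,r,\sigma,\hat\beta,\hat\pi$, on $T$, on an upper bound for $\tau$, on upper bounds for $\|u\|_{H^1(0,T;H)}$,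 $\|y_0\|_{B,\sigma}$ and $\|\hat\beta(y_0)\|_{L^1(\Omega)}$ and, if $\lambda_1=0$, on a number $\delta_0>0$ with $[m_0-\delta_0,m_0+\delta_0]\subset D(\beta)$. 2. If $(y_1,\mu_1)$ and $(y_2,\mu_2)$ are solutions corresponding to $u_1,u_2\in H^1(0,T;H)$ and to the same $y_0$, then $$\|y_1-y_2\|_{L^\infty(0,T;V_A^{-r})\cap L^2(0,T;V_B^\sigma)}+\|\tau^{1/2}(y_1-y_2)\|_{L^\infty(0,T;H)}\le K_2\|u_1-u_2\|_{L^2(0,T;H)},$$ where $K_2$ depends only on the operators $A^r$ and $B^\sigma$, on $L_\pi$ and on $T$. 3. For given data, the component $y$ of a solution $(y,\mu)$ and $A^r\mu$ are uniquely determined, and so is $\mu$ if $\lambda_1>0$. -/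

import Mathlib

open MeasureTheory Filter Topology Set
open scoped NNReal ENNReal InnerProductSpace

noncomputable section

section Spectral

variable {H : Type*} [NormedAddCommGroup H] [InnerProductSpace ℝ H]

/-- `A` has compact resolvent: for some `ξ` the operator `A - ξ` is a bijection of its domain onto
`H` whose inverse `R` is bounded and compact. -/
def HasCompactResolvent (A : H →ₗ.[ℝ] H) : Prop :=
  ∃ (ξ : ℝ) (R : H →L[ℝ] H), IsCompactOperator R ∧
    (∀ x : H, ∃ h : R x ∈ A.domain, A ⟨R x, h⟩ - ξ • R x = x) ∧
    ∀ x : A.domain, R (A x - ξ • (x : H)) = x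

/-- Unbounded monotone self-adjoint linear operators with compact resolvent. -/
structure IsMonotoneSelfAdjointCompact [CompleteSpace H] (A : H →ₗ.[ℝ] H) : Prop where
  unbounded : ¬ ∃ C : ℝ, ∀ x : A.domain, ‖A x‖ ≤ C * ‖x‖
  monotone : ∀ x : A.domain, 0 ≤ ⟪A x, (x : H)⟫_ℝ
  selfAdjoint : IsSelfAdjoint A
  compactResolvent : HasCompactResolvent A

/-- A complete orthonormal sequence of eigenvectors `vec j` of `A`, with nondecreasing sequence
of eigenvalues `val j` diverging to `+∞`.  The numbering starts from `0`. -/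
structure EigenSystem (A : H →ₗ.[ℝ] H) where
  val : ℕ → ℝ
  vec : HilbertBasis ℕ ℝ H
  mem : ∀ j, vec j ∈ A.domain
  eigen : ∀ j, A ⟨vec j, mem j⟩ = val j • vec j
  nonneg : ∀ j, 0 ≤ val j
  mono : Monotone val
  tendsto : Tendsto val atTop atTop

theorem exists_equiv_nat_monotone {ι : Type*} [Infinite ι] (f : ι → ℝ)
    (hf : ∀ C : ℝ, {i | f i ≤ C}.Finite) :
    ∃ e : ℕ ≃ ι, Monotone (f ∘ e) ∧ Tendsto (f ∘ e) atTop atTop := by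
  have hc : Countable ι := by
    rw [← Set.countable_univ_iff]
    have : (Set.univ : Set ι) = ⋃ n : ℕ, {i | f i ≤ n} := by
      ext i; simpa using exists_nat_ge (f i)
    rw [this]
    exact Set.countable_iUnion fun n => (hf n).countable
  obtain ⟨g, hg⟩ := hc.exists_injective_nat
  let key : ι → ℝ ×ₗ ℕ := fun i => toLex (f i, g i)
  have hkey : Function.Injective key := fun i j h => by
    have h' := congrArg ofLex h
    exact hg (congrArg Prod.snd h')
  have hle : ∀ i j, key i ≤ key j → f i ≤ f j := by
    intro i j h
    rcases Prod.Lex.toLex_le_toLex.1 h with h | h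
    · exact h.le
    · exact h.1.le
  have hfin : ∀ i, {j | key j < key i}.Finite := fun i =>
    (hf (f i)).subset fun j hj => hle j i (le_of_lt hj)
  let rank : ι → ℕ := fun i => (hfin i).toFinset.card
  have hrank : ∀ i j, key i < key j → rank i < rank j := by
    intro i j hij
    apply Finset.card_lt_card
    rw [Finset.ssubset_iff_of_subset]
    · exact ⟨i, by simpa using hij, by simp⟩
    · intro k hk
      simp only [Finite.mem_toFinset, Set.mem_ofPred_eq] at hk ⊢
      exact hk.trans hij
  have hinj : Function.Injective rank := by
    intro i j h
    rcases lt_trichotomy (key i) (key j) with h1 | h1 | h1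
    · exact absurd h (hrank i j h1).ne
    · exact hkey h1
    · exact absurd h (hrank j i h1).ne'
  have hmono : ∀ i j, rank i ≤ rank j → f i ≤ f j := by
    intro i j h
    refine hle i j (not_lt.1 fun h1 => ?_)
    exact absurd (hrank j i h1) (not_lt.2 h)
  have : Infinite (Set.range rank) := Set.infinite_coe_iff.2 (Set.infinite_range_of_injective hinj)
  classical
  let e : ℕ ≃ ι :=
    (Nat.Subtype.orderIsoOfNat (Set.range rank)).toEquiv.trans (Equiv.ofInjective rank hinj).symm
  have he : ∀ n, rank (e n) = (Nat.Subtype.orderIsoOfNat (Set.range rank) n : ℕ) := fun n =>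
    Equiv.apply_ofInjective_symm hinj _
  refine ⟨e, fun n m h => hmono _ _ ?_, ?_⟩
  · rw [he, he]
    exact (Nat.Subtype.orderIsoOfNat (Set.range rank)).monotone h
  · rw [tendsto_atTop]
    intro C
    rw [← Nat.cofinite_eq_atTop, Filter.eventually_cofinite]
    refine ((hf C).preimage e.injective.injOn).subset fun n hn => ?_
    exact (not_le.1 hn).le

theorem IsMonotoneSelfAdjointCompact.nonempty_eigenSystem [CompleteSpace H] {A : H →ₗ.[ℝ] H}
    (hA : IsMonotoneSelfAdjointCompact A) : Nonempty (EigenSystem A) := by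
  obtain ⟨ξ, R, hR, hR1, hR2⟩ := hA.compactResolvent
  have hsymmA : ∀ x y : A.domain, ⟪A x, (y : H)⟫_ℝ = ⟪(x : H), A y⟫_ℝ := by
    have h := LinearPMap.adjoint_isFormalAdjoint (T := A) hA.selfAdjoint.dense_domain
    rw [LinearPMap.isSelfAdjoint_def.1 hA.selfAdjoint] at h
    exact fun x y => h x y
  have hsymm : (R : H →ₗ[ℝ] H).IsSymmetric := by
    intro x y
    obtain ⟨hx, hx'⟩ := hR1 x
    obtain ⟨hy, hy'⟩ := hR1 y
    have h := hsymmA ⟨R x, hx⟩ ⟨R y, hy⟩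
    have e1 : ⟪R x, y⟫_ℝ = ⟪R x, A ⟨R y, hy⟩ - ξ • R y⟫_ℝ := by rw [hy']
    have e2 : ⟪x, R y⟫_ℝ = ⟪A ⟨R x, hx⟩ - ξ • R x, R y⟫_ℝ := by rw [hx']
    change ⟪R x, y⟫_ℝ = ⟪x, R y⟫_ℝ
    rw [e1, e2, inner_sub_left, inner_sub_right, real_inner_smul_left, real_inner_smul_right]
    simp only at h
    rw [h]
  have hinj : ∀ x, R x = 0 → x = 0 := by
    intro x hx
    obtain ⟨h, h'⟩ := hR1 x
    have : (⟨R x, h⟩ : A.domain) = 0 := Subtype.ext hx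
    rw [this, hx] at h'
    simpa using h'.symm
  have hfd : ∀ μ : ℝ, FiniteDimensional ℝ (Module.End.eigenspace (R : H →ₗ[ℝ] H) μ) := by
    intro μ
    by_cases hμ : μ = 0
    · have : Module.End.eigenspace (R : H →ₗ[ℝ] H) μ = ⊥ := by
        rw [Submodule.eq_bot_iff]
        intro x hx
        rw [Module.End.mem_eigenspace_iff, hμ, zero_smul] at hx
        exact hinj x hx
      rw [this]; infer_instance
    · exact ContinuousLinearMap.finite_dimensional_eigenspace hR μ hμ
  let ι := Σ μ : ℝ, Fin (Module.finrank ℝ (Module.End.eigenspace (R : H →ₗ[ℝ] H) μ))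
  let v : ι → H := fun i =>
    (stdOrthonormalBasis ℝ (Module.End.eigenspace (R : H →ₗ[ℝ] H) i.1) i.2 : H)
  have hv : Orthonormal ℝ v :=
    hsymm.orthogonalFamily_eigenspaces.orthonormal_sigma_orthonormal
      (v_family := fun μ => stdOrthonormalBasis ℝ (Module.End.eigenspace (R : H →ₗ[ℝ] H) μ))
      (fun μ => (stdOrthonormalBasis ℝ _).orthonormal)
  have hRv : ∀ i, R (v i) = i.1 • v i := fun i =>
    Module.End.mem_eigenspace_iff.1
      (stdOrthonormalBasis ℝ (Module.End.eigenspace (R : H →ₗ[ℝ] H) i.1) i.2).2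
  have hv0 : ∀ i, v i ≠ 0 := fun i => hv.ne_zero i
  have hμ0 : ∀ i : ι, i.1 ≠ 0 := by
    intro i h
    apply hv0 i
    apply hinj
    rw [hRv, h, zero_smul]
  have hspan : (Submodule.span ℝ (Set.range v))ᗮ = ⊥ := by
    rw [eq_bot_iff, ← ContinuousLinearMap.orthogonalComplement_iSup_eigenspaces_eq_bot hR hsymm]
    apply Submodule.orthogonal_le
    refine iSup_le fun μ x hx => ?_
    have h := (stdOrthonormalBasis ℝ (Module.End.eigenspace (R : H →ₗ[ℝ] H) μ)).sum_repr ⟨x, hx⟩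
    have h' := congrArg (Subtype.val) h
    rw [← show _ = x from h', Submodule.coe_sum]
    refine Submodule.sum_mem _ fun k _ => ?_
    rw [Submodule.coe_smul]
    exact Submodule.smul_mem _ _ (Submodule.subset_span ⟨⟨μ, k⟩, rfl⟩)
  have hdom : ∀ i, ∃ h : v i ∈ A.domain, A ⟨v i, h⟩ = (ξ + (i.1)⁻¹) • v i := by
    intro i
    obtain ⟨h, h'⟩ := hR1 ((i.1)⁻¹ • v i)
    have e : R ((i.1)⁻¹ • v i) = v i := by
      rw [map_smul, hRv, smul_smul, inv_mul_cancel₀ (hμ0 i), one_smul]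
    have hd : v i ∈ A.domain := e ▸ h
    refine ⟨hd, ?_⟩
    have e2 : (⟨R ((i.1)⁻¹ • v i), h⟩ : A.domain) = ⟨v i, hd⟩ := Subtype.ext e
    rw [e2, e] at h'
    rw [add_smul, ← h']
    abel
  choose hd hAv using hdom
  let f : ι → ℝ := fun i => ξ + (i.1)⁻¹
  have hf0 : ∀ i, 0 ≤ f i := by
    intro i
    have h := hA.monotone ⟨v i, hd i⟩
    rw [hAv] at h
    simp only [real_inner_smul_left, real_inner_self_eq_norm_sq, hv.1 i] at h
    simpa using h
  have : Infinite ι := by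
    by_contra hfin
    rw [not_infinite_iff_finite] at hfin
    have := Fintype.ofFinite ι
    let b := HilbertBasis.mkOfOrthogonalEqBot hv hspan
    have : FiniteDimensional ℝ H := b.toOrthonormalBasis.toBasis.finiteDimensional_of_finite
    apply hA.unbounded
    exact ⟨‖LinearMap.toContinuousLinearMap A.toFun‖, fun x =>
      (LinearMap.toContinuousLinearMap A.toFun).le_opNorm x⟩
  have hffin : ∀ C : ℝ, {i | f i ≤ C}.Finite := by
    intro C
    by_contra hinf
    have hinf : {i | f i ≤ C}.Infinite := hinf
    let D : ℝ := |C| + |ξ| + 1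
    have hDpos : 0 < D := by positivity
    have hlow : ∀ i ∈ {i | f i ≤ C}, D⁻¹ ≤ |i.1| := by
      intro i hi
      have h1 : |(i.1)⁻¹| ≤ D := by
        have h2 : (i.1)⁻¹ = f i - ξ := by simp [f]
        rw [h2]
        calc |f i - ξ| ≤ |f i| + |ξ| := abs_sub _ _
          _ ≤ |C| + |ξ| := by
            rw [abs_of_nonneg (hf0 i)]
            have : f i ≤ |C| := le_trans hi (le_abs_self C)
            linarith
          _ ≤ D := by simp [D]
      rw [abs_inv] at h1
      exact inv_le_of_inv_le₀ (abs_pos.2 (hμ0 i)) h1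
    obtain ⟨K, hK, hKR⟩ := hR.image_closedBall_subset_compact 1
    obtain ⟨N, hNfin, hN⟩ := Metric.totallyBounded_iff.1 hK.totallyBounded (D⁻¹ / 2) (by positivity)
    have hmem : ∀ i : ι, ∃ p ∈ N, dist (R (v i)) p < D⁻¹ / 2 := by
      intro i
      have : R (v i) ∈ K := hKR ⟨v i, by simp [hv.1 i], rfl⟩
      simpa using hN this
    choose q hqN hq using hmem
    obtain ⟨i, hi, j, hj, hij, hqij⟩ :=
      hinf.exists_ne_map_eq_of_mapsTo (f := q) (fun i _ => hqN i) hNfin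
    have h1 : dist (R (v i)) (R (v j)) < D⁻¹ := by
      have := dist_triangle_right (R (v i)) (R (v j)) (q i)
      have h2 := hq i
      have h3 := hq j
      rw [← hqij] at h3
      linarith
    have h2 : ‖R (v i) - R (v j)‖ ^ 2 = i.1 ^ 2 + j.1 ^ 2 := by
      rw [hRv, hRv, norm_sub_sq_real, norm_smul, norm_smul, hv.1, hv.1, real_inner_smul_left,
        real_inner_smul_right, hv.2 hij]
      simp
    rw [dist_eq_norm] at h1
    have h3 : ‖R (v i) - R (v j)‖ ^ 2 < D⁻¹ ^ 2 := by gcongr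
    have h4 : D⁻¹ ^ 2 ≤ i.1 ^ 2 := by
      rw [← sq_abs i.1]
      have := hlow i hi
      gcongr
    nlinarith [sq_nonneg j.1]
  obtain ⟨e, he1, he2⟩ := exists_equiv_nat_monotone f hffin
  have hrange : Set.range (v ∘ e) = Set.range v := e.surjective.range_comp v
  let b : HilbertBasis ℕ ℝ H :=
    HilbertBasis.mkOfOrthogonalEqBot (hv.comp e e.injective) (by rw [hrange]; exact hspan)
  have hb : ∀ j, b j = v (e j) := fun j =>
    congrFun (HilbertBasis.coe_mkOfOrthogonalEqBot (hv.comp e e.injective) _) j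
  refine ⟨⟨f ∘ e, b, fun j => by rw [hb]; exact hd _, fun j => ?_, fun j => hf0 _, he1, he2⟩⟩
  have e2 : (⟨b j, by rw [hb]; exact hd _⟩ : A.domain) = ⟨v (e j), hd _⟩ := Subtype.ext (hb j)
  rw [e2, hb, hAv]
  rfl

/-- The eigenvalues `λ₁ ≤ λ₂ ≤ …` and eigenvectors `e₁, e₂, …` of `A`, numbered from `0`. -/
def IsMonotoneSelfAdjointCompact.eigenSystem [CompleteSpace H] {A : H →ₗ.[ℝ] H}
    (hA : IsMonotoneSelfAdjointCompact A) : EigenSystem A :=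
  Classical.choice hA.nonempty_eigenSystem


namespace EigenSystem

variable {A : H →ₗ.[ℝ] H} (E : EigenSystem A)

theorem summable_smul_vec {c : ℕ → ℝ} (hc : Summable fun j => c j ^ 2) :
    Summable fun j => c j • E.vec j := by
  have : Memℓp c 2 := by
    rw [memℓp_gen_iff (by norm_num)]
    simpa using hc
  simpa using (E.vec.hasSum_repr_symm ⟨c, this⟩).summable

/-- The power `A ^ s`, `s > 0`: its domain consists of the `v` with `∑ |λ_j ^ s (v, e_j)|² < ∞`,
and `A ^ s v = ∑ λ_j ^ s (v, e_j) e_j`. -/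
def pow (s : ℝ) : H →ₗ.[ℝ] H where
  domain :=
    { carrier := {v | Summable fun j => (E.val j ^ s * ⟪E.vec j, v⟫_ℝ) ^ 2}
      zero_mem' := by simp [summable_zero]
      add_mem' := by
        intro v w hv hw
        refine Summable.of_nonneg_of_le (fun j => sq_nonneg _) (fun j => ?_)
          ((hv.mul_left 2).add (hw.mul_left 2))
        rw [inner_add_right, mul_add]
        nlinarith [sq_nonneg (E.val j ^ s * ⟪E.vec j, v⟫_ℝ - E.val j ^ s * ⟪E.vec j, w⟫_ℝ)]
      smul_mem' := by
        intro a v hv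
        refine (hv.mul_left (a ^ 2)).congr fun j => ?_
        rw [real_inner_smul_right]
        ring }
  toFun :=
    { toFun := fun v => ∑' j, (E.val j ^ s * ⟪E.vec j, (v : H)⟫_ℝ) • E.vec j
      map_add' := by
        intro v w
        rw [← (E.summable_smul_vec v.2).tsum_add (E.summable_smul_vec w.2)]
        refine tsum_congr fun j => ?_
        rw [Submodule.coe_add, inner_add_right, mul_add, add_smul]
      map_smul' := by
        intro a v
        rw [RingHom.id_apply, ← tsum_const_smul'']
        refine tsum_congr fun j => ?_
        rw [Submodule.coe_smul, real_inner_smul_right, smul_smul]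
        ring_nf }

theorem inner_vec_pow (s : ℝ) (v : (E.pow s).domain) (j : ℕ) :
    ⟪E.vec j, E.pow s v⟫_ℝ = E.val j ^ s * ⟪E.vec j, (v : H)⟫_ℝ := by
  have h := (E.summable_smul_vec v.2).hasSum.mapL (innerSL ℝ (E.vec j))
  have h2 : HasSum (fun i => (innerSL ℝ (E.vec j))
      ((E.val i ^ s * ⟪E.vec i, (v : H)⟫_ℝ) • E.vec i)) (E.val j ^ s * ⟪E.vec j, (v : H)⟫_ℝ) := by
    convert hasSum_single j ?_ using 1
    · simp [E.vec.orthonormal.1 j]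
    · intro i hi
      simp [E.vec.orthonormal.2 hi.symm]
  exact h.unique h2

theorem finite_val_eq_zero : {j | E.val j = 0}.Finite := by
  have h := E.tendsto.eventually_gt_atTop 0
  rw [← Nat.cofinite_eq_atTop, Filter.eventually_cofinite] at h
  exact h.subset fun j hj => by simp [show E.val j = 0 from hj]

/-- The indices of the vanishing eigenvalues: none of them if `λ₁ > 0`, the first one only
if `0 = λ₁ < λ₂`. -/
def zeroIndices : Finset ℕ := E.finite_val_eq_zero.toFinset

/-- The space `V_A^r = D(A ^ r)`, to be normed by `(v, w)_{A,r}`. -/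
def SpecSpace (r : ℝ) : Type _ := (E.pow r).domain

namespace SpecSpace

variable {E} {r : ℝ}

instance : AddCommGroup (E.SpecSpace r) := inferInstanceAs (AddCommGroup (E.pow r).domain)

instance : Module ℝ (E.SpecSpace r) := inferInstanceAs (Module ℝ (E.pow r).domain)

/-- The inclusion of `V_A^r` in `H`. -/
def toH : E.SpecSpace r →ₗ[ℝ] H := (E.pow r).domain.subtype

/-- The operator `A ^ r` on `V_A^r`. -/
def op : E.SpecSpace r →ₗ[ℝ] H := (E.pow r).toFun

theorem toH_injective : Function.Injective (toH : E.SpecSpace r → H) := Subtype.val_injective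

theorem inner_vec_op (v : E.SpecSpace r) (j : ℕ) :
    ⟪E.vec j, op v⟫_ℝ = E.val j ^ r * ⟪E.vec j, toH v⟫_ℝ := E.inner_vec_pow r v j

/-- The inner product `(v, w)_{A,r}` of `V_A^r`, that is, `(A ^ r v, A ^ r w)` if `λ₁ > 0`, and
`(v, e₁) (w, e₁) + (A ^ r v, A ^ r w)` if `0 = λ₁ < λ₂`. -/
@[reducible]
def core : InnerProductSpace.Core ℝ (E.SpecSpace r) where
  inner v w := ∑ j ∈ E.zeroIndices, ⟪toH v, E.vec j⟫_ℝ * ⟪toH w, E.vec j⟫_ℝ + ⟪op v, op w⟫_ℝ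
  conj_inner_symm v w := by
    simp only [conj_trivial]
    rw [real_inner_comm]
    congr 1
    exact Finset.sum_congr rfl fun j _ => mul_comm _ _
  re_inner_nonneg v := by
    simp only [RCLike.re_to_real]
    exact add_nonneg (Finset.sum_nonneg fun j _ => mul_self_nonneg _) real_inner_self_nonneg
  add_left v w z := by
    simp only [map_add, inner_add_left, add_mul, Finset.sum_add_distrib]
    ring
  smul_left v w a := by
    simp only [map_smul, real_inner_smul_left, conj_trivial, mul_add, Finset.mul_sum, mul_assoc]
  definite v h := by
    have h1 : 0 ≤ ∑ j ∈ E.zeroIndices, ⟪toH v, E.vec j⟫_ℝ * ⟪toH v, E.vec j⟫_ℝ :=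
      Finset.sum_nonneg fun j _ => mul_self_nonneg _
    have h2 : 0 ≤ ⟪op v, op v⟫_ℝ := real_inner_self_nonneg
    have h3 : op v = 0 := inner_self_eq_zero.1 (by linarith : ⟪op v, op v⟫_ℝ = 0)
    have h4 := (Finset.sum_eq_zero_iff_of_nonneg fun j _ => mul_self_nonneg _).1
      (by linarith : ∑ j ∈ E.zeroIndices, ⟪toH v, E.vec j⟫_ℝ * ⟪toH v, E.vec j⟫_ℝ = 0)
    apply toH_injective
    rw [map_zero, ← E.vec.repr.map_eq_zero_iff]
    ext j
    rw [E.vec.repr_apply_apply]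
    change ⟪E.vec j, toH v⟫_ℝ = 0
    by_cases hj : E.val j = 0
    · rw [real_inner_comm]
      exact mul_self_eq_zero.1 (h4 j (by simpa [zeroIndices] using hj))
    · have h5 := inner_vec_op v j
      rw [h3, inner_zero_right] at h5
      have h6 : E.val j ^ r ≠ 0 :=
        (Real.rpow_pos_of_pos (lt_of_le_of_ne (E.nonneg j) (Ne.symm hj)) r).ne'
      exact (mul_eq_zero.1 h5.symm).resolve_left h6

instance : NormedAddCommGroup (E.SpecSpace r) := core.toNormedAddCommGroup

instance : InnerProductSpace ℝ (E.SpecSpace r) := InnerProductSpace.ofCore core.toCore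

theorem norm_sq_eq (v : E.SpecSpace r) :
    ‖v‖ ^ 2 = ∑ j ∈ E.zeroIndices, ⟪toH v, E.vec j⟫_ℝ ^ 2 + ‖op v‖ ^ 2 := by
  rw [← real_inner_self_eq_norm_sq, ← real_inner_self_eq_norm_sq (op v)]
  simp only [sq]
  rfl

theorem exists_norm_toH_le (hr : 0 < r) : ∃ C : ℝ, ∀ v : E.SpecSpace r, ‖toH v‖ ≤ C * ‖v‖ := by
  classical
  have hex : ∃ j, 0 < E.val j := (E.tendsto.eventually_gt_atTop 0).exists
  set a : ℝ := E.val (Nat.find hex) ^ r with ha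
  have hapos : 0 < a := Real.rpow_pos_of_pos (Nat.find_spec hex) r
  have hale : ∀ j, E.val j ≠ 0 → a ≤ E.val j ^ r := by
    intro j hj
    have hj' : 0 < E.val j := lt_of_le_of_ne (E.nonneg j) (Ne.symm hj)
    exact Real.rpow_le_rpow (E.nonneg _) (E.mono (Nat.find_min' hex hj')) hr.le
  refine ⟨Real.sqrt (1 + (a ^ 2)⁻¹), fun v => ?_⟩
  have hnorm : ∀ x : H, HasSum (fun j => ⟪E.vec j, x⟫_ℝ ^ 2) (‖x‖ ^ 2) := by
    intro x
    have h := E.vec.hasSum_inner_mul_inner x x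
    rw [real_inner_self_eq_norm_sq] at h
    have h' : (fun j => ⟪E.vec j, x⟫_ℝ ^ 2) = fun j => ⟪x, E.vec j⟫_ℝ * ⟪E.vec j, x⟫_ℝ :=
      funext fun j => by rw [sq, real_inner_comm (E.vec j) x]
    rw [h']
    exact h
  have h1 : HasSum (fun j => if j ∈ E.zeroIndices then ⟪toH v, E.vec j⟫_ℝ ^ 2 else 0)
      (∑ j ∈ E.zeroIndices, ⟪toH v, E.vec j⟫_ℝ ^ 2) := by
    rw [← Finset.sum_congr rfl fun j hj => if_pos hj]
    exact hasSum_sum_of_ne_finset_zero fun j hj => if_neg hj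
  have h2 := h1.add ((hnorm (op v)).mul_left (a ^ 2)⁻¹)
  have h3 := hasSum_le (fun j => ?_) (hnorm (toH v)) h2
  · have h4 : ‖toH v‖ ^ 2 ≤ (1 + (a ^ 2)⁻¹) * ‖v‖ ^ 2 := by
      rw [norm_sq_eq]
      have h5 : 0 ≤ ∑ j ∈ E.zeroIndices, ⟪toH v, E.vec j⟫_ℝ ^ 2 :=
        Finset.sum_nonneg fun j _ => sq_nonneg _
      have h6 : 0 < (a ^ 2)⁻¹ := by positivity
      nlinarith [sq_nonneg ‖op v‖, mul_nonneg h6.le h5]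
    have h7 := Real.sqrt_le_sqrt h4
    rwa [Real.sqrt_sq (norm_nonneg _), Real.sqrt_mul (by positivity), Real.sqrt_sq (norm_nonneg _)]
      at h7
  · by_cases hj : E.val j = 0
    · have : j ∈ E.zeroIndices := by simpa [zeroIndices] using hj
      rw [if_pos this, real_inner_comm]
      have : 0 ≤ (a ^ 2)⁻¹ * ⟪E.vec j, op v⟫_ℝ ^ 2 := by positivity
      linarith
    · have : j ∉ E.zeroIndices := by simpa [zeroIndices] using hj
      rw [if_neg this, zero_add, inner_vec_op, mul_pow, ← mul_assoc]
      have h8 : a ^ 2 ≤ (E.val j ^ r) ^ 2 := by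
        have := hale j hj
        gcongr
      have h9 : 1 ≤ (a ^ 2)⁻¹ * (E.val j ^ r) ^ 2 := by
        rw [inv_mul_eq_div, one_le_div (by positivity)]
        exact h8
      nlinarith [sq_nonneg ⟪E.vec j, toH v⟫_ℝ]

/-- The inclusion of `V_A^r` in `H` as a continuous linear map. -/
def toHL (hr : 0 < r) : E.SpecSpace r →L[ℝ] H :=
  (toH : E.SpecSpace r →ₗ[ℝ] H).mkContinuousOfExistsBound (exists_norm_toH_le hr)

end SpecSpace

/-- The space `V_A^{-r}`, dual to `V_A^r`, with the dual norm. -/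
abbrev NegSpace (r : ℝ) : Type _ := StrongDual ℝ (E.SpecSpace r)

/-- The identification of `H` with a subspace of `V_A^{-r}`: `⟨v, w⟩_{A,r} = (v, w)`. -/
def toNeg {r : ℝ} (hr : 0 < r) : H →L[ℝ] E.NegSpace r :=
  (ContinuousLinearMap.compL ℝ (E.SpecSpace r) H ℝ).flip (SpecSpace.toHL hr) ∘L innerSL ℝ

@[simp]
theorem toNeg_apply {r : ℝ} (hr : 0 < r) (v : H) (w : E.SpecSpace r) :
    E.toNeg hr v w = ⟪v, SpecSpace.toH w⟫_ℝ := rfl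

end EigenSystem

/-- The domain of `P`, to be normed by `(v, w) + (P v, P w)`. -/
def GraphSpace (P : H →ₗ.[ℝ] H) : Type _ := P.domain

namespace GraphSpace

variable {P : H →ₗ.[ℝ] H}

instance : AddCommGroup (GraphSpace P) := inferInstanceAs (AddCommGroup P.domain)

instance : Module ℝ (GraphSpace P) := inferInstanceAs (Module ℝ P.domain)

/-- The inclusion of the domain of `P` in `H`. -/
def toH : GraphSpace P →ₗ[ℝ] H := P.domain.subtype

/-- The operator `P` on its domain. -/
def op : GraphSpace P →ₗ[ℝ] H := P.toFun

/-- The inner product `(v, w) + (P v, P w)`. -/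
@[reducible]
def core : InnerProductSpace.Core ℝ (GraphSpace P) where
  inner v w := ⟪toH v, toH w⟫_ℝ + ⟪op v, op w⟫_ℝ
  conj_inner_symm v w := by
    simp only [conj_trivial]
    rw [real_inner_comm, real_inner_comm (op v)]
  re_inner_nonneg v := by
    simp only [RCLike.re_to_real]
    exact add_nonneg real_inner_self_nonneg real_inner_self_nonneg
  add_left v w z := by
    simp only [map_add, inner_add_left]
    ring
  smul_left v w a := by
    simp only [map_smul, real_inner_smul_left, conj_trivial, mul_add]
  definite v h := by
    have h1 : 0 ≤ ⟪toH v, toH v⟫_ℝ := real_inner_self_nonneg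
    have h2 : 0 ≤ ⟪op v, op v⟫_ℝ := real_inner_self_nonneg
    exact Subtype.val_injective (inner_self_eq_zero.1 (by linarith : ⟪toH v, toH v⟫_ℝ = 0))

instance : NormedAddCommGroup (GraphSpace P) := core.toNormedAddCommGroup

instance : InnerProductSpace ℝ (GraphSpace P) := InnerProductSpace.ofCore core.toCore

end GraphSpace

end Spectral

section TimeDependent

variable {X : Type*} [NormedAddCommGroup X] [NormedSpace ℝ X]

/-- Lebesgue measure on the time interval `(0, T)`. -/
def timeMeasure (T : ℝ) : Measure ℝ := volume.restrict (Ioo 0 T)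

/-- `f'` is the weak derivative of `f` on `(0, T)`. -/
def HasWeakTimeDeriv (T : ℝ) (f f' : ℝ → X) : Prop :=
  ∀ φ : ℝ → ℝ, ContDiff ℝ (⊤ : ℕ∞) φ → HasCompactSupport φ → tsupport φ ⊆ Ioo 0 T →
    ∫ t, deriv φ t • f t ∂timeMeasure T = -∫ t, φ t • f' t ∂timeMeasure T

/-- `f` belongs to `H¹(0, T; X)` and `f'` is its derivative. -/
structure IsH1 (T : ℝ) (f f' : ℝ → X) : Prop where
  memLp : MemLp f 2 (timeMeasure T)
  memLp_deriv : MemLp f' 2 (timeMeasure T)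
  weakDeriv : HasWeakTimeDeriv T f f'

/-- The norm in `H¹(0, T; X)` of a function `f` with derivative `f'`. -/
def h1Norm (T : ℝ) (f f' : ℝ → X) : ℝ≥0∞ :=
  eLpNorm f 2 (timeMeasure T) + eLpNorm f' 2 (timeMeasure T)

/-- The element of `C([0, T]; X)` that agrees with `f` almost everywhere takes the value `x`
at `t = 0`. -/
def HasInitialValue (T : ℝ) (f : ℝ → X) (x : X) : Prop :=
  ∃ c : ℝ → X, ContinuousOn c (Icc 0 T) ∧ c =ᵐ[timeMeasure T] f ∧ c 0 = x

end TimeDependent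

/-- Three-dimensional Euclidean space. -/
abbrev Space3 : Type := EuclideanSpace ℝ (Fin 3)

/-- The boundary of the open set `Ω` is smooth: near each of its points, `Ω` is the sublevel set
of a smooth function with nonvanishing differential there. -/
def HasSmoothBoundary (Ω : Set Space3) : Prop :=
  ∀ p ∈ frontier Ω, ∃ (U : Set Space3) (ψ : Space3 → ℝ), IsOpen U ∧ p ∈ U ∧ ContDiff ℝ (⊤ : ℕ∞) ψ ∧
    fderiv ℝ ψ p ≠ 0 ∧ Ω ∩ U = {x ∈ U | ψ x < 0}

/-- The space `H = L²(Ω)`. -/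
abbrev L2 (Ω : Set Space3) : Type := Lp ℝ 2 (volume.restrict Ω)

/-- The function `v` is constant. -/
def IsConstFun {Ω : Set Space3} (v : L2 Ω) : Prop :=
  ∃ c : ℝ, v =ᵐ[volume.restrict Ω] fun _ => c

/-- The domain of the subdifferential `β` of `βhat`. -/
def subdiffDomain (βhat : ℝ → ℝ≥0∞) : Set ℝ :=
  {s | ∃ ξ : ℝ, ∀ z : ℝ, (βhat s : EReal) + ((ξ * (z - s) : ℝ) : EReal) ≤ (βhat z : EReal)}

/-- The assumptions on the convex part `βhat` and on the smooth part `πhat` of the potential;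
`L` is a Lipschitz constant of `π`, the derivative of `πhat`. -/
structure IsAdmissiblePotential (βhat : ℝ → ℝ≥0∞) (πhat : ℝ → ℝ) (L : ℝ≥0) : Prop where
  convex : ConvexOn ℝ≥0 univ βhat
  lsc : LowerSemicontinuous βhat
  zero : βhat 0 = 0
  contDiff : ContDiff ℝ 1 πhat
  lipschitz : LipschitzWith L (deriv πhat)
  coercive : 0 < liminf (fun s : ℝ => ((βhat s : EReal) + (πhat s : EReal)) / ((s ^ 2 : ℝ) : EReal))
    (comap (fun s : ℝ => |s|) atTop)

/-- The integral of `βhat (v)` over `Ω`, equal to `∞` if `βhat (v)` is not in `L¹(Ω)`. -/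
def betaIntegral {Ω : Set Space3} (βhat : ℝ → ℝ≥0∞) (v : L2 Ω) : ℝ≥0∞ :=
  ∫⁻ x in Ω, βhat (v x)

open EigenSystem in
/-- The pair `(y, μ)` has the required regularity and solves the problem with right-hand side `u`
and initial value `y₀`.  The functions `dy` and `dyH` stand for the derivative of `y`, as a
function with values in `V_A^{-r}`, and, if `τ > 0`, as a function with values in `H`; if `τ = 0`,
then `dyH` is not subject to any condition and plays no role. -/
structure IsSolution {Ω : Set Space3} {A B : L2 Ω →ₗ.[ℝ] L2 Ω} (EA : EigenSystem A)
    (EB : EigenSystem B) {r : ℝ} (hr : 0 < r) (σ T τ : ℝ) (βhat : ℝ → ℝ≥0∞) (πhat : ℝ → ℝ)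
    (u : ℝ → L2 Ω) (y₀ : GraphSpace (EB.pow σ)) (y : ℝ → GraphSpace (EB.pow σ))
    (μ : ℝ → EA.SpecSpace r) (dy : ℝ → EA.NegSpace r) (dyH : ℝ → L2 Ω) : Prop where
  memH1_y : IsH1 T (fun t => EA.toNeg hr (GraphSpace.toH (y t))) dy
  memLinfty_y : MemLp y ∞ (timeMeasure T)
  memL2_tau_dy : MemLp (fun t => τ • dyH t) 2 (timeMeasure T)
  tau_dy_eq : ∀ᵐ t ∂timeMeasure T, EA.toNeg hr (τ • dyH t) = τ • dy t
  memL2_μ : MemLp μ 2 (timeMeasure T)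
  beta_memL1 : ∫⁻ t, betaIntegral βhat (GraphSpace.toH (y t)) ∂timeMeasure T < ∞
  first_equation : ∀ᵐ t ∂timeMeasure T, ∀ v : EA.SpecSpace r,
    dy t v + ⟪SpecSpace.op (μ t), SpecSpace.op v⟫_ℝ = 0
  second_inequality : ∀ᵐ t ∂timeMeasure T, ∀ v : GraphSpace (EB.pow σ),
    ((τ * ⟪dyH t, GraphSpace.toH (y t - v)⟫_ℝ
        + ⟪GraphSpace.op (y t), GraphSpace.op (y t - v)⟫_ℝ : ℝ) : EReal)
      + (betaIntegral βhat (GraphSpace.toH (y t)) : EReal)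
      + ((∫ x in Ω, (deriv πhat (GraphSpace.toH (y t) x) - u t x)
          * (GraphSpace.toH (y t) x - GraphSpace.toH v x) : ℝ) : EReal)
    ≤ ((⟪SpecSpace.toH (μ t), GraphSpace.toH (y t - v)⟫_ℝ : ℝ) : EReal)
      + (betaIntegral βhat (GraphSpace.toH v) : EReal)
  initial_value :
    HasInitialValue T (fun t => EA.toNeg hr (GraphSpace.toH (y t))) (EA.toNeg hr (GraphSpace.toH y₀))

end

/-! Put H = L²(Ω), V = V_B^σ, W = V_A^r, and let N f in W be the Riesz representative of w ↦ (f, w).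
Removing from μ its component along e₁ when λ₁ = 0 (the map `proj`) turns (A^r μ, A^r v) into the
W-inner product of `proj μ` and v. The first equation then reads N ∂ₜy = -proj μ, and the system is
a gradient flow, in the norm ‖N ·‖ and with the extra viscosity τ, of the energy ½‖B^σ y‖² + ∫(βhat
+ πhat)(y) - (u, y); if λ₁ = 0, the mean of y is conserved. The form B^σ and βhat are monotone and π
is a Lipschitz perturbation. Compactness of the resolvent of B enters only through the Ehrling
inequality ‖v‖² ≤ ε‖B^σ v‖² + C‖N v‖² (`EigenSystem.ehrling`), which lets the perturbation be
absorbed by the dissipation. Everything up to the last parts is therefore done for abstract spaces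
H, V, W with this inequality.

Stability (`exists_stability`): each of two solutions is a test element for the inequality of the
other. The difference has zero mean, so the undetermined part of μ drops out, and Gronwall's lemma
for ‖N(y₁ - y₂)‖² + τ‖y₁ - y₂‖² gives continuous dependence. It is proved for approximate solutions
with a consistency error of order h, so that the same estimate serves for uniqueness and for
convergence.

Existence: Euler steps with π explicit and all else implicit. A step minimizes a strictly convex
functional under the mean constraint, whose Lagrange multiplier is the e₁-component of μ
(`exists_step`). Testing with the previous value gives the energy bound. Testing with the constants
m₀ ± δ₀/2 bounds the multiplier; this is where m₀ has to be interior to D(β). The stability estimate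
makes the interpolants of y a Cauchy sequence in L²(0,T;V) with a rate in h, so no compactness in
time is needed. The functions μ and √τ ∂ₜy are merely bounded in L², but for a fixed limit of y all
relations to be satisfied describe closed convex sets of pairs (μ, √τ ∂ₜy). A point common to all
these sets, which replaces a weak limit, completes the solution
(`exists_isTrajectory_of_isApproximation`). -/

/-! ### Absolutely continuous functions and primitives -/

section AbsolutelyContinuous

variable {X Y : Type*}

/-- Reduces absolute continuity of a vector-valued function to that of a scalar one that dominates
its increments, such as the primitive of the norm. -/
theorem AbsolutelyContinuousOnInterval.of_dist_le [PseudoMetricSpace X] [PseudoMetricSpace Y]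
    {f : ℝ → X} {g : ℝ → Y} {a b C : ℝ} (hg : AbsolutelyContinuousOnInterval g a b)
    (h : ∀ x ∈ uIcc a b, ∀ y ∈ uIcc a b, dist (f x) (f y) ≤ C * dist (g x) (g y)) :
    AbsolutelyContinuousOnInterval f a b := by
  rw [absolutelyContinuousOnInterval_iff] at hg ⊢
  intro ε hε
  obtain ⟨δ, hδ, H⟩ := hg (ε / (|C| + 1)) (by positivity)
  refine ⟨δ, hδ, fun E hE hl => ?_⟩
  have h1 := H E hE hl
  rw [lt_div_iff₀ (by positivity)] at h1
  refine lt_of_le_of_lt ?_ h1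
  rw [Finset.sum_mul]
  refine Finset.sum_le_sum fun i hi => ?_
  refine (h _ (hE.1 i hi).1 _ (hE.1 i hi).2).trans ?_
  rw [mul_comm]
  have : C ≤ |C| + 1 := by linarith [le_abs_self C]
  gcongr

variable [NormedAddCommGroup X] [NormedSpace ℝ X]

theorem IntervalIntegrable.absolutelyContinuousOnInterval_primitive {f : ℝ → X} {a b c : ℝ}
    (h : IntervalIntegrable f volume a b) (hc : c ∈ uIcc a b) :
    AbsolutelyContinuousOnInterval (fun x => ∫ v in c..x, f v) a b := by
  refine (h.norm.absolutelyContinuousOnInterval_intervalIntegral hc).of_dist_le (C := 1) ?_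
  intro x hx y hy
  have hI : ∀ z ∈ uIcc a b, IntervalIntegrable f volume c z := fun z hz =>
    h.mono_set (uIcc_subset_uIcc hc hz)
  rw [one_mul, dist_eq_norm, Real.dist_eq,
    intervalIntegral.integral_interval_sub_left (hI x hx) (hI y hy),
    intervalIntegral.integral_interval_sub_left (hI x hx).norm (hI y hy).norm]
  exact intervalIntegral.norm_integral_le_abs_integral_norm

/-- Subtracting the primitive of `f'` leaves an absolutely continuous function with derivative zero
almost everywhere, hence a constant. Differentiability is a hypothesis because it can fail for
absolutely continuous functions with values in a Banach space. -/
theorem AbsolutelyContinuousOnInterval.eq_add_integral [CompleteSpace X] {f f' : ℝ → X} {a b : ℝ}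
    (hf : AbsolutelyContinuousOnInterval f a b) (hf' : IntervalIntegrable f' volume a b)
    (hd : ∀ᵐ x, x ∈ uIcc a b → HasDerivAt f (f' x) x) {x : ℝ} (hx : x ∈ uIcc a b) :
    f x = f a + ∫ t in a..x, f' t := by
  have h1 := hf.sub (hf'.absolutelyContinuousOnInterval_primitive (c := a) left_mem_uIcc)
  obtain ⟨C, hC⟩ := h1.const_of_ae_hasDerivAt_zero (by
    filter_upwards [hd, hf'.ae_hasDerivAt_integral] with y h2 h3 hy
    convert! (h2 hy).sub (h3 hy a left_mem_uIcc)
    exact (sub_self _).symm)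
  have h2 := hC x hx
  have h3 := hC a left_mem_uIcc
  simp only [Pi.sub_apply, intervalIntegral.integral_same, sub_zero] at h2 h3
  rw [h3, ← h2]
  abel

/-- The chain rule behind all energy identities: the squared norm of a primitive is absolutely
continuous because primitives are bounded and t ↦ t² is Lipschitz on bounded sets. -/
theorem norm_sq_primitive {E : Type*} [NormedAddCommGroup E] [InnerProductSpace ℝ E]
    [CompleteSpace E] {f : ℝ → E} {T : ℝ} (hf : IntervalIntegrable f volume 0 T) {t : ℝ}
    (ht : t ∈ uIcc 0 T) :
    IntervalIntegrable (fun s => 2 * ⟪f s, ∫ x in (0 : ℝ)..s, f x⟫_ℝ) volume 0 T ∧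
    ‖∫ s in (0 : ℝ)..t, f s‖ ^ 2 = ∫ s in (0 : ℝ)..t, 2 * ⟪f s, ∫ x in (0 : ℝ)..s, f x⟫_ℝ := by
  have hac := hf.absolutelyContinuousOnInterval_primitive (c := 0) left_mem_uIcc
  obtain ⟨C, hC⟩ := hac.exists_bound
  have hac2 : AbsolutelyContinuousOnInterval (fun t => ‖∫ s in (0 : ℝ)..t, f s‖ ^ 2) 0 T := by
    refine hac.of_dist_le (C := 2 * C) fun x hx y hy => ?_
    have h1 := abs_norm_sub_norm_le (∫ s in (0 : ℝ)..x, f s) (∫ s in (0 : ℝ)..y, f s)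
    rw [Real.dist_eq, dist_eq_norm, sq_sub_sq, abs_mul]
    have h2 : |‖∫ s in (0 : ℝ)..x, f s‖ + ‖∫ s in (0 : ℝ)..y, f s‖| ≤ 2 * C := by
      rw [abs_of_nonneg (by positivity)]
      linarith [hC x hx, hC y hy]
    exact mul_le_mul h2 h1 (abs_nonneg _) ((abs_nonneg _).trans h2)
  have hint : IntervalIntegrable (fun s => 2 * ⟪f s, ∫ x in (0 : ℝ)..s, f x⟫_ℝ) volume 0 T := by
    refine IntervalIntegrable.const_mul ?_ 2
    rw [intervalIntegrable_iff] at hf ⊢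
    have hm : AEStronglyMeasurable (fun s => ∫ x in (0 : ℝ)..s, f x)
        (volume.restrict (uIoc 0 T)) :=
      (hac.continuousOn.mono uIoc_subset_uIcc).aestronglyMeasurable measurableSet_uIoc
    refine Integrable.mono (hf.norm.mul_const C) (hf.aestronglyMeasurable.inner hm) ?_
    refine (ae_restrict_iff' measurableSet_uIoc).2 (ae_of_all _ fun s hs => ?_)
    refine (norm_inner_le_norm _ _).trans ?_
    rw [Real.norm_eq_abs, abs_mul, abs_norm]
    gcongr
    exact (hC s (uIoc_subset_uIcc hs)).trans (le_abs_self _)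
  refine ⟨hint, ?_⟩
  have := hac2.eq_add_integral hint ?_ ht
  · simpa using this
  · filter_upwards [hf.ae_hasDerivAt_integral] with x hx hxT
    convert! (hx hxT 0 left_mem_uIcc).norm_sq using 1
    rw [real_inner_comm]

end AbsolutelyContinuous

/-! ### Weak derivatives in time and Gronwall's inequality -/

section TimeDependent

variable {X : Type*} [NormedAddCommGroup X]

instance {T : ℝ} : IsFiniteMeasure (timeMeasure T) := by
  unfold timeMeasure
  infer_instance

theorem integrable_timeMeasure_iff {T : ℝ} (hT : 0 < T) {f : ℝ → X} :
    Integrable f (timeMeasure T) ↔ IntervalIntegrable f volume 0 T := by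
  rw [intervalIntegrable_iff_integrableOn_Ioo_of_le hT.le]
  rfl

theorem integrable_of_continuousOn {T : ℝ} {f : ℝ → X} (hf : ContinuousOn f (Icc 0 T)) :
    Integrable f (timeMeasure T) :=
  hf.integrableOn_Icc.mono_set Ioo_subset_Icc_self

variable [NormedSpace ℝ X]

theorem integral_timeMeasure {T : ℝ} (hT : 0 < T) (f : ℝ → X) :
    ∫ t, f t ∂timeMeasure T = ∫ t in (0 : ℝ)..T, f t := by
  rw [intervalIntegral.integral_of_le hT.le, integral_Ioc_eq_integral_Ioo]
  rfl

theorem ae_timeMeasure {T : ℝ} {p : ℝ → Prop} :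
    (∀ᵐ t ∂timeMeasure T, p t) ↔ ∀ᵐ t, t ∈ Ioo 0 T → p t :=
  ae_restrict_iff' measurableSet_Ioo

theorem integrable_smul_of_hasCompactSupport {T : ℝ} {ψ : ℝ → ℝ} {k : ℝ → X}
    (hψ : Continuous ψ) (hψc : HasCompactSupport ψ) (hk : Integrable k (timeMeasure T)) :
    Integrable (fun t => ψ t • k t) (timeMeasure T) := by
  obtain ⟨C, hC⟩ := hψ.bounded_above_of_compact_support hψc
  exact hk.bdd_smul C hψ.aestronglyMeasurable (ae_of_all _ hC)

theorem continuousOn_primitive {T : ℝ} (hT : 0 < T) {f : ℝ → X}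
    (hf : Integrable f (timeMeasure T)) :
    ContinuousOn (fun t => ∫ s in (0 : ℝ)..t, f s) (Icc 0 T) := by
  rw [integrable_timeMeasure_iff hT] at hf
  have := (hf.absolutelyContinuousOnInterval_primitive (c := 0) left_mem_uIcc).continuousOn
  rwa [uIcc_of_le hT.le] at this

theorem HasWeakTimeDeriv.sub {T : ℝ} {f f' g g' : ℝ → X}
    (h1 : HasWeakTimeDeriv T f f') (h2 : HasWeakTimeDeriv T g g')
    (hf : Integrable f (timeMeasure T)) (hf' : Integrable f' (timeMeasure T))
    (hg : Integrable g (timeMeasure T)) (hg' : Integrable g' (timeMeasure T)) :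
    HasWeakTimeDeriv T (fun t => f t - g t) (fun t => f' t - g' t) := by
  intro φ hφ hφc hφs
  have hdφ : Continuous (deriv φ) := hφ.continuous_deriv (by norm_num)
  simp only [smul_sub]
  rw [integral_sub (integrable_smul_of_hasCompactSupport hdφ hφc.deriv hf) (integrable_smul_of_hasCompactSupport hdφ hφc.deriv hg),
    integral_sub (integrable_smul_of_hasCompactSupport hφ.continuous hφc hf') (integrable_smul_of_hasCompactSupport hφ.continuous hφc hg'),
    h1 φ hφ hφc hφs, h2 φ hφ hφc hφs]
  abel

variable [CompleteSpace X]

/-- Integrate the derivative of the product of φ and the primitive over (0, T); the boundary terms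
vanish because φ has support in the open interval. -/
theorem hasWeakTimeDeriv_add_primitive {T : ℝ} (hT : 0 < T) {f : ℝ → X} (c : X)
    (hf : Integrable f (timeMeasure T)) :
    HasWeakTimeDeriv T (fun t => c + ∫ s in (0 : ℝ)..t, f s) f := by
  intro φ hφ hφc hφs
  rw [integrable_timeMeasure_iff hT] at hf
  rw [integral_timeMeasure hT, integral_timeMeasure hT]
  have hac := hf.absolutelyContinuousOnInterval_primitive (c := 0) left_mem_uIcc
  have hac1 : AbsolutelyContinuousOnInterval (fun t => c + ∫ s in (0 : ℝ)..t, f s) 0 T :=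
    hac.of_dist_le (C := 1) fun x _ y _ => by rw [dist_add_left, one_mul]
  have hφac : AbsolutelyContinuousOnInterval φ 0 T :=
    (hφ.of_le (by exact_mod_cast le_top)).contDiffOn.absolutelyContinuousOnInterval
  have hac2 := hφac.smul hac1
  have hdφ : Continuous (deriv φ) := hφ.continuous_deriv (by norm_num)
  have i1 : IntervalIntegrable (fun t => deriv φ t • (c + ∫ s in (0 : ℝ)..t, f s)) volume 0 T :=
    (hdφ.continuousOn.smul hac1.continuousOn).intervalIntegrable
  have i2 : IntervalIntegrable (fun t => φ t • f t) volume 0 T :=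
    hf.continuousOn_smul hφ.continuous.continuousOn
  have h := hac2.eq_add_integral (i1.add i2) ?_ right_mem_uIcc
  · have h0 : φ 0 = 0 := image_eq_zero_of_notMem_tsupport fun h0 => lt_irrefl _ (hφs h0).1
    have h1 : φ T = 0 := image_eq_zero_of_notMem_tsupport fun h0 => lt_irrefl _ (hφs h0).2
    simp only [Pi.smul_apply', h0, h1, zero_smul, zero_add] at h
    rw [← add_eq_zero_iff_eq_neg, ← intervalIntegral.integral_add i1 i2]
    exact h.symm
  · filter_upwards [hf.ae_hasDerivAt_integral] with x hx hxT
    have h2 := ((hφ.differentiable (by simp)) x).hasDerivAt.smul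
      ((hx hxT 0 left_mem_uIcc).const_add c)
    rw [add_comm] at h2
    exact h2

theorem ae_eq_zero_of_forall_integral_smul_eq_zero {T : ℝ} {f : ℝ → X}
    (hf : Integrable f (timeMeasure T))
    (h : ∀ φ : ℝ → ℝ, ContDiff ℝ (⊤ : ℕ∞) φ → HasCompactSupport φ → tsupport φ ⊆ Ioo 0 T →
      ∫ t, φ t • f t ∂timeMeasure T = 0) : f =ᵐ[timeMeasure T] 0 := by
  refine ae_timeMeasure.2 ?_
  refine isOpen_Ioo.ae_eq_zero_of_integral_contDiff_smul_eq_zero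
    (IntegrableOn.locallyIntegrableOn hf) fun g hg hgc hgs => ?_
  rw [← h g hg hgc hgs]
  refine (setIntegral_eq_integral_of_forall_compl_eq_zero fun x hx => ?_).symm
  rw [image_eq_zero_of_notMem_tsupport fun hx' => hx (hgs hx'), zero_smul]

theorem HasWeakTimeDeriv.ae_eq {T : ℝ} {f f' g' : ℝ → X}
    (h1 : HasWeakTimeDeriv T f f') (h2 : HasWeakTimeDeriv T f g')
    (hf : Integrable f (timeMeasure T)) (hf' : Integrable f' (timeMeasure T))
    (hg' : Integrable g' (timeMeasure T)) : f' =ᵐ[timeMeasure T] g' := by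
  have h := ae_eq_zero_of_forall_integral_smul_eq_zero (hf'.sub hg') fun φ hφ hφc hφs => by
    have := h1.sub h2 hf hf' hf hg' φ hφ hφc hφs
    simp only [sub_self, smul_zero, integral_zero] at this
    exact neg_eq_zero.1 this.symm
  filter_upwards [h] with t ht
  exact sub_eq_zero.1 ht

/-- The du Bois-Reymond argument: fix a bump ρ of integral one. For a test function ψ, the function
ψ - (∫ψ)ρ has integral zero, hence is the derivative of a test function, and so ψ sees g only
through the constant ∫ρg. -/
theorem exists_ae_eq_const_of_hasWeakTimeDeriv_zero {T : ℝ} (hT : 0 < T) {g : ℝ → X}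
    (hg : Integrable g (timeMeasure T)) (h : HasWeakTimeDeriv T g fun _ => 0) :
    ∃ c, ∀ᵐ t ∂timeMeasure T, g t = c := by
  let b : ContDiffBump (T / 2) := ⟨T / 8, T / 4, by positivity, by linarith⟩
  have hbsupp : tsupport (b.normed volume) ⊆ Icc (T / 4) (3 * T / 4) := by
    rw [b.tsupport_normed_eq, Real.closedBall_eq_Icc]
    refine Icc_subset_Icc ?_ ?_ <;> simp only [b] <;> linarith
  set ρ : ℝ → ℝ := b.normed volume
  have hρ : ContDiff ℝ (⊤ : ℕ∞) ρ := b.contDiff_normed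
  have hρi : ∫ x, ρ x = 1 := b.integral_normed
  refine ⟨∫ t, ρ t • g t ∂timeMeasure T, ?_⟩
  set c := ∫ t, ρ t • g t ∂timeMeasure T with hc
  have h0 := ae_eq_zero_of_forall_integral_smul_eq_zero (f := fun t => g t - c)
    (hg.sub (integrable_const c)) ?_
  · filter_upwards [h0] with t ht
    exact sub_eq_zero.1 ht
  intro ψ hψ hψc hψs
  obtain ⟨α, β, hα, hβ, hαβ⟩ : ∃ α β : ℝ, 0 < α ∧ β < T ∧ tsupport ψ ⊆ Icc α β := by
    by_cases hne : (tsupport ψ).Nonempty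
    · obtain ⟨α, hα, hα'⟩ := hψc.isCompact.exists_isLeast hne
      obtain ⟨β, hβ, hβ'⟩ := hψc.isCompact.exists_isGreatest hne
      exact ⟨α, β, (hψs hα).1, (hψs hβ).2, fun x hx => ⟨hα' hx, hβ' hx⟩⟩
    · rw [not_nonempty_iff_eq_empty] at hne
      exact ⟨1, T - 1, one_pos, by linarith, by simp [hne]⟩
  -- The interval [a, d] is compact in (0, T) and contains the supports of both ψ and ρ, hence that
  -- of the primitive φ of k.
  set a := min α (T / 4)
  set d := max β (3 * T / 4)
  have ha : 0 < a := lt_min hα (by linarith)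
  have hd : d < T := max_lt hβ (by linarith)
  have had : a ≤ d := (min_le_right _ _).trans (le_trans (by linarith) (le_max_right _ _))
  set I := ∫ x, ψ x
  set k : ℝ → ℝ := fun t => ψ t - I * ρ t with hk
  have hksm : ContDiff ℝ (⊤ : ℕ∞) k := hψ.sub (contDiff_const.mul hρ)
  have hk0 : ∀ x, x ∉ Icc a d → k x = 0 := by
    intro x hx
    have h1 : ψ x = 0 := image_eq_zero_of_notMem_tsupport fun hx' => hx
      ⟨(min_le_left _ _).trans (hαβ hx').1, (hαβ hx').2.trans (le_max_left _ _)⟩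
    have h2 : ρ x = 0 := image_eq_zero_of_notMem_tsupport fun hx' => hx
      ⟨(min_le_right _ _).trans (hbsupp hx').1, (hbsupp hx').2.trans (le_max_right _ _)⟩
    simp [hk, h1, h2]
  have hkint : ∫ x, k x = 0 := by
    rw [hk, integral_sub (hψ.continuous.integrable_of_hasCompactSupport hψc)
      ((hρ.continuous.integrable_of_hasCompactSupport b.hasCompactSupport_normed).const_mul I),
      integral_const_mul, hρi, mul_one, sub_self]
  set φ : ℝ → ℝ := fun t => ∫ s in a..t, k s with hφ
  have hφd : ∀ t, HasDerivAt φ (k t) t := fun t =>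
    intervalIntegral.integral_hasDerivAt_right (hksm.continuous.intervalIntegrable _ _)
      (hksm.continuous.stronglyMeasurableAtFilter _ _) hksm.continuous.continuousAt
  have hderiv : deriv φ = k := funext fun t => (hφd t).deriv
  have hφsm : ContDiff ℝ (⊤ : ℕ∞) φ := by
    rw [contDiff_infty_iff_deriv]
    exact ⟨fun t => (hφd t).differentiableAt, hderiv ▸ hksm⟩
  have hφ0 : ∀ t, t ∉ Icc a d → φ t = 0 := by
    intro t ht
    rcases lt_or_ge t a with h1 | h1
    · refine intervalIntegral.integral_zero_ae ?_
      have : ∀ᵐ x : ℝ, x ≠ a := by simp [ae_iff]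
      filter_upwards [this] with x hxa hx
      rw [uIoc_of_ge h1.le] at hx
      exact hk0 x fun h2 => hxa (le_antisymm hx.2 h2.1)
    · have h2 : d < t := not_le.1 fun h3 => ht ⟨h1, h3⟩
      rw [hφ]
      simp only
      rw [intervalIntegral.integral_of_le h1, ← integral_Icc_eq_integral_Ioc, ← hkint]
      exact setIntegral_eq_integral_of_forall_compl_eq_zero fun x hx =>
        hk0 x fun h3 => hx ⟨h3.1, h3.2.trans h2.le⟩
  have hφt : tsupport φ ⊆ Icc a d :=
    closure_minimal (fun x hx => by by_contra h1; exact hx (hφ0 x h1)) isClosed_Icc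
  have hφc : HasCompactSupport φ := isCompact_Icc.of_isClosed_subset (isClosed_tsupport _) hφt
  -- As φ' = ψ - Iρ, the hypothesis says that ∫ψg = I∫ρg = I c.
  have key := h φ hφsm hφc (hφt.trans fun x hx => ⟨ha.trans_le hx.1, hx.2.trans_lt hd⟩)
  have hρc : HasCompactSupport ρ := b.hasCompactSupport_normed
  have j1 := integrable_smul_of_hasCompactSupport hψ.continuous hψc hg
  have j2 := integrable_smul_of_hasCompactSupport hρ.continuous hρc hg
  simp only [hderiv, hk, smul_zero, integral_zero, neg_zero, sub_smul, mul_smul] at key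
  rw [integral_sub j1 (g := fun t => I • ρ t • g t) (j2.smul I), integral_smul, ← hc, sub_eq_zero] at key
  simp only [smul_sub]
  rw [integral_sub j1 (integrable_smul_of_hasCompactSupport hψ.continuous hψc (integrable_const c)), key, integral_smul_const]
  have : ∫ t, ψ t ∂timeMeasure T = I :=
    setIntegral_eq_integral_of_forall_compl_eq_zero fun x hx =>
      image_eq_zero_of_notMem_tsupport fun h3 => hx (hψs h3)
  rw [this, sub_self]

/-- A function with integrable weak derivative is almost everywhere a primitive of it. -/
theorem HasWeakTimeDeriv.exists_ae_eq_add_primitive {T : ℝ} (hT : 0 < T) {f f' : ℝ → X}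
    (h : HasWeakTimeDeriv T f f') (hf : Integrable f (timeMeasure T))
    (hf' : Integrable f' (timeMeasure T)) :
    ∃ c, ∀ᵐ t ∂timeMeasure T, f t = c + ∫ s in (0 : ℝ)..t, f' s := by
  have h0 := hasWeakTimeDeriv_add_primitive hT 0 hf'
  have hF : Integrable (fun t => 0 + ∫ s in (0 : ℝ)..t, f' s) (timeMeasure T) :=
    integrable_of_continuousOn (continuousOn_const.add (continuousOn_primitive hT hf'))
  have h1 := h.sub h0 hf hf' hF hf'
  simp only [sub_self] at h1
  obtain ⟨c, hc⟩ := exists_ae_eq_const_of_hasWeakTimeDeriv_zero hT (hf.sub hF) h1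
  refine ⟨c, ?_⟩
  filter_upwards [hc] with t ht
  simp only [Pi.sub_apply, zero_add] at ht
  rw [← ht, sub_add_cancel]

/-- The differential form of Gronwall's lemma is applied to the right-hand side of `h`, which is
differentiable from the right even though φ is merely continuous. -/
theorem le_mul_exp_of_le_add_mul_integral {T a C : ℝ} {φ : ℝ → ℝ} (hφ : ContinuousOn φ (Icc 0 T))
    (hC : 0 ≤ C) (h : ∀ t ∈ Icc 0 T, φ t ≤ a + C * ∫ s in (0 : ℝ)..t, φ s) :
    ∀ t ∈ Icc 0 T, φ t ≤ a * Real.exp (C * t) := by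
  intro t ht
  have hT : 0 ≤ T := ht.1.trans ht.2
  have hI : ∀ x ∈ Icc 0 T, IntervalIntegrable φ volume 0 x := fun x hx =>
    ContinuousOn.intervalIntegrable (hφ.mono (by
      rw [uIcc_of_le hx.1]; exact Icc_subset_Icc_right hx.2))
  have hcont : ContinuousOn (fun t => a + C * ∫ s in (0 : ℝ)..t, φ s) (Icc 0 T) := by
    have h1 := (hI T ⟨hT, le_rfl⟩).absolutelyContinuousOnInterval_primitive
      (c := 0) left_mem_uIcc
    have h2 := h1.continuousOn
    rw [uIcc_of_le hT] at h2
    exact continuousOn_const.add (continuousOn_const.mul h2)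
  have key := le_gronwallBound_of_liminf_deriv_right_le (f' := fun t => C * φ t) (δ := a) (K := C)
    (ε := 0) hcont ?_ (by simp) ?_ t ht
  · rw [sub_zero, gronwallBound_ε0] at key
    exact (h t ht).trans key
  · intro x hx r
    refine HasDerivWithinAt.liminf_right_slope_le (f := fun t => a + C * ∫ s in (0 : ℝ)..t, φ s) ?_
    refine HasDerivWithinAt.const_add a (HasDerivWithinAt.const_mul C ?_)
    have hx' : Icc 0 T ∈ 𝓝[>] x :=
      mem_of_superset (Ioo_mem_nhdsGT hx.2) fun y hy => ⟨hx.1.trans hy.1.le, hy.2.le⟩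
    refine intervalIntegral.integral_hasDerivWithinAt_right (hI x ⟨hx.1, hx.2.le⟩)
      (t := Ioi x) ?_ ?_
    · exact ⟨Icc 0 T, hx', hφ.aestronglyMeasurable measurableSet_Icc⟩
    · exact (hφ x ⟨hx.1, hx.2.le⟩).mono_of_mem_nhdsWithin hx'
  · intro x hx
    rw [add_zero]
    exact mul_le_mul_of_nonneg_left (h x ⟨hx.1, hx.2.le⟩) hC

/-- Gronwall's inequality in the form of an energy estimate. -/
theorem add_integral_le_exp_mul_integral {T C : ℝ} (hT : 0 < T) (hC : 0 ≤ C) {φ φ' q G : ℝ → ℝ}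
    (hφ' : Integrable φ' (timeMeasure T)) (hq : Integrable q (timeMeasure T))
    (hG : Integrable G (timeMeasure T)) (hφ : ∀ t ∈ Icc 0 T, φ t = ∫ s in (0 : ℝ)..t, φ' s)
    (hq0 : ∀ t, 0 ≤ q t) (hG0 : ∀ t, 0 ≤ G t)
    (h : ∀ᵐ t ∂timeMeasure T, φ' t + q t ≤ C * φ t + G t) :
    ∀ t ∈ Icc 0 T, φ t + ∫ s in (0 : ℝ)..t, q s ≤
      Real.exp (C * T) * ∫ s, G s ∂timeMeasure T := by
  have hcφ : ContinuousOn φ (Icc 0 T) := (continuousOn_primitive hT hφ').congr hφ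
  have hcq := continuousOn_primitive hT hq
  have hI : ∀ {k : ℝ → ℝ}, Integrable k (timeMeasure T) → ∀ x ∈ Icc 0 T,
      IntervalIntegrable k volume 0 x := fun hk x hx =>
    ((integrable_timeMeasure_iff hT).1 hk).mono_set
      (uIcc_subset_uIcc left_mem_uIcc (by rwa [uIcc_of_le hT.le]))
  have hGT : 0 ≤ ∫ s, G s ∂timeMeasure T := integral_nonneg hG0
  have key := le_mul_exp_of_le_add_mul_integral (T := T) (a := ∫ s, G s ∂timeMeasure T) (C := C)
    (hcφ.add hcq) hC ?_
  · intro t ht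
    refine (key t ht).trans ?_
    rw [mul_comm]
    have : C * t ≤ C * T := mul_le_mul_of_nonneg_left ht.2 hC
    gcongr
  · intro t ht
    rw [ae_timeMeasure] at h
    have iφ := integrable_of_continuousOn hcφ
    have iQ := integrable_of_continuousOn hcq
    have h1 : ∫ s in (0 : ℝ)..t, (φ' s + q s) ≤ ∫ s in (0 : ℝ)..t, (C * φ s + G s) := by
      refine intervalIntegral.integral_mono_ae_restrict ht.1
        ((hI hφ' t ht).add (hI hq t ht)) (((hI iφ t ht).const_mul C).add (hI hG t ht)) ?_
      rw [← restrict_Ioo_eq_restrict_Icc]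
      refine (ae_restrict_iff' measurableSet_Ioo).2 ?_
      filter_upwards [h] with x hx hx'
      exact hx ⟨hx'.1, hx'.2.trans_le ht.2⟩
    rw [intervalIntegral.integral_add (hI hφ' t ht) (hI hq t ht), ← hφ t ht,
      intervalIntegral.integral_add ((hI iφ t ht).const_mul C) (hI hG t ht),
      intervalIntegral.integral_const_mul] at h1
    have h2 : ∫ s in (0 : ℝ)..t, G s ≤ ∫ s, G s ∂timeMeasure T := by
      rw [integral_timeMeasure hT]
      exact intervalIntegral.integral_mono_interval le_rfl ht.1 ht.2 (ae_of_all _ hG0)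
        (hI hG T ⟨hT.le, le_rfl⟩)
    -- The integrand is enlarged by the nonnegative primitive of q, so that the inequality closes
    -- for φ + ∫q and both terms are controlled at once.
    have h3 : ∫ s in (0 : ℝ)..t, φ s ≤
        ∫ s in (0 : ℝ)..t, (φ s + ∫ x in (0 : ℝ)..s, q x) := by
      refine intervalIntegral.integral_mono_on ht.1 (hI iφ t ht)
        ((hI iφ t ht).add (hI iQ t ht)) fun x hx => ?_
      have : 0 ≤ ∫ x in (0 : ℝ)..x, q x := intervalIntegral.integral_nonneg hx.1 fun s _ => hq0 s
      linarith
    have h4 := mul_le_mul_of_nonneg_left h3 hC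
    simp only [Pi.add_apply]
    linarith

end TimeDependent

/-! ### Convex minimization, Lagrange multipliers, and a substitute for weak limits -/

section ConvexAnalysis

/-- Convexity of an extended-valued functional. -/
def ConvexENN {V : Type*} [AddCommGroup V] [Module ℝ V] (Ψ : V → ℝ≥0∞) : Prop :=
  ∀ (x y : V) (a b : ℝ), 0 ≤ a → 0 ≤ b → a + b = 1 →
    Ψ (a • x + b • y) ≤ ENNReal.ofReal a * Ψ x + ENNReal.ofReal b * Ψ y

theorem ConvexENN.toReal_le {V : Type*} [AddCommGroup V] [Module ℝ V] {Ψ : V → ℝ≥0∞}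
    (h : ConvexENN Ψ) {x y : V} (hx : Ψ x ≠ ∞) (hy : Ψ y ≠ ∞) {a b : ℝ} (ha : 0 ≤ a) (hb : 0 ≤ b)
    (hab : a + b = 1) : Ψ (a • x + b • y) ≠ ∞ ∧
      (Ψ (a • x + b • y)).toReal ≤ a * (Ψ x).toReal + b * (Ψ y).toReal := by
  have h1 := h x y a b ha hb hab
  have hx' : ENNReal.ofReal a * Ψ x ≠ ∞ := ENNReal.mul_ne_top ENNReal.ofReal_ne_top hx
  have hy' : ENNReal.ofReal b * Ψ y ≠ ∞ := ENNReal.mul_ne_top ENNReal.ofReal_ne_top hy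
  have h2 := ENNReal.add_ne_top.2 ⟨hx', hy'⟩
  refine ⟨ne_top_of_le_ne_top h2 h1, ?_⟩
  have h3 := ENNReal.toReal_mono h2 h1
  rwa [ENNReal.toReal_add hx' hy', ENNReal.toReal_mul, ENNReal.toReal_mul,
    ENNReal.toReal_ofReal ha, ENNReal.toReal_ofReal hb] at h3

theorem LowerSemicontinuous.le_of_tendsto_of_eventually_le {V : Type*} [TopologicalSpace V]
    {Ψ : V → ℝ≥0∞} (h : LowerSemicontinuous Ψ) {ι : Type*} {l : Filter ι} [l.NeBot] {x : ι → V}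
    {y : V} (hx : Tendsto x l (𝓝 y)) {c : ℝ≥0∞} (hc : ∀ᶠ n in l, Ψ (x n) ≤ c) : Ψ y ≤ c := by
  by_contra hlt
  obtain ⟨n, h1, h2⟩ := ((hx.eventually (h y c (not_le.1 hlt))).and hc).exists
  exact absurd h2 (not_le.2 h1)

variable {V : Type*} [NormedAddCommGroup V] [InnerProductSpace ℝ V] [CompleteSpace V]

/-- Elliptic variational inequalities have solutions. -/
theorem exists_variationalInequality (q : V →L[ℝ] V →L[ℝ] ℝ) (hsymm : ∀ x y, q x y = q y x)
    {α : ℝ} (hα : 0 < α) (hq : ∀ v, α * ‖v‖ ^ 2 ≤ q v v) (ℓ : V →L[ℝ] ℝ) {Ψ : V → ℝ≥0∞}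
    (hconv : ConvexENN Ψ) (hlsc : LowerSemicontinuous Ψ) (hfin : ∃ v, Ψ v ≠ ∞) :
    ∃ y, Ψ y ≠ ∞ ∧ ∀ v, Ψ v ≠ ∞ →
      q y (y - v) + (Ψ y).toReal ≤ ℓ (y - v) + (Ψ v).toReal := by
  set g : V → ℝ := fun v => q v v / 2 - ℓ v with hg
  set J : V → ℝ := fun v => g v + (Ψ v).toReal with hJ
  have hgc : Continuous g := by
    have : Continuous fun v => q v v := q.continuous.clm_apply continuous_id
    fun_prop
  set D : Set V := {v | Ψ v ≠ ∞}
  have hlow : ∀ v, -(‖ℓ‖ ^ 2 / (2 * α)) ≤ J v := by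
    intro v
    have h1 := hq v
    have h2 : ℓ v ≤ ‖ℓ‖ * ‖v‖ := (le_abs_self _).trans (ℓ.le_opNorm v)
    have h3 : (0 : ℝ) ≤ (Ψ v).toReal := ENNReal.toReal_nonneg
    have h4 : -(‖ℓ‖ ^ 2 / (2 * α)) ≤ α * ‖v‖ ^ 2 / 2 - ‖ℓ‖ * ‖v‖ := by
      rw [neg_le_iff_add_nonneg]
      have : α * ‖v‖ ^ 2 / 2 - ‖ℓ‖ * ‖v‖ + ‖ℓ‖ ^ 2 / (2 * α) = (α * ‖v‖ - ‖ℓ‖) ^ 2 / (2 * α) := by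
        field_simp
        ring
      rw [this]
      positivity
    simp only [hJ, hg]
    linarith
  have hbdd : BddBelow (J '' D) := ⟨_, by rintro _ ⟨v, -, rfl⟩; exact hlow v⟩
  have hne : (J '' D).Nonempty := hfin.elim fun v hv => ⟨_, v, hv, rfl⟩
  set m := sInf (J '' D) with hm
  have hm_le : ∀ v ∈ D, m ≤ J v := fun v hv => csInf_le hbdd ⟨v, hv, rfl⟩
  have hseq : ∀ n : ℕ, ∃ v ∈ D, J v < m + 1 / ((n : ℝ) + 1) := by
    intro n
    have h1 : sInf (J '' D) < m + 1 / ((n : ℝ) + 1) := by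
      rw [← hm]
      have : (0 : ℝ) < 1 / ((n : ℝ) + 1) := by positivity
      linarith
    obtain ⟨_, ⟨v, hv, rfl⟩, hlt⟩ := exists_lt_of_csInf_lt hne h1
    exact ⟨v, hv, hlt⟩
  choose x hxD hxJ using hseq
  -- Comparison of the infimum with the value at the midpoint: by coercivity of q the gap controls
  -- ‖a - b‖², so minimizing sequences are Cauchy.
  have hmid : ∀ a ∈ D, ∀ b ∈ D, α / 4 * ‖a - b‖ ^ 2 ≤ (J a - m) + (J b - m) := by
    intro a ha b hb
    obtain ⟨h1, h2⟩ := hconv.toReal_le ha hb (a := 1 / 2) (b := 1 / 2) (by norm_num)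
      (by norm_num) (by norm_num)
    have h3 := hm_le _ h1
    have h4 := hq (a - b)
    have h5 : q (a - b) (a - b) = q a a - 2 * q a b + q b b := by
      simp only [map_sub, sub_apply, hsymm b a]
      ring
    have h6 : g ((1 / 2 : ℝ) • a + (1 / 2 : ℝ) • b) =
        (q a a + 2 * q a b + q b b) / 8 - (ℓ a + ℓ b) / 2 := by
      simp only [hg, map_add, map_smul, add_apply,
        smul_apply, smul_eq_mul, hsymm b a]
      ring
    simp only [hJ] at h3 ⊢
    rw [h6] at h3
    rw [h5] at h4
    simp only [hg]
    nlinarith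
  have hcau : CauchySeq x := by
    rw [Metric.cauchySeq_iff']
    intro ε hε
    obtain ⟨N, hN⟩ := exists_nat_one_div_lt (show 0 < α * ε ^ 2 / 8 by positivity)
    refine ⟨N, fun n hn => ?_⟩
    have h1 := hmid _ (hxD n) _ (hxD N)
    have h2 := hxJ n
    have h3 := hxJ N
    have h4 : 1 / ((n : ℝ) + 1) ≤ 1 / ((N : ℝ) + 1) := by
      have : (N : ℝ) ≤ n := by exact_mod_cast hn
      gcongr
    rw [dist_eq_norm]
    have h5 : ‖x n - x N‖ ^ 2 < ε ^ 2 := by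
      have : α / 4 * ‖x n - x N‖ ^ 2 < α / 4 * ε ^ 2 := by linarith
      exact lt_of_mul_lt_mul_left this (by positivity)
    exact lt_of_pow_lt_pow_left₀ 2 hε.le h5
  obtain ⟨y, hy⟩ := cauchySeq_tendsto_of_complete hcau
  -- The quadratic part g is continuous; together with lower semicontinuity of Ψ this passes the
  -- bound Ψ(x n) ≤ m + 1/(n+1) - g(x n) to the limit.
  have hgy : Tendsto (fun n : ℕ => m + 1 / ((n : ℝ) + 1) - g (x n)) atTop (𝓝 (m - g y)) := by
    have h1 := (tendsto_const_nhds (x := m)).add tendsto_one_div_add_atTop_nhds_zero_nat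
    rw [add_zero] at h1
    exact h1.sub ((hgc.tendsto y).comp hy)
  have hbd : ∀ n, (Ψ (x n)).toReal ≤ m + 1 / ((n : ℝ) + 1) - g (x n) := fun n => by
    have := (hxJ n).le
    simp only [hJ] at this
    linarith
  have hnn : 0 ≤ m - g y := ge_of_tendsto' hgy fun n => ENNReal.toReal_nonneg.trans (hbd n)
  have hΨy : ∀ ε > 0, Ψ y ≤ ENNReal.ofReal (m - g y + ε) := by
    intro ε hε
    refine hlsc.le_of_tendsto_of_eventually_le hy ?_
    filter_upwards [hgy.eventually_lt_const (show m - g y < m - g y + ε by linarith)] with n hn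
    rw [← ENNReal.ofReal_toReal (hxD n)]
    exact ENNReal.ofReal_le_ofReal ((hbd n).trans hn.le)
  have hyD : Ψ y ≠ ∞ := ne_top_of_le_ne_top ENNReal.ofReal_ne_top (hΨy 1 one_pos)
  have hJy : J y ≤ m := by
    have : (Ψ y).toReal ≤ m - g y := by
      refine le_of_forall_pos_le_add fun ε hε => ?_
      have := ENNReal.toReal_mono ENNReal.ofReal_ne_top (hΨy ε hε)
      rwa [ENNReal.toReal_ofReal (by linarith)] at this
    simp only [hJ]
    linarith
  refine ⟨y, hyD, fun v hv => ?_⟩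
  -- The first variation: minimality of y against (1 - t)y + tv, divided by t. The last term is the
  -- quadratic remainder, which vanishes as t → 0.
  have hvar : ∀ t ∈ Ioo (0 : ℝ) 1, q y (y - v) + (Ψ y).toReal ≤
      ℓ (y - v) + (Ψ v).toReal + t * (q (v - y) (v - y) / 2) := by
    intro t ht
    obtain ⟨h1, h2⟩ := hconv.toReal_le hyD hv (a := 1 - t) (b := t) (by linarith [ht.2])
      ht.1.le (by ring)
    have h3 := hm_le _ h1
    have h6 : g ((1 - t) • y + t • v) = g y + t * (q y (v - y) - ℓ (v - y))
        + t ^ 2 * (q (v - y) (v - y) / 2) := by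
      simp only [hg, map_add, map_smul, map_sub, add_apply,
        sub_apply,
        smul_apply, smul_eq_mul, hsymm v y]
      ring
    simp only [hJ] at h3 hJy
    rw [h6] at h3
    have h7 : 0 ≤ t * (q y (v - y) - ℓ (v - y) + t * (q (v - y) (v - y) / 2)
        + (Ψ v).toReal - (Ψ y).toReal) := by nlinarith
    have h8 := nonneg_of_mul_nonneg_right h7 ht.1
    have h9 : q y (v - y) = - q y (y - v) := by rw [← map_neg, neg_sub]
    have h10 : ℓ (v - y) = - ℓ (y - v) := by rw [← map_neg, neg_sub]
    rw [h9, h10] at h8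
    linarith
  have hlim : Tendsto (fun t : ℝ => ℓ (y - v) + (Ψ v).toReal + t * (q (v - y) (v - y) / 2))
      (𝓝[>] 0) (𝓝 (ℓ (y - v) + (Ψ v).toReal + 0 * (q (v - y) (v - y) / 2))) :=
    Tendsto.mono_left (Continuous.tendsto (by fun_prop) 0) nhdsWithin_le_nhds
  rw [zero_mul, add_zero] at hlim
  refine ge_of_tendsto hlim ?_
  filter_upwards [Ioo_mem_nhdsGT (zero_lt_one' ℝ)] with t ht using hvar t ht

/-- Elliptic variational inequalities under a linear constraint, with a Lagrange multiplier. -/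
theorem exists_variationalInequality_multiplier (q : V →L[ℝ] V →L[ℝ] ℝ)
    (hsymm : ∀ x y, q x y = q y x)
    {α : ℝ} (hα : 0 < α) (hq : ∀ v, α * ‖v‖ ^ 2 ≤ q v v) (ℓ k : V →L[ℝ] ℝ) {Ψ : V → ℝ≥0∞}
    (hconv : ConvexENN Ψ) (hlsc : LowerSemicontinuous Ψ) {v₀ v₁ v₂ : V} (h₀ : Ψ v₀ ≠ ∞)
    (h₁ : Ψ v₁ ≠ ∞) (h₂ : Ψ v₂ ≠ ∞) (hk₁ : k v₁ < k v₀) (hk₂ : k v₀ < k v₂) :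
    ∃ (y : V) (c : ℝ), Ψ y ≠ ∞ ∧ k y = k v₀ ∧ ∀ v, Ψ v ≠ ∞ →
      q y (y - v) + (Ψ y).toReal ≤ ℓ (y - v) + c * k (y - v) + (Ψ v).toReal := by
  classical
  set m := k v₀ with hm
  -- The constraint is included in the convex functional as the indicator of the hyperplane k = m.
  set Ψ' : V → ℝ≥0∞ := fun v => if k v = m then Ψ v else ∞ with hΨ'
  have hpos : ∀ v, k v = m → Ψ' v = Ψ v := fun v hv => if_pos hv
  have hfin : ∀ v, Ψ' v ≠ ∞ → k v = m := fun v hv => by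
    by_contra hne
    exact hv (if_neg hne)
  have hconv' : ConvexENN Ψ' := by
    intro x y a b ha hb hab
    rcases ha.eq_or_lt with rfl | ha'
    · obtain rfl : b = 1 := by linarith
      simp
    rcases hb.eq_or_lt with rfl | hb'
    · obtain rfl : a = 1 := by linarith
      simp
    by_cases hx : k x = m
    · by_cases hy : k y = m
      · have : k (a • x + b • y) = m := by
          simp only [map_add, map_smul, hx, hy, smul_eq_mul, ← add_mul, hab, one_mul]
        rw [hpos _ hx, hpos _ hy, hpos _ this]
        exact hconv x y a b ha hb hab
      · have : Ψ' y = ∞ := if_neg hy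
        rw [this, ENNReal.mul_top (by simpa using hb'), add_top]
        exact le_top
    · have : Ψ' x = ∞ := if_neg hx
      rw [this, ENNReal.mul_top (by simpa using ha'), top_add]
      exact le_top
  have hlsc' : LowerSemicontinuous Ψ' := by
    rw [lowerSemicontinuous_iff_isClosed_preimage]
    intro c
    by_cases hc : c = ∞
    · simp [hc]
    have : Ψ' ⁻¹' Iic c = Ψ ⁻¹' Iic c ∩ k ⁻¹' {m} := by
      ext v
      simp only [mem_preimage, mem_Iic, mem_inter_iff, mem_singleton_iff, hΨ']
      by_cases hv : k v = m
      · simp [hv]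
      · simp [hv, hc]
    rw [this]
    exact (lowerSemicontinuous_iff_isClosed_preimage.1 hlsc c).inter
      (isClosed_singleton.preimage k.continuous)
  obtain ⟨y, hy, hvi⟩ := exists_variationalInequality q hsymm hα hq ℓ hconv' hlsc'
    ⟨v₀, by rwa [hpos v₀ rfl]⟩
  have hky := hfin y hy
  rw [hpos y hky] at hy
  -- G is the slack of the inequality without multiplier. It is convex and nonnegative on the
  -- hyperplane, and a multiplier is a number c with c(k v - m) ≤ G v everywhere: a Hahn–Banach
  -- argument in one dimension.
  set G : V → ℝ := fun v => ℓ (y - v) - q y (y - v) + (Ψ v).toReal - (Ψ y).toReal with hG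
  have hG0 : ∀ v, Ψ v ≠ ∞ → k v = m → 0 ≤ G v := by
    intro v hv hkv
    have := hvi v (by rwa [hpos v hkv])
    rw [hpos y hky, hpos v hkv] at this
    simp only [hG]
    linarith
  -- The weights put the convex combination of v and w on the hyperplane, where G ≥ 0. Hence each
  -- slope from the left is at most each slope from the right.
  have hsep : ∀ v w, Ψ v ≠ ∞ → Ψ w ≠ ∞ → k v < m → m < k w →
      G v / (k v - m) ≤ G w / (k w - m) := by
    intro v w hv hw hkv hkw
    set s := k w - k v with hs
    have hs0 : 0 < s := by linarith
    obtain ⟨h3, h4⟩ := hconv.toReal_le hv hw (a := (k w - m) / s) (b := (m - k v) / s)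
      (div_nonneg (by linarith) hs0.le) (div_nonneg (by linarith) hs0.le) (by
        rw [← add_div, hs]
        rw [div_eq_one_iff_eq hs0.ne']
        ring)
    have h5 := hG0 _ h3 (by
      simp only [map_add, map_smul, smul_eq_mul]
      field_simp
      rw [hs]
      ring)
    have hab : (k w - m) / s + (m - k v) / s = 1 := by
      rw [← add_div, hs, div_eq_one_iff_eq hs0.ne']
      ring
    have h6 : G (((k w - m) / s) • v + ((m - k v) / s) • w) ≤
        (k w - m) / s * G v + (m - k v) / s * G w := by
      have e1 : ∀ f : V →L[ℝ] ℝ, f (y - (((k w - m) / s) • v + ((m - k v) / s) • w)) =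
          (k w - m) / s * f (y - v) + (m - k v) / s * f (y - w) := by
        intro f
        simp only [map_sub, map_add, map_smul, smul_eq_mul]
        linear_combination (-f y) * hab
      simp only [hG, e1]
      have e2 : (Ψ y).toReal = (k w - m) / s * (Ψ y).toReal + (m - k v) / s * (Ψ y).toReal := by
        rw [← add_mul, hab, one_mul]
      linarith
    have h7 : 0 ≤ (k w - m) * G v + (m - k v) * G w := by
      have h8 := mul_nonneg hs0.le (h5.trans h6)
      have h9 : s * ((k w - m) / s * G v + (m - k v) / s * G w) =
          (k w - m) * G v + (m - k v) * G w := by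
        field_simp
      rwa [h9] at h8
    have e3 : G v / (k v - m) = -(G v) / (m - k v) := by
      rw [← neg_sub m (k v), div_neg, neg_div]
    rw [e3, div_le_div_iff₀ (by linarith) (by linarith)]
    linarith
  -- The slopes from the right. The set is nonempty because of v₂ and bounded below because of v₁;
  -- its infimum is a multiplier.
  set S : Set ℝ := {c | ∃ w, Ψ w ≠ ∞ ∧ m < k w ∧ c = G w / (k w - m)} with hS
  have hSb : ∀ v, Ψ v ≠ ∞ → k v < m → ∀ c ∈ S, G v / (k v - m) ≤ c := by
    rintro v hv hkv _ ⟨w, hw, hkw, rfl⟩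
    exact hsep v w hv hw hkv hkw
  have hSne : S.Nonempty := ⟨_, v₂, h₂, hk₂, rfl⟩
  have hSbdd : BddBelow S := ⟨_, fun c hc => hSb v₁ h₁ hk₁ c hc⟩
  refine ⟨y, sInf S, hy, hky, fun v hv => ?_⟩
  have main : sInf S * (k v - m) ≤ G v := by
    rcases lt_trichotomy (k v) m with h | h | h
    · have h1 := le_csInf hSne (hSb v hv h)
      rw [div_le_iff_of_neg (by linarith)] at h1
      exact h1
    · rw [h, sub_self, mul_zero]
      exact hG0 v hv h
    · have h1 : sInf S ≤ G v / (k v - m) := csInf_le hSbdd ⟨v, hv, h, rfl⟩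
      rwa [le_div_iff₀ (by linarith)] at h1
  have e : k (y - v) = -(k v - m) := by rw [map_sub, hky]; ring
  simp only [hG] at main
  rw [e]
  linarith

/-- A bounded sequence has a point lying in all closed convex sets in which the sequence
eventually lies. -/
theorem exists_mem_of_eventually_mem_convex {x : ℕ → V} {C : ℝ} (hC : ∀ n, ‖x n‖ ≤ C) :
    ∃ z, ∀ S : Set V, IsClosed S → Convex ℝ S → (∀ᶠ n in atTop, x n ∈ S) → z ∈ S := by
  -- Closed convex hulls of the tails. Their elements of least norm have increasing bounded norms,
  -- and their limit belongs to all the hulls.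
  set K : ℕ → Set V := fun n => closure (convexHull ℝ (x '' Ici n)) with hK
  have hKc : ∀ n, Convex ℝ (K n) := fun n => (convex_convexHull ℝ _).closure
  have hKx : ∀ n, x n ∈ K n := fun n =>
    subset_closure (subset_convexHull ℝ _ ⟨n, self_mem_Ici, rfl⟩)
  have hanti : ∀ n m, n ≤ m → K m ⊆ K n := fun n m h =>
    closure_mono (convexHull_mono (image_mono (Ici_subset_Ici.2 h)))
  have hmin : ∀ n, ∃ p ∈ K n, ∀ w ∈ K n, ‖p‖ ≤ ‖w‖ := by
    intro n
    obtain ⟨p, hp, h⟩ := exists_norm_eq_iInf_of_complete_convex ⟨_, hKx n⟩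
      isClosed_closure.isComplete (hKc n) 0
    refine ⟨p, hp, fun w hw => ?_⟩
    have h1 : ⨅ w : K n, ‖(0 : V) - w‖ ≤ ‖(0 : V) - w‖ :=
      ciInf_le ⟨0, by rintro _ ⟨w, rfl⟩; exact norm_nonneg _⟩ (⟨w, hw⟩ : K n)
    rw [← h, zero_sub, zero_sub, norm_neg, norm_neg] at h1
    exact h1
  choose p hpK hpmin using hmin
  have hmono : Monotone fun n => ‖p n‖ ^ 2 := fun n m h => by
    have := hpmin n _ (hanti n m h (hpK m))
    simp only
    gcongr
  have hbdd : BddAbove (range fun n => ‖p n‖ ^ 2) := ⟨C ^ 2, by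
    rintro _ ⟨n, rfl⟩
    have := (hpmin n _ (hKx n)).trans (hC n)
    simp only
    gcongr⟩
  have hlim := tendsto_atTop_ciSup hmono hbdd
  set d := ⨆ n, ‖p n‖ ^ 2
  -- The midpoint of p n and p m still lies in K n, so its norm is at least ‖p n‖; the parallelogram
  -- law then makes p a Cauchy sequence.
  have hpar : ∀ n m, n ≤ m → ‖p n - p m‖ ^ 2 ≤ 2 * (d - ‖p n‖ ^ 2) := by
    intro n m h
    have h1 : (1 / 2 : ℝ) • p n + (1 / 2 : ℝ) • p m ∈ K n :=
      hKc n (hpK n) (hanti n m h (hpK m)) (by norm_num) (by norm_num) (by norm_num)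
    have h2 := hpmin n _ h1
    rw [← smul_add, norm_smul] at h2
    have h3 := parallelogram_law_with_norm ℝ (p n) (p m)
    have h4 : ‖p m‖ ^ 2 ≤ d := le_ciSup hbdd m
    norm_num at h2
    have h5 : (2 * ‖p n‖) ^ 2 ≤ ‖p n + p m‖ ^ 2 := by
      have : 2 * ‖p n‖ ≤ ‖p n + p m‖ := by linarith
      gcongr
    nlinarith
  have hcau : CauchySeq p := by
    rw [Metric.cauchySeq_iff']
    intro ε hε
    obtain ⟨N, hN⟩ := (hlim.eventually_const_lt
      (show d - ε ^ 2 / 2 < d by have : 0 < ε ^ 2 := by positivity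
                                 linarith)).exists
    refine ⟨N, fun n hn => ?_⟩
    have h1 := hpar N n hn
    rw [dist_comm, dist_eq_norm]
    refine lt_of_pow_lt_pow_left₀ 2 hε.le ?_
    linarith
  obtain ⟨z, hz⟩ := cauchySeq_tendsto_of_complete hcau
  refine ⟨z, fun S hS hSc hev => ?_⟩
  obtain ⟨N, hN⟩ := eventually_atTop.1 hev
  have hsub : K N ⊆ S := closure_minimal
    (convexHull_min (by rintro _ ⟨n, hn, rfl⟩; exact hN n hn) hSc) hS
  exact hsub (isClosed_closure.mem_of_tendsto hz
    (eventually_atTop.2 ⟨N, fun n hn => hanti N n hn (hpK n)⟩))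

/-- The product carries the maximum norm, so the argument is transported from the Hilbert product;
closed convex sets are the same for both norms. -/
theorem exists_prod_mem_of_eventually_mem_convex {X : Type*} [NormedAddCommGroup X]
    [InnerProductSpace ℝ X] [CompleteSpace X] {x : ℕ → V × X} {C : ℝ}
    (hC : ∀ n, ‖x n‖ ≤ C) :
    ∃ z, ∀ S : Set (V × X), IsClosed S → Convex ℝ S → (∀ᶠ n in atTop, x n ∈ S) → z ∈ S := by
  let e := WithLp.prodContinuousLinearEquiv 2 ℝ V X
  obtain ⟨z, hz⟩ := exists_mem_of_eventually_mem_convex (x := fun n => e.symm (x n))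
    (C := ‖(e.symm : V × X →L[ℝ] WithLp 2 (V × X))‖ * C) fun n =>
      ((e.symm : V × X →L[ℝ] WithLp 2 (V × X)).le_opNorm (x n)).trans (by gcongr; exact hC n)
  refine ⟨e z, fun S hS hSc hev => ?_⟩
  refine hz (e ⁻¹' S) (hS.preimage e.continuous)
    (hSc.linear_preimage (e : WithLp 2 (V × X) →ₗ[ℝ] V × X)) ?_
  filter_upwards [hev] with n hn
  simpa using hn

end ConvexAnalysis

/-! ### The abstract triple of spaces and the splitting of μ -/

/-- Hilbert spaces `V` and `W` mapped continuously to `H` by `j` and `i`, with the norm of `V`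
being the graph norm of an operator `P`, and a vector `e`, zero or normalized, common to the three
spaces, that represents the kernel of the operator acting on `W`. -/
structure EvolutionSpaces (H V W : Type*)
    [NormedAddCommGroup H] [InnerProductSpace ℝ H] [CompleteSpace H]
    [NormedAddCommGroup V] [InnerProductSpace ℝ V] [CompleteSpace V]
    [NormedAddCommGroup W] [InnerProductSpace ℝ W] [CompleteSpace W] where
  i : W →L[ℝ] H
  j : V →L[ℝ] H
  P : V →L[ℝ] H
  e : H
  eW : W
  norm_sq : ∀ v, ‖v‖ ^ 2 = ‖j v‖ ^ 2 + ‖P v‖ ^ 2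
  i_eW : i eW = e
  inner_eW : ∀ w, ⟪eW, w⟫_ℝ = ⟪e, i w⟫_ℝ
  e_unit : e = 0 ∨ ‖e‖ = 1
  adjoint_injective : ∀ f, ContinuousLinearMap.adjoint i f = 0 → f = 0
  ehrling : ∀ ε > 0, ∃ C, 0 ≤ C ∧ ∀ v,
    ‖j v‖ ^ 2 ≤ ε * ‖P v‖ ^ 2 + C * ‖ContinuousLinearMap.adjoint i (j v)‖ ^ 2

namespace EvolutionSpaces

variable {H V W : Type*}
    [NormedAddCommGroup H] [InnerProductSpace ℝ H] [CompleteSpace H]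
    [NormedAddCommGroup V] [InnerProductSpace ℝ V] [CompleteSpace V]
    [NormedAddCommGroup W] [InnerProductSpace ℝ W] [CompleteSpace W]
    (S : EvolutionSpaces H V W)

/-- The Riesz representative in `W` of an element of `H`. -/
noncomputable def N : H →L[ℝ] W := ContinuousLinearMap.adjoint S.i

/-- The projection of `W` along `e`. -/
noncomputable def proj : W →L[ℝ] W :=
  ContinuousLinearMap.id ℝ W - ((innerSL ℝ S.e).comp S.i).smulRight S.eW

theorem proj_apply (μ : W) : S.proj μ = μ - ⟪S.e, S.i μ⟫_ℝ • S.eW := rfl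

theorem inner_N (f : H) (w : W) : ⟪S.N f, w⟫_ℝ = ⟪f, S.i w⟫_ℝ :=
  ContinuousLinearMap.adjoint_inner_left S.i w f

theorem inner_N' (f : H) (w : W) : ⟪w, S.N f⟫_ℝ = ⟪S.i w, f⟫_ℝ :=
  ContinuousLinearMap.adjoint_inner_right S.i w f

theorem N_e : S.N S.e = S.eW :=
  ext_inner_right ℝ fun w => by rw [inner_N, S.inner_eW]

theorem mul_inner_e_e (c : ℝ) (w : H) (hc : c = ⟪S.e, w⟫_ℝ) : c * ⟪S.e, S.e⟫_ℝ = c := by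
  rcases S.e_unit with h | h
  · rw [hc, h, inner_zero_left, zero_mul]
  · rw [real_inner_self_eq_norm_sq, h]
    ring

theorem inner_e_i_proj (μ : W) : ⟪S.e, S.i (S.proj μ)⟫_ℝ = 0 := by
  rw [proj_apply, map_sub, map_smul, S.i_eW, inner_sub_right, real_inner_smul_right,
    S.mul_inner_e_e _ (S.i μ) rfl, sub_self]

theorem proj_eW : S.proj S.eW = 0 := by
  rw [proj_apply, S.i_eW]
  rcases S.e_unit with h | h
  · rw [← S.N_e, h]
    simp
  · rw [real_inner_self_eq_norm_sq, h]
    simp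

theorem proj_N {f : H} (hf : ⟪S.e, f⟫_ℝ = 0) : S.proj (S.N f) = S.N f := by
  rw [proj_apply, ← S.inner_eW, S.inner_N', S.i_eW, hf, zero_smul, sub_zero]

/-- Separates the part of μ that the first equation determines from its component along e; the
latter disappears against elements of zero mean. -/
theorem inner_i_eq (μ : W) (f : H) :
    ⟪S.i μ, f⟫_ℝ = ⟪S.proj μ, S.N f⟫_ℝ + ⟪S.e, S.i μ⟫_ℝ * ⟪S.e, f⟫_ℝ := by
  rw [S.inner_N', proj_apply, map_sub, map_smul, S.i_eW, inner_sub_left, real_inner_smul_left]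
  ring

/-- For W = V_A^r the right-hand side is (A^r μ, A^r w), which is how the first equation acquires
its abstract form. -/
theorem inner_i_proj (μ : W) (w : W) :
    ⟪S.proj μ, w⟫_ℝ = ⟪μ, w⟫_ℝ - ⟪S.e, S.i μ⟫_ℝ * ⟪S.e, S.i w⟫_ℝ := by
  rw [proj_apply, inner_sub_left, real_inner_smul_left, S.inner_eW]

theorem norm_e_le : ‖S.e‖ ≤ 1 := by
  rcases S.e_unit with h | h
  · simp [h]
  · exact h.le

theorem norm_eW_le : ‖S.eW‖ ≤ 1 := by
  have h := S.inner_eW S.eW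
  rw [real_inner_self_eq_norm_sq, S.i_eW, real_inner_self_eq_norm_sq] at h
  have := S.norm_e_le
  have h2 : ‖S.eW‖ ^ 2 ≤ 1 := by rw [h]; nlinarith [norm_nonneg S.e]
  nlinarith [norm_nonneg S.eW]

theorem norm_j_le (v : V) : ‖S.j v‖ ≤ ‖v‖ := by
  refine le_of_sq_le_sq ?_ (norm_nonneg _)
  rw [S.norm_sq]
  nlinarith [sq_nonneg ‖S.P v‖]

theorem norm_P_le (v : V) : ‖S.P v‖ ≤ ‖v‖ := by
  refine le_of_sq_le_sq ?_ (norm_nonneg _)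
  rw [S.norm_sq]
  nlinarith [sq_nonneg ‖S.j v‖]

end EvolutionSpaces

/-! ### Time discretization and a priori estimates -/

/-- Discrete Gronwall lemma, by 1 + a ≤ exp a. Since the factors 1 + a k are at least one, the
accumulated dissipation D can be carried along. -/
theorem add_sum_le_mul_exp {F D a : ℕ → ℝ} {n : ℕ} (hF : ∀ k, k ≤ n → 0 ≤ F k)
    (hD : ∀ k, 0 ≤ D k) (ha : ∀ k, 0 ≤ a k)
    (h : ∀ k, k < n → F (k + 1) + D k ≤ (1 + a k) * F k) :
    F n + ∑ k ∈ Finset.range n, D k ≤ F 0 * Real.exp (∑ k ∈ Finset.range n, a k) := by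
  induction n with
  | zero => simp
  | succ n ih =>
    have h1 := ih (fun k hk => hF k (by omega)) (fun k hk => h k (by omega))
    rw [Finset.sum_range_succ, Finset.sum_range_succ, Real.exp_add]
    have h2 := h n (by omega)
    have h3 : 0 ≤ ∑ k ∈ Finset.range n, D k := Finset.sum_nonneg fun k _ => hD k
    have h4 : 1 + a n ≤ Real.exp (a n) := by linarith [Real.add_one_le_exp (a n)]
    have h5 : 0 ≤ F n := hF n (by omega)
    calc F (n + 1) + (∑ k ∈ Finset.range n, D k + D n)
        ≤ (1 + a n) * (F n + ∑ k ∈ Finset.range n, D k) := by nlinarith [mul_nonneg (ha n) h3]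
      _ ≤ Real.exp (a n) * (F 0 * Real.exp (∑ k ∈ Finset.range n, a k)) := by
          gcongr
      _ = _ := by ring

/-- A convex functional `Φ` and a functional `Π` with Lipschitz continuous gradient `π`, whose sum
is coercive. -/
structure IsPotential {H : Type*} [NormedAddCommGroup H] [InnerProductSpace ℝ H] (Φ : H → ℝ≥0∞)
    (Pi : H → ℝ) (pi : H → H) (L c C : ℝ) : Prop where
  convex : ConvexENN Φ
  lsc : LowerSemicontinuous Φ
  L_nonneg : 0 ≤ L
  c_pos : 0 < c
  C_nonneg : 0 ≤ C
  lipschitz : ∀ x y, ‖pi x - pi y‖ ≤ L * ‖x - y‖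
  taylor : ∀ x y, |Pi x - Pi y - ⟪pi y, x - y⟫_ℝ| ≤ L / 2 * ‖x - y‖ ^ 2
  coercive : ∀ x, Φ x ≠ ∞ → c * ‖x‖ ^ 2 - C ≤ (Φ x).toReal + Pi x

namespace IsPotential

variable {H : Type*} [NormedAddCommGroup H] [InnerProductSpace ℝ H] {Φ : H → ℝ≥0∞} {Pi : H → ℝ}
  {pi : H → H} {L c C : ℝ} (hp : IsPotential Φ Pi pi L c C)

include hp

theorem abs_Pi_le (x : H) : |Pi x| ≤ |Pi 0| + ‖pi 0‖ * ‖x‖ + L / 2 * ‖x‖ ^ 2 := by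
  have h1 := hp.taylor x 0
  rw [sub_zero] at h1
  have h2 := abs_real_inner_le_norm (pi 0) x
  have h3 : Pi x = (Pi x - Pi 0 - ⟪pi 0, x⟫_ℝ) + Pi 0 + ⟪pi 0, x⟫_ℝ := by ring
  rw [h3]
  refine (abs_add_le _ _).trans ?_
  have h4 := abs_add_le (Pi x - Pi 0 - ⟪pi 0, x⟫_ℝ) (Pi 0)
  linarith

theorem norm_pi_le (x : H) : ‖pi x‖ ≤ ‖pi 0‖ + L * ‖x‖ := by
  have h := hp.lipschitz x 0
  rw [sub_zero] at h
  have := norm_sub_norm_le (pi x) (pi 0)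
  linarith

end IsPotential

namespace EvolutionSpaces

variable {H V W : Type*}
    [NormedAddCommGroup H] [InnerProductSpace ℝ H] [CompleteSpace H]
    [NormedAddCommGroup V] [InnerProductSpace ℝ V] [CompleteSpace V]
    [NormedAddCommGroup W] [InnerProductSpace ℝ W] [CompleteSpace W]
    (S : EvolutionSpaces H V W)

/-- Eliminating proj μ = -h⁻¹ N j(y - y₀) leaves an elliptic variational inequality for y alone. The
component of μ along e cannot be eliminated; it is the multiplier of the constraint on the mean. -/
theorem exists_step {Φ : H → ℝ≥0∞} (hconv : ConvexENN Φ) (hlsc : LowerSemicontinuous Φ)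
    {τ h : ℝ} (hτ : 0 ≤ τ) (hh : 0 < h) (f : H) {y₀ : V} (hy₀ : Φ (S.j y₀) ≠ ∞)
    (hmean : S.e = 0 ∨ ∃ v₁ v₂, Φ (S.j v₁) ≠ ∞ ∧ Φ (S.j v₂) ≠ ∞ ∧
      ⟪S.e, S.j v₁⟫_ℝ < ⟪S.e, S.j y₀⟫_ℝ ∧ ⟪S.e, S.j y₀⟫_ℝ < ⟪S.e, S.j v₂⟫_ℝ) :
    ∃ (y : V) (μ : W), Φ (S.j y) ≠ ∞ ∧ ⟪S.e, S.j y⟫_ℝ = ⟪S.e, S.j y₀⟫_ℝ ∧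
      S.N (S.j (y - y₀)) = -h • S.proj μ ∧
      ∀ v, Φ (S.j v) ≠ ∞ → τ / h * ⟪S.j (y - y₀), S.j (y - v)⟫_ℝ + ⟪S.P y, S.P (y - v)⟫_ℝ
        + (Φ (S.j y)).toReal - ⟪f, S.j (y - v)⟫_ℝ ≤
        ⟪S.i μ, S.j (y - v)⟫_ℝ + (Φ (S.j v)).toReal := by
  let NJ : V →L[ℝ] W := S.N.comp S.j
  let q : V →L[ℝ] V →L[ℝ] ℝ := (innerSL ℝ).bilinearComp S.P S.P
    + h⁻¹ • (innerSL ℝ).bilinearComp NJ NJ + (τ / h) • (innerSL ℝ).bilinearComp S.j S.j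
  have hqa : ∀ x y, q x y = ⟪S.P x, S.P y⟫_ℝ + h⁻¹ * ⟪S.N (S.j x), S.N (S.j y)⟫_ℝ
      + τ / h * ⟪S.j x, S.j y⟫_ℝ := fun x y => rfl
  have hsymm : ∀ x y, q x y = q y x := fun x y => by
    rw [hqa, hqa, real_inner_comm, real_inner_comm (S.N _), real_inner_comm (S.j _)]
  obtain ⟨C, hC0, hC⟩ := S.ehrling 1 one_pos
  -- From ‖v‖² = ‖jv‖² + ‖Pv‖² ≤ 2‖Pv‖² + C‖Njv‖², where C‖Njv‖² = Ch · h⁻¹‖Njv‖². The viscous term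
  -- is not needed, so that τ = 0 is allowed.
  have hα : 0 < (2 + C * h)⁻¹ := by positivity
  have hq : ∀ v, (2 + C * h)⁻¹ * ‖v‖ ^ 2 ≤ q v v := by
    intro v
    rw [inv_mul_le_iff₀ (by positivity), hqa, real_inner_self_eq_norm_sq,
      real_inner_self_eq_norm_sq, real_inner_self_eq_norm_sq, S.norm_sq]
    have h1 : ‖S.j v‖ ^ 2 ≤ 1 * ‖S.P v‖ ^ 2 + C * ‖S.N (S.j v)‖ ^ 2 := hC v
    have h2 : 0 ≤ τ / h * ‖S.j v‖ ^ 2 := by positivity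
    have h3 : 0 ≤ h⁻¹ * ‖S.N (S.j v)‖ ^ 2 := by positivity
    have h4 : C * h * (h⁻¹ * ‖S.N (S.j v)‖ ^ 2) = C * ‖S.N (S.j v)‖ ^ 2 := by
      field_simp
    have h5 : 0 ≤ C * h := by positivity
    nlinarith [mul_nonneg h5 h2, mul_nonneg h5 (sq_nonneg ‖S.P v‖)]
  let ℓ : V →L[ℝ] ℝ := (innerSL ℝ f).comp S.j + h⁻¹ • (innerSL ℝ (S.N (S.j y₀))).comp NJ
    + (τ / h) • (innerSL ℝ (S.j y₀)).comp S.j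
  have hℓ : ∀ v, ℓ v = ⟪f, S.j v⟫_ℝ + h⁻¹ * ⟪S.N (S.j y₀), S.N (S.j v)⟫_ℝ
    + τ / h * ⟪S.j y₀, S.j v⟫_ℝ := fun v => rfl
  let k : V →L[ℝ] ℝ := (innerSL ℝ S.e).comp S.j
  have hk : ∀ v, k v = ⟪S.e, S.j v⟫_ℝ := fun v => rfl
  have hconv' : ConvexENN fun v => Φ (S.j v) := fun x y a b ha hb hab => by
    simp only [map_add, map_smul]
    exact hconv _ _ a b ha hb hab
  have hlsc' : LowerSemicontinuous fun v => Φ (S.j v) := hlsc.comp S.j.continuous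
  obtain ⟨y, c, hy, hky, hvi⟩ : ∃ (y : V) (c : ℝ), Φ (S.j y) ≠ ∞ ∧ k y = k y₀ ∧
      ∀ v, Φ (S.j v) ≠ ∞ →
      q y (y - v) + (Φ (S.j y)).toReal ≤ ℓ (y - v) + c * k (y - v) + (Φ (S.j v)).toReal := by
    rcases hmean with he | ⟨v₁, v₂, h1, h2, hk1, hk2⟩
    · obtain ⟨y, hy, hvi⟩ := exists_variationalInequality q hsymm hα hq ℓ hconv' hlsc' ⟨y₀, hy₀⟩
      refine ⟨y, 0, hy, by simp [hk, he], fun v hv => ?_⟩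
      rw [zero_mul, add_zero]
      exact hvi v hv
    · exact exists_variationalInequality_multiplier q hsymm hα hq ℓ k hconv' hlsc' hy₀ h1 h2
        hk1 hk2
  have hmean0 : ⟪S.e, S.j (y - y₀)⟫_ℝ = 0 := by
    rw [← hk, map_sub, hky, sub_self]
  -- The projection kills eW and fixes N j(y - y₀), because y - y₀ has zero mean; so the multiplier
  -- does not disturb the first equation.
  refine ⟨y, -h⁻¹ • S.N (S.j (y - y₀)) + c • S.eW, hy, hky, ?_, fun v hv => ?_⟩
  · rw [map_add, map_smul, map_smul, S.proj_eW, S.proj_N hmean0, smul_zero, add_zero, smul_smul]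
    field_simp
    rw [one_smul]
  · have h1 := hvi v hv
    rw [hqa, hℓ, hk] at h1
    rw [← S.inner_N', inner_add_left, real_inner_smul_left, real_inner_smul_left,
      S.inner_N' _ S.eW, S.i_eW]
    rw [S.j.map_sub y y₀, S.N.map_sub, inner_sub_left, inner_sub_left]
    linarith

/-- The semi-implicit time discretization with step `h`. -/
structure IsScheme (Φ : H → ℝ≥0∞) (pi : H → H) (τ h : ℝ) (u : ℕ → H) (Y : ℕ → V) (μ : ℕ → W) :
    Prop where
  finite : ∀ n, Φ (S.j (Y n)) ≠ ∞
  mean : ∀ n, ⟪S.e, S.j (Y n)⟫_ℝ = ⟪S.e, S.j (Y 0)⟫_ℝ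
  eqn : ∀ n, S.N (S.j (Y (n + 1) - Y n)) = -h • S.proj (μ n)
  vi : ∀ n v, Φ (S.j v) ≠ ∞ →
    τ / h * ⟪S.j (Y (n + 1) - Y n), S.j (Y (n + 1) - v)⟫_ℝ
      + ⟪S.P (Y (n + 1)), S.P (Y (n + 1) - v)⟫_ℝ + (Φ (S.j (Y (n + 1)))).toReal
      + ⟪pi (S.j (Y n)) - u (n + 1), S.j (Y (n + 1) - v)⟫_ℝ ≤
    ⟪S.i (μ n), S.j (Y (n + 1) - v)⟫_ℝ + (Φ (S.j v)).toReal

/-- Comparison elements for the estimate of the component of `μ` along `e`. -/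
def MeanCondition (Φ : H → ℝ≥0∞) (ρ M : ℝ) (y₀ : V) : Prop :=
  S.e = 0 ∨ ∃ v₁ v₂, Φ (S.j v₁) ≠ ∞ ∧ Φ (S.j v₂) ≠ ∞ ∧
    ⟪S.e, S.j v₁⟫_ℝ = ⟪S.e, S.j y₀⟫_ℝ - ρ ∧ ⟪S.e, S.j v₂⟫_ℝ = ⟪S.e, S.j y₀⟫_ℝ + ρ ∧
    (Φ (S.j v₁)).toReal ≤ M ∧ (Φ (S.j v₂)).toReal ≤ M ∧ ‖v₁‖ ≤ M ∧ ‖v₂‖ ≤ M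

/-- Iteration of `exists_step`. The iterates are kept in the set of elements of finite potential
with the mean of y₀, so that the comparison elements serve at every step. -/
theorem exists_isScheme {Φ : H → ℝ≥0∞} (hconv : ConvexENN Φ) (hlsc : LowerSemicontinuous Φ)
    (pi : H → H) {τ h ρ M : ℝ} (hτ : 0 ≤ τ) (hh : 0 < h) (hρ : 0 < ρ) (u : ℕ → H) {y₀ : V}
    (hy₀ : Φ (S.j y₀) ≠ ∞) (hmean : S.MeanCondition Φ ρ M y₀) :
    ∃ (Y : ℕ → V) (μ : ℕ → W), Y 0 = y₀ ∧ S.IsScheme Φ pi τ h u Y μ := by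
  let D := {y : V // Φ (S.j y) ≠ ∞ ∧ ⟪S.e, S.j y⟫_ℝ = ⟪S.e, S.j y₀⟫_ℝ}
  have hstep : ∀ (n : ℕ) (x : D), ∃ (y : D) (μ : W),
      S.N (S.j ((y : V) - x)) = -h • S.proj μ ∧
      ∀ v, Φ (S.j v) ≠ ∞ → τ / h * ⟪S.j ((y : V) - x), S.j (y - v)⟫_ℝ
        + ⟪S.P y, S.P (y - v)⟫_ℝ
        + (Φ (S.j y)).toReal - ⟪u (n + 1) - pi (S.j x), S.j (y - v)⟫_ℝ ≤
        ⟪S.i μ, S.j (y - v)⟫_ℝ + (Φ (S.j v)).toReal := by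
    intro n x
    obtain ⟨y, μ, h1, h2, h3, h4⟩ := S.exists_step hconv hlsc hτ hh
      (u (n + 1) - pi (S.j (x : V))) x.2.1 (by
        refine hmean.imp id ?_
        rintro ⟨v₁, v₂, h1, h2, h3, h4, -⟩
        refine ⟨v₁, v₂, h1, h2, ?_, ?_⟩
        · rw [h3, x.2.2]; linarith
        · rw [h4, x.2.2]; linarith)
    exact ⟨⟨y, h1, h2.trans x.2.2⟩, μ, h3, h4⟩
  choose next mu h1 h2 using hstep
  let Z : ℕ → D := fun n => Nat.rec ⟨y₀, hy₀, rfl⟩ next n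
  have hZ : ∀ n, Z (n + 1) = next n (Z n) := fun n => rfl
  let Y : ℕ → V := fun n => (Z n).1
  have hmeanY : ∀ n, ⟪S.e, S.j (Y n)⟫_ℝ = ⟪S.e, S.j (Y 0)⟫_ℝ := fun n => (Z n).2.2
  refine ⟨Y, fun n => mu n (Z n), rfl,
    ⟨fun n => (Z n).2.1, hmeanY, fun n => ?_, fun n v hv => ?_⟩⟩
  · simp only [Y, hZ]
    exact h1 n (Z n)
  · have := h2 n (Z n) v hv
    simp only [Y, hZ]
    rw [← neg_sub (u (n + 1)), inner_neg_left]
    linarith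

namespace IsScheme

variable {S} {Φ : H → ℝ≥0∞} {Pi : H → ℝ} {pi : H → H} {L c C τ h : ℝ} {u : ℕ → H} {Y : ℕ → V}
  {μ : ℕ → W} (hs : S.IsScheme Φ pi τ h u Y μ) (hp : IsPotential Φ Pi pi L c C)

include hs

theorem inner_e_sub (n : ℕ) : ⟪S.e, S.j (Y (n + 1) - Y n)⟫_ℝ = 0 := by
  rw [map_sub, inner_sub_right, hs.mean (n + 1), hs.mean n, sub_self]

theorem norm_proj (hh : 0 < h) (n : ℕ) :
    h * ‖S.proj (μ n)‖ ^ 2 = h⁻¹ * ‖S.N (S.j (Y (n + 1) - Y n))‖ ^ 2 := by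
  rw [hs.eqn, norm_smul, norm_neg, Real.norm_of_nonneg hh.le]
  field_simp

include hp

/-- The inequality is tested with the previous value. Evaluating π there costs L/2 ‖j(Y(n+1) - Y
n)‖², which `hK` splits in two: a quarter of ‖P(Y(n+1) - Y n)‖², half of which is available, and K‖N
j(Y(n+1) - Y n)‖², which is at most half of the dissipation h‖proj μ‖² as Kh ≤ 1/2. The forcing term
is summed by parts, leaving increments of u. -/
theorem energy_step {K : ℝ} (hh : 0 < h)
    (hK : ∀ v, L / 2 * ‖S.j v‖ ^ 2 ≤ 1 / 4 * ‖S.P v‖ ^ 2 + K * ‖S.N (S.j v)‖ ^ 2)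
    (hKh : K * h ≤ 1 / 2) (n : ℕ) :
    (1 / 2 * ‖S.P (Y (n + 1))‖ ^ 2 + (Φ (S.j (Y (n + 1)))).toReal + Pi (S.j (Y (n + 1)))
        - ⟪u (n + 1), S.j (Y (n + 1))⟫_ℝ)
      + (τ / h * ‖S.j (Y (n + 1) - Y n)‖ ^ 2 + h / 2 * ‖S.proj (μ n)‖ ^ 2
        + 1 / 4 * ‖S.P (Y (n + 1) - Y n)‖ ^ 2) ≤
    (1 / 2 * ‖S.P (Y n)‖ ^ 2 + (Φ (S.j (Y n))).toReal + Pi (S.j (Y n)) - ⟪u n, S.j (Y n)⟫_ℝ)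
      + ‖u (n + 1) - u n‖ * ‖S.j (Y n)‖ := by
  have h1 := hs.vi n (Y n) (hs.finite n)
  rw [S.inner_i_eq, hs.inner_e_sub n, mul_zero, add_zero, hs.eqn n, real_inner_smul_right,
    real_inner_self_eq_norm_sq, real_inner_self_eq_norm_sq] at h1
  have h2 : ⟪S.P (Y (n + 1)), S.P (Y (n + 1) - Y n)⟫_ℝ = 1 / 2 * ‖S.P (Y (n + 1))‖ ^ 2
      - 1 / 2 * ‖S.P (Y n)‖ ^ 2 + 1 / 2 * ‖S.P (Y (n + 1) - Y n)‖ ^ 2 := by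
    rw [map_sub, norm_sub_sq_real, inner_sub_right, real_inner_self_eq_norm_sq]
    ring
  rw [h2, inner_sub_left] at h1
  have h3 := (abs_le.1 (hp.taylor (S.j (Y (n + 1))) (S.j (Y n)))).2
  rw [← map_sub] at h3
  have h4 := hK (Y (n + 1) - Y n)
  have h5 := hs.norm_proj hh n
  have h6 : K * ‖S.N (S.j (Y (n + 1) - Y n))‖ ^ 2 ≤ h / 2 * ‖S.proj (μ n)‖ ^ 2 := by
    have : h / 2 * ‖S.proj (μ n)‖ ^ 2 = h⁻¹ / 2 * ‖S.N (S.j (Y (n + 1) - Y n))‖ ^ 2 := by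
      linarith
    rw [this]
    have : K ≤ h⁻¹ / 2 := by
      rw [inv_eq_one_div, div_div, le_div_iff₀ (by positivity)]
      linarith
    gcongr
  have h7 : ⟪u (n + 1), S.j (Y (n + 1) - Y n)⟫_ℝ = ⟪u (n + 1), S.j (Y (n + 1))⟫_ℝ
      - ⟪u n, S.j (Y n)⟫_ℝ - ⟪u (n + 1) - u n, S.j (Y n)⟫_ℝ := by
    rw [map_sub, inner_sub_right, inner_sub_left]
    ring
  have h8 := (abs_le.1 (abs_real_inner_le_norm (u (n + 1) - u n) (S.j (Y n)))).1
  rw [h7] at h1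
  linarith

end IsScheme

end EvolutionSpaces

namespace EvolutionSpaces

variable {H V W : Type*}
    [NormedAddCommGroup H] [InnerProductSpace ℝ H] [CompleteSpace H]
    [NormedAddCommGroup V] [InnerProductSpace ℝ V] [CompleteSpace V]
    [NormedAddCommGroup W] [InnerProductSpace ℝ W] [CompleteSpace W]
    {S : EvolutionSpaces H V W} {Φ : H → ℝ≥0∞} {Pi : H → ℝ} {pi : H → H} {L c C : ℝ}

/-- The energy shifted by B is coercive and dominates c‖j Y‖, so the increments of u act as factors
1 + ‖u(k+1) - u k‖/c, and the discrete Gronwall lemma needs only the total variation of u. The bound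
is independent of τ, h and n. -/
theorem IsScheme.energy_bound (hp : IsPotential Φ Pi pi L c C) {K M : ℝ} (hM : 0 ≤ M)
    (hK : ∀ v, L / 2 * ‖S.j v‖ ^ 2 ≤ 1 / 4 * ‖S.P v‖ ^ 2 + K * ‖S.N (S.j v)‖ ^ 2) :
    ∃ K₁, 0 ≤ K₁ ∧ ∀ {τ h : ℝ} {n : ℕ} {u : ℕ → H} {Y : ℕ → V} {μ : ℕ → W},
      S.IsScheme Φ pi τ h u Y μ → 0 ≤ τ → 0 < h → K * h ≤ 1 / 2 → ‖Y 0‖ ≤ M →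
      (Φ (S.j (Y 0))).toReal ≤ M → (∀ k ≤ n, ‖u k‖ ≤ M) →
      ∑ k ∈ Finset.range n, ‖u (k + 1) - u k‖ ≤ M →
      (∀ k ≤ n, ‖Y k‖ ≤ K₁ ∧ (Φ (S.j (Y k))).toReal ≤ K₁) ∧
      ∑ k ∈ Finset.range n, (τ / h * ‖S.j (Y (k + 1) - Y k)‖ ^ 2 + h / 2 * ‖S.proj (μ k)‖ ^ 2
        + 1 / 4 * ‖S.P (Y (k + 1) - Y k)‖ ^ 2) ≤ K₁ := by
  have hc := hp.c_pos
  have hL := hp.L_nonneg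
  have hC := hp.C_nonneg
  -- C compensates the coercivity constant, M²/(2c) the term (u, jY) by Young's inequality, and c/2
  -- produces the 1 in `hFlow` that makes c‖jY‖ ≤ F possible.
  set B : ℝ := C + M ^ 2 / (2 * c) + c / 2 with hB
  set F₀ : ℝ := 1 / 2 * M ^ 2 + M + (|Pi 0| + ‖pi 0‖ * M + L / 2 * M ^ 2) + M * M + B with hF₀
  set E : ℝ := F₀ * Real.exp (M / c) with hE
  have hB0 : 0 ≤ B := by positivity
  have hE0 : 0 ≤ E := by positivity
  set R : ℝ := √(2 * E + 2 * E / c) with hR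
  have hR0 : 0 ≤ R := Real.sqrt_nonneg _
  set Q : ℝ := |Pi 0| + ‖pi 0‖ * R + L / 2 * R ^ 2 with hQ
  have hQ0 : 0 ≤ Q := by positivity
  refine ⟨R + E + Q + M * R, by positivity, ?_⟩
  intro τ h n u Y μ hs hτ hh hKh hY0 hΦ0 hu hdu
  obtain ⟨F, hF⟩ : ∃ F : ℕ → ℝ, F = fun k => (1 / 2 * ‖S.P (Y k)‖ ^ 2 + (Φ (S.j (Y k))).toReal
    + Pi (S.j (Y k)) - ⟪u k, S.j (Y k)⟫_ℝ) + B := ⟨_, rfl⟩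
  obtain ⟨D, hD⟩ : ∃ D : ℕ → ℝ, D = fun k => τ / h * ‖S.j (Y (k + 1) - Y k)‖ ^ 2
    + h / 2 * ‖S.proj (μ k)‖ ^ 2 + 1 / 4 * ‖S.P (Y (k + 1) - Y k)‖ ^ 2 := ⟨_, rfl⟩
  have hD0 : ∀ k, 0 ≤ D k := fun k => by
    rw [hD]
    positivity
  have hFlow : ∀ k ≤ n, 1 / 2 * ‖S.P (Y k)‖ ^ 2 + c / 2 * (‖S.j (Y k)‖ ^ 2 + 1) ≤ F k := by
    intro k hk
    have h1 := hp.coercive _ (hs.finite k)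
    have h2 := (abs_le.1 (abs_real_inner_le_norm (u k) (S.j (Y k)))).2
    have h3 : ‖u k‖ * ‖S.j (Y k)‖ ≤ M * ‖S.j (Y k)‖ := by gcongr; exact hu k hk
    have h4 : 0 ≤ c / 2 * ‖S.j (Y k)‖ ^ 2 - M * ‖S.j (Y k)‖ + M ^ 2 / (2 * c) := by
      have : c / 2 * ‖S.j (Y k)‖ ^ 2 - M * ‖S.j (Y k)‖ + M ^ 2 / (2 * c) =
          (c * ‖S.j (Y k)‖ - M) ^ 2 / (2 * c) := by
        field_simp
        ring
      rw [this]
      positivity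
    simp only [hF, hB]
    linarith
  have hF0 : ∀ k ≤ n, 0 ≤ F k := fun k hk => le_trans (by positivity) (hFlow k hk)
  have hstep : ∀ k, k < n → F (k + 1) + D k ≤ (1 + ‖u (k + 1) - u k‖ / c) * F k := by
    intro k hk
    have h1 := hs.energy_step hp hh hK hKh k
    have h2 : c * ‖S.j (Y k)‖ ≤ F k := by
      refine le_trans ?_ (hFlow k hk.le)
      have e1 : 0 ≤ c / 2 * (‖S.j (Y k)‖ - 1) ^ 2 := by positivity
      have e2 : 0 ≤ ‖S.P (Y k)‖ ^ 2 := by positivity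
      linarith
    have h3 : ‖u (k + 1) - u k‖ * ‖S.j (Y k)‖ ≤ ‖u (k + 1) - u k‖ / c * F k := by
      rw [div_mul_eq_mul_div, le_div_iff₀ hc, mul_assoc, mul_comm _ c]
      gcongr
    simp only [hF, hD] at h3 ⊢
    linarith
  have hFinit : F 0 ≤ F₀ := by
    have h1 := (le_abs_self _).trans (hp.abs_Pi_le (S.j (Y 0)))
    have h2 := (S.norm_j_le (Y 0)).trans hY0
    have h3 := (S.norm_P_le (Y 0)).trans hY0
    have h4 := (abs_le.1 (abs_real_inner_le_norm (u 0) (S.j (Y 0)))).1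
    have h5 : ‖u 0‖ * ‖S.j (Y 0)‖ ≤ M * M := by
      gcongr
      exact hu 0 (Nat.zero_le _)
    have h6 : ‖pi 0‖ * ‖S.j (Y 0)‖ + L / 2 * ‖S.j (Y 0)‖ ^ 2 ≤ ‖pi 0‖ * M + L / 2 * M ^ 2 := by
      gcongr
    have h7 : ‖S.P (Y 0)‖ ^ 2 ≤ M ^ 2 := by gcongr
    simp only [hF, hF₀]
    linarith
  have hmain : ∀ k ≤ n, F k + ∑ l ∈ Finset.range k, D l ≤ E := by
    intro k hk
    refine (add_sum_le_mul_exp (fun l hl => hF0 l (hl.trans hk)) hD0 (fun l => by positivity)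
      (fun l hl => hstep l (hl.trans_le hk))).trans ?_
    rw [← Finset.sum_div]
    have h1 : ∑ l ∈ Finset.range k, ‖u (l + 1) - u l‖ ≤ M :=
      (Finset.sum_le_sum_of_subset_of_nonneg (Finset.range_subset_range.2 hk)
        fun l _ _ => norm_nonneg _).trans hdu
    rw [hE]
    have := hF0 0 (Nat.zero_le _)
    gcongr
  have hFE : ∀ k ≤ n, F k ≤ E := fun k hk => by
    have := hmain k hk
    have h1 : 0 ≤ ∑ l ∈ Finset.range k, D l := Finset.sum_nonneg fun l _ => hD0 l
    linarith
  have hYR : ∀ k ≤ n, ‖Y k‖ ≤ R := by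
    intro k hk
    refine Real.le_sqrt_of_sq_le ?_
    rw [S.norm_sq]
    have h1 := (hFlow k hk).trans (hFE k hk)
    have h2 : ‖S.j (Y k)‖ ^ 2 ≤ 2 * E / c := by
      rw [le_div_iff₀ hc]
      linarith [sq_nonneg ‖S.P (Y k)‖]
    have h3 : ‖S.P (Y k)‖ ^ 2 ≤ 2 * E := by
      linarith [mul_nonneg hc.le (sq_nonneg ‖S.j (Y k)‖)]
    linarith
  refine ⟨fun k hk => ⟨?_, ?_⟩, ?_⟩
  · have := hYR k hk
    have : 0 ≤ M * R := by positivity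
    linarith
  · have h1 := hFE k hk
    have h2 := (S.norm_j_le (Y k)).trans (hYR k hk)
    have h3 : |Pi (S.j (Y k))| ≤ Q := (hp.abs_Pi_le _).trans (by rw [hQ]; gcongr)
    have h4 := (abs_le.1 (abs_real_inner_le_norm (u k) (S.j (Y k)))).2
    have h5 : ‖u k‖ * ‖S.j (Y k)‖ ≤ M * R := by
      gcongr
      exact hu k hk
    have h6 := (abs_le.1 h3).1
    have h7 : 0 ≤ ‖S.P (Y k)‖ ^ 2 := by positivity
    simp only [hF] at h1
    linarith
  · have h1 := hmain n le_rfl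
    rw [hD] at h1
    have h2 := hF0 n le_rfl
    have : 0 ≤ M * R := by positivity
    linarith

/-- Against comparison elements whose means lie at distance ρ on either side of that of Y, the
component of μ along e appears multiplied by ρ with both signs, while all other terms are bounded by
the energy estimate or by the dissipation. -/
theorem IsScheme.mean_bound (hp : IsPotential Φ Pi pi L c C) {M ρ K : ℝ} (hM : 0 ≤ M)
    (hρ : 0 < ρ) (hK : 0 ≤ K) :
    ∃ A, 0 ≤ A ∧ ∀ {τ h : ℝ} {n : ℕ} {u : ℕ → H} {Y : ℕ → V} {μ : ℕ → W},
      S.IsScheme Φ pi τ h u Y μ → 0 ≤ τ → 0 < h → S.MeanCondition Φ ρ M (Y 0) →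
      ‖u (n + 1)‖ ≤ M → ‖Y n‖ ≤ K → ‖Y (n + 1)‖ ≤ K →
      |⟪S.e, S.i (μ n)⟫_ℝ| ≤ A * (1 + τ / h * ‖S.j (Y (n + 1) - Y n)‖ + ‖S.proj (μ n)‖) := by
  have hL := hp.L_nonneg
  set R := K + M with hR
  set A : ℝ := M + R + R * (K + (‖pi 0‖ + L * K + M)) + ‖S.N‖ * R with hA
  refine ⟨A / ρ, by positivity, ?_⟩
  intro τ h n u Y μ hs hτ hh hmean hu hY hY1
  have hA0 : 0 ≤ A := by positivity
  rcases hmean with he | ⟨v₁, v₂, hf1, hf2, he1, he2, hΦ1, hΦ2, hn1, hn2⟩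
  · rw [he, inner_zero_left, abs_zero]
    positivity
  have key : ∀ v, Φ (S.j v) ≠ ∞ → (Φ (S.j v)).toReal ≤ M → ‖v‖ ≤ M →
      -(⟪S.e, S.i (μ n)⟫_ℝ * ⟪S.e, S.j (Y (n + 1) - v)⟫_ℝ) ≤
        A * (1 + τ / h * ‖S.j (Y (n + 1) - Y n)‖ + ‖S.proj (μ n)‖) := by
    intro v hv hΦ hn
    have h1 := hs.vi n v hv
    rw [S.inner_i_eq] at h1
    have hd : ‖Y (n + 1) - v‖ ≤ R := (norm_sub_le _ _).trans (add_le_add hY1 hn)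
    have hjd := (S.norm_j_le _).trans hd
    have hPd := (S.norm_P_le _).trans hd
    have h2 := (abs_le.1 (abs_real_inner_le_norm (S.j (Y (n + 1) - Y n))
      (S.j (Y (n + 1) - v)))).1
    have h2' : ‖S.j (Y (n + 1) - Y n)‖ * ‖S.j (Y (n + 1) - v)‖ ≤
        ‖S.j (Y (n + 1) - Y n)‖ * R := by gcongr
    have hτh : 0 ≤ τ / h := by positivity
    have h2'' : -(τ / h * ‖S.j (Y (n + 1) - Y n)‖ * R) ≤
        τ / h * ⟪S.j (Y (n + 1) - Y n), S.j (Y (n + 1) - v)⟫_ℝ := by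
      rw [mul_assoc, ← mul_neg]
      exact mul_le_mul_of_nonneg_left (by linarith) hτh
    have h3 := (abs_le.1 (abs_real_inner_le_norm (S.P (Y (n + 1))) (S.P (Y (n + 1) - v)))).1
    have h3' : ‖S.P (Y (n + 1))‖ * ‖S.P (Y (n + 1) - v)‖ ≤ K * R := by
      gcongr
      exact (S.norm_P_le _).trans hY1
    have h4 := (abs_le.1 (abs_real_inner_le_norm (pi (S.j (Y n)) - u (n + 1))
      (S.j (Y (n + 1) - v)))).1
    have h4a : ‖pi (S.j (Y n)) - u (n + 1)‖ ≤ ‖pi 0‖ + L * K + M := by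
      refine (norm_sub_le _ _).trans (add_le_add ((hp.norm_pi_le _).trans ?_) hu)
      gcongr
      exact (S.norm_j_le _).trans hY
    have h4' : ‖pi (S.j (Y n)) - u (n + 1)‖ * ‖S.j (Y (n + 1) - v)‖ ≤
        (‖pi 0‖ + L * K + M) * R := by gcongr
    have h5 := (abs_le.1 (abs_real_inner_le_norm (S.proj (μ n))
      (S.N (S.j (Y (n + 1) - v))))).2
    have h5' : ‖S.proj (μ n)‖ * ‖S.N (S.j (Y (n + 1) - v))‖ ≤ ‖S.proj (μ n)‖ * (‖S.N‖ * R) := by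
      gcongr
      exact (S.N.le_opNorm _).trans (by gcongr)
    have h6 : (0 : ℝ) ≤ (Φ (S.j (Y (n + 1)))).toReal := ENNReal.toReal_nonneg
    have hx : 0 ≤ τ / h * ‖S.j (Y (n + 1) - Y n)‖ := by positivity
    have hz : 0 ≤ ‖S.proj (μ n)‖ := norm_nonneg _
    have hR0 : 0 ≤ R := by positivity
    have hAR : R ≤ A := by
      rw [hA]
      have : 0 ≤ R * (K + (‖pi 0‖ + L * K + M)) := by positivity
      have : 0 ≤ ‖S.N‖ * R := by positivity
      linarith
    have hAN : ‖S.N‖ * R ≤ A := by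
      rw [hA]
      have : 0 ≤ R * (K + (‖pi 0‖ + L * K + M)) := by positivity
      linarith
    have hA1 : M + K * R + (‖pi 0‖ + L * K + M) * R ≤ A := by
      rw [hA]
      have : 0 ≤ ‖S.N‖ * R := by positivity
      linarith
    have e1 : τ / h * ‖S.j (Y (n + 1) - Y n)‖ * R ≤ A * (τ / h * ‖S.j (Y (n + 1) - Y n)‖) := by
      rw [mul_comm A]
      gcongr
    have e2 : ‖S.proj (μ n)‖ * (‖S.N‖ * R) ≤ A * ‖S.proj (μ n)‖ := by
      rw [mul_comm A]
      gcongr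
    rw [mul_add, mul_add, mul_one]
    linarith
  have k1 := key v₁ hf1 hΦ1 hn1
  have k2 := key v₂ hf2 hΦ2 hn2
  rw [map_sub, inner_sub_right, hs.mean, he1] at k1
  rw [map_sub, inner_sub_right, hs.mean, he2] at k2
  rw [div_mul_eq_mul_div, le_div_iff₀ hρ, ← abs_of_pos hρ, ← abs_mul, abs_le]
  constructor <;> linarith

/-- Sums the energy and mean estimates. The constants see the data only through T, τmax, M and ρ,
which is the uniformity required of K₁. -/
theorem exists_apriori_bound (hp : IsPotential Φ Pi pi L c C) {T τmax M ρ : ℝ}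
    (hτmax : 0 ≤ τmax) (hM : 0 ≤ M) (hρ : 0 < ρ) (hT : 0 ≤ T) :
    ∃ K h₀, 0 ≤ K ∧ 0 < h₀ ∧ ∀ {τ h : ℝ} {n : ℕ} {u : ℕ → H} {Y : ℕ → V} {μ : ℕ → W},
      S.IsScheme Φ pi τ h u Y μ → 0 ≤ τ → τ ≤ τmax → 0 < h → h ≤ h₀ → n * h = T → ‖Y 0‖ ≤ M →
      (Φ (S.j (Y 0))).toReal ≤ M → S.MeanCondition Φ ρ M (Y 0) → (∀ k ≤ n, ‖u k‖ ≤ M) →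
      ∑ k ∈ Finset.range n, ‖u (k + 1) - u k‖ ≤ M →
      (∀ k ≤ n, ‖Y k‖ ≤ K ∧ (Φ (S.j (Y k))).toReal ≤ K) ∧
      h * ∑ k ∈ Finset.range n, ‖μ k‖ ^ 2 ≤ K ∧
      h * ∑ k ∈ Finset.range n, τ * ‖h⁻¹ • S.j (Y (k + 1) - Y k)‖ ^ 2 ≤ K ∧
      ∑ k ∈ Finset.range n, ‖S.j (Y (k + 1) - Y k)‖ ^ 2 ≤ K := by
  have hL := hp.L_nonneg
  obtain ⟨K, hK0, hK⟩ : ∃ K, 0 ≤ K ∧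
      ∀ v, L / 2 * ‖S.j v‖ ^ 2 ≤ 1 / 4 * ‖S.P v‖ ^ 2 + K * ‖S.N (S.j v)‖ ^ 2 := by
    -- This ε makes L/2 · ε at most 1/4, as `energy_step` requires.
    obtain ⟨C₁, h1, h2⟩ := S.ehrling (1 / (2 * (L + 1))) (by positivity)
    refine ⟨L / 2 * C₁, by positivity, fun v => ?_⟩
    have h3 := mul_le_mul_of_nonneg_left (h2 v) (show 0 ≤ L / 2 by positivity)
    have h4 : L / 2 * (1 / (2 * (L + 1))) ≤ 1 / 4 := by
      rw [mul_one_div, div_le_div_iff₀ (by positivity) (by positivity)]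
      linarith
    have h5 := mul_le_mul_of_nonneg_right h4 (sq_nonneg ‖S.P v‖)
    change _ ≤ L / 2 * (_ + C₁ * ‖S.N (S.j v)‖ ^ 2) at h3
    linarith
  obtain ⟨C₁, hC₁0, hC₁⟩ := S.ehrling 1 one_pos
  obtain ⟨K₁, hK₁0, hK₁⟩ := IsScheme.energy_bound (S := S) hp hM hK
  obtain ⟨A, hA0, hA⟩ := IsScheme.mean_bound (S := S) hp hM hρ hK₁0
  -- Comes from ‖μ‖² ≤ 2‖proj μ‖² + 2(e, μ)² and the mean estimate. The upper bound for τ is used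
  -- here: h(τ/h)²‖·‖² is τ times the dissipation (τ/h)‖·‖².
  set Kμ : ℝ := 2 * (2 * K₁) + 2 * (A ^ 2 * (3 * (T + τmax * K₁ + 2 * K₁))) with hKμ
  have hKμ0 : 0 ≤ Kμ := by positivity
  -- The first restriction on h gives Kh ≤ 1/2; the second gives h² ≤ h/2, used for the sum of the
  -- squared increments.
  refine ⟨K₁ + Kμ + (4 + C₁) * K₁, min (1 / (2 * (K + 1))) (1 / 2), by positivity,
    by positivity, ?_⟩
  intro τ h n u Y μ hs hτ hτm hh hh0 hnh hY0 hΦ0 hmean hu hdu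
  have hKh : K * h ≤ 1 / 2 := by
    have h1 : h ≤ 1 / (2 * (K + 1)) := hh0.trans (min_le_left _ _)
    rw [le_div_iff₀ (by positivity)] at h1
    nlinarith
  have hh2 : h ≤ 1 / 2 := hh0.trans (min_le_right _ _)
  obtain ⟨hYΦ, hD⟩ := hK₁ hs hτ hh hKh hY0 hΦ0 hu hdu
  obtain ⟨D, hDdef⟩ : ∃ D : ℕ → ℝ, D = fun k => τ / h * ‖S.j (Y (k + 1) - Y k)‖ ^ 2
    + h / 2 * ‖S.proj (μ k)‖ ^ 2 + 1 / 4 * ‖S.P (Y (k + 1) - Y k)‖ ^ 2 := ⟨_, rfl⟩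
  replace hD : ∑ k ∈ Finset.range n, D k ≤ K₁ := by
    rw [hDdef]
    exact hD
  have hC₁K : 0 ≤ (4 + C₁) * K₁ := by positivity
  refine ⟨fun k hk => ⟨?_, ?_⟩, ?_, ?_, ?_⟩
  · linarith [(hYΦ k hk).1]
  · linarith [(hYΦ k hk).2]
  · have hμ : ∀ k ∈ Finset.range n, h * ‖μ k‖ ^ 2 ≤
        4 * D k + 2 * (A ^ 2 * (3 * (h + τmax * D k + 2 * D k))) := by
      intro k hk
      rw [Finset.mem_range] at hk
      have h1 := hA (n := k) hs hτ hh hmean (hu (k + 1) hk) (hYΦ k hk.le).1 (hYΦ (k + 1) hk).1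
      have e1 : μ k = S.proj (μ k) + ⟪S.e, S.i (μ k)⟫_ℝ • S.eW := by
        rw [S.proj_apply]
        abel
      have h2 : ‖μ k‖ ≤ ‖S.proj (μ k)‖ + |⟪S.e, S.i (μ k)⟫_ℝ| := by
        conv_lhs => rw [e1]
        refine (norm_add_le _ _).trans ?_
        rw [norm_smul, Real.norm_eq_abs]
        have := mul_le_mul_of_nonneg_left S.norm_eW_le (abs_nonneg ⟪S.e, S.i (μ k)⟫_ℝ)
        linarith
      set a := ‖S.proj (μ k)‖
      set b := |⟪S.e, S.i (μ k)⟫_ℝ|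
      set d := τ / h * ‖S.j (Y (k + 1) - Y k)‖ with hd
      have ha0 : 0 ≤ a := norm_nonneg _
      have hb0 : 0 ≤ b := abs_nonneg _
      have hd0 : 0 ≤ d := by positivity
      have h3 : ‖μ k‖ ^ 2 ≤ 2 * a ^ 2 + 2 * b ^ 2 := by
        have : ‖μ k‖ ^ 2 ≤ (a + b) ^ 2 := by gcongr
        nlinarith [sq_nonneg (a - b)]
      have h4 : b ^ 2 ≤ A ^ 2 * (3 * (1 + d ^ 2 + a ^ 2)) := by
        have h5 : b ^ 2 ≤ (A * (1 + d + a)) ^ 2 := by gcongr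
        rw [mul_pow] at h5
        refine h5.trans ?_
        gcongr
        nlinarith [sq_nonneg (1 - d), sq_nonneg (1 - a), sq_nonneg (d - a)]
      have h6 : h * a ^ 2 ≤ 2 * D k := by
        simp only [hDdef]
        have : 0 ≤ τ / h * ‖S.j (Y (k + 1) - Y k)‖ ^ 2 := by positivity
        have : 0 ≤ ‖S.P (Y (k + 1) - Y k)‖ ^ 2 := by positivity
        linarith
      have h7 : h * d ^ 2 ≤ τmax * D k := by
        have e2 : h * d ^ 2 = τ * (τ / h * ‖S.j (Y (k + 1) - Y k)‖ ^ 2) := by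
          rw [hd]
          field_simp
        rw [e2]
        refine mul_le_mul hτm ?_ (by positivity) hτmax
        simp only [hDdef]
        have : 0 ≤ h / 2 * ‖S.proj (μ k)‖ ^ 2 := by positivity
        have : 0 ≤ ‖S.P (Y (k + 1) - Y k)‖ ^ 2 := by positivity
        linarith
      have h8 := mul_le_mul_of_nonneg_left h3 hh.le
      have h9 := mul_le_mul_of_nonneg_left h4 hh.le
      have h10 : A ^ 2 * (3 * (h + h * d ^ 2 + h * a ^ 2)) ≤
          A ^ 2 * (3 * (h + τmax * D k + 2 * D k)) := by gcongr
      linarith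
    have hsum := Finset.sum_le_sum hμ
    rw [Finset.sum_add_distrib, ← Finset.mul_sum, ← Finset.mul_sum, ← Finset.mul_sum,
      ← Finset.mul_sum, ← Finset.mul_sum, Finset.sum_add_distrib, Finset.sum_add_distrib,
      Finset.sum_const, Finset.card_range, nsmul_eq_mul, hnh, ← Finset.mul_sum,
      ← Finset.mul_sum] at hsum
    have : A ^ 2 * (3 * (T + τmax * ∑ k ∈ Finset.range n, D k + 2 * ∑ k ∈ Finset.range n, D k))
        ≤ A ^ 2 * (3 * (T + τmax * K₁ + 2 * K₁)) := by gcongr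
    linarith
  · rw [Finset.mul_sum]
    refine le_trans (Finset.sum_le_sum (g := D) fun k hk => ?_) (by linarith)
    have e : h * (τ * ‖h⁻¹ • S.j (Y (k + 1) - Y k)‖ ^ 2) =
        τ / h * ‖S.j (Y (k + 1) - Y k)‖ ^ 2 := by
      rw [norm_smul, norm_inv, Real.norm_of_nonneg hh.le]
      field_simp
    rw [e]
    simp only [hDdef]
    have : 0 ≤ h / 2 * ‖S.proj (μ k)‖ ^ 2 := by positivity
    have : 0 ≤ ‖S.P (Y (k + 1) - Y k)‖ ^ 2 := by positivity
    linarith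
  -- The increments in H are controlled by Ehrling's inequality rather than by the viscous term,
  -- hence also for τ = 0.
  · refine le_trans (Finset.sum_le_sum (g := fun k => (4 + C₁) * D k) fun k hk => ?_) ?_
    · have h1 : ‖S.j (Y (k + 1) - Y k)‖ ^ 2 ≤ 1 * ‖S.P (Y (k + 1) - Y k)‖ ^ 2
          + C₁ * ‖S.N (S.j (Y (k + 1) - Y k))‖ ^ 2 := hC₁ _
      rw [hs.eqn, norm_smul, norm_neg, Real.norm_of_nonneg hh.le, mul_pow] at h1
      have h2 : h ^ 2 * ‖S.proj (μ k)‖ ^ 2 ≤ h / 2 * ‖S.proj (μ k)‖ ^ 2 := by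
        gcongr
        nlinarith
      have h3 : 0 ≤ τ / h * ‖S.j (Y (k + 1) - Y k)‖ ^ 2 := by positivity
      have h4 : 0 ≤ h / 2 * ‖S.proj (μ k)‖ ^ 2 := by positivity
      have h5 : 0 ≤ ‖S.P (Y (k + 1) - Y k)‖ ^ 2 := by positivity
      have h6 := mul_le_mul_of_nonneg_left h2 hC₁0
      have h7 := mul_nonneg hC₁0 h3
      have h8 := mul_nonneg hC₁0 h5
      simp only [hDdef]
      linarith
    · rw [← Finset.mul_sum]
      have := mul_le_mul_of_nonneg_left hD (show 0 ≤ 4 + C₁ by positivity)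
      linarith

end EvolutionSpaces

/-! ### Continuous dependence for approximate solutions -/

theorem integrable_norm_sq {X : Type*} [NormedAddCommGroup X] {T : ℝ} {f : ℝ → X}
    (hf : MemLp f 2 (timeMeasure T)) : Integrable (fun t => ‖f t‖ ^ 2) (timeMeasure T) := by
  simpa using hf.integrable_norm_pow (by norm_num)

theorem intervalIntegrable_of_mem {X : Type*} [NormedAddCommGroup X] {T : ℝ} (hT : 0 < T)
    {f : ℝ → X} (hf : Integrable f (timeMeasure T)) (x : ℝ) (hx : x ∈ Icc 0 T) :
    IntervalIntegrable f volume 0 x :=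
  ((integrable_timeMeasure_iff hT).1 hf).mono_set
    (uIcc_subset_uIcc left_mem_uIcc (by rwa [uIcc_of_le hT.le]))

theorem mul_add_le_of_le_add {h₁ h₂ a b c : ℝ} (hh₁ : 0 ≤ h₁) (hh₂ : 0 ≤ h₂) (ha : 0 ≤ a)
    (hb : 0 ≤ b) (hc : c ≤ a + b) :
    c * (h₁ * a + h₂ * b) ≤ 2 * ((h₁ + h₂) * (a ^ 2 + b ^ 2)) := by
  have h1 : c * (h₁ * a + h₂ * b) ≤ (a + b) * (h₁ * a + h₂ * b) := by gcongr
  have h2 : h₁ * a + h₂ * b ≤ (h₁ + h₂) * (a + b) := by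
    nlinarith [mul_nonneg hh₁ hb, mul_nonneg hh₂ ha]
  have h3 : (a + b) * (h₁ * a + h₂ * b) ≤ (a + b) * ((h₁ + h₂) * (a + b)) := by gcongr
  have h4 : (a + b) ^ 2 ≤ 2 * (a ^ 2 + b ^ 2) := by nlinarith [sq_nonneg (a - b)]
  have h5 := mul_le_mul_of_nonneg_left h4 (show 0 ≤ h₁ + h₂ by positivity)
  linarith

/-- Makes every consistency error first order in h₁ + h₂ with square-integrable coefficients; the
assumption that h₁ and h₂ are at most one reduces the second-order term. -/
theorem stability_error_le {K L h₁ h₂ m₁ m₂ m d₁ d₂ d γ₁ γ₂ U : ℝ} (hK : 0 ≤ K) (hh₁ : 0 ≤ h₁)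
    (hh₁' : h₁ ≤ 1) (hh₂ : 0 ≤ h₂) (hh₂' : h₂ ≤ 1) (hm₁ : 0 ≤ m₁) (hm₂ : 0 ≤ m₂) (hd₁ : 0 ≤ d₁)
    (hd₂ : 0 ≤ d₂) (hU : 0 ≤ U) (hm : m ≤ m₁ + m₂) (hd : d ≤ d₁ + d₂) :
    K * (h₁ * m₁ + h₂ * m₂) ^ 2 + L ^ 2 * (γ₁ + γ₂) ^ 2 + U + 2 * (m * (h₁ * m₁ + h₂ * m₂))
      + 2 * (d * (h₁ * d₁ + h₂ * d₂)) ≤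
    (1 + 4 * K + 4 + 2 * L ^ 2) * (U + (h₁ + h₂) * (m₁ ^ 2 + m₂ ^ 2 + d₁ ^ 2 + d₂ ^ 2)
      + (γ₁ ^ 2 + γ₂ ^ 2)) := by
  have k1 := mul_add_le_of_le_add hh₁ hh₂ hm₁ hm₂ hm
  have k2 := mul_add_le_of_le_add hh₁ hh₂ hd₁ hd₂ hd
  have k3 : (h₁ * m₁ + h₂ * m₂) ^ 2 ≤ 2 * ((h₁ + h₂) * (m₁ ^ 2 + m₂ ^ 2)) := by
    rw [sq]
    refine mul_add_le_of_le_add hh₁ hh₂ hm₁ hm₂ ?_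
    have := mul_le_mul_of_nonneg_right hh₁' hm₁
    have := mul_le_mul_of_nonneg_right hh₂' hm₂
    linarith
  have k4 : (γ₁ + γ₂) ^ 2 ≤ 2 * (γ₁ ^ 2 + γ₂ ^ 2) := by nlinarith [sq_nonneg (γ₁ - γ₂)]
  have k5 := mul_le_mul_of_nonneg_left k3 hK
  have k6 := mul_le_mul_of_nonneg_left k4 (sq_nonneg L)
  obtain ⟨X, hX⟩ : ∃ X, X = (h₁ + h₂) * (m₁ ^ 2 + m₂ ^ 2) := ⟨_, rfl⟩
  obtain ⟨Y, hY⟩ : ∃ Y, Y = (h₁ + h₂) * (d₁ ^ 2 + d₂ ^ 2) := ⟨_, rfl⟩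
  obtain ⟨Z, hZ⟩ : ∃ Z, Z = γ₁ ^ 2 + γ₂ ^ 2 := ⟨_, rfl⟩
  have hX0 : 0 ≤ X := by rw [hX]; positivity
  have hY0 : 0 ≤ Y := by rw [hY]; positivity
  have hZ0 : 0 ≤ Z := by rw [hZ]; positivity
  have eG : (h₁ + h₂) * (m₁ ^ 2 + m₂ ^ 2 + d₁ ^ 2 + d₂ ^ 2) = X + Y := by
    rw [hX, hY]
    ring
  rw [eG, ← hZ]
  rw [← hX] at k1 k5
  rw [← hY] at k2
  rw [← hZ] at k6
  have l1 : 0 ≤ K * (4 * U + 2 * X + 4 * Y + 4 * Z) := by positivity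
  have l2 : 0 ≤ L ^ 2 * (2 * U + 2 * X + 2 * Y) := by positivity
  linarith

namespace EvolutionSpaces

variable {H V W : Type*}
    [NormedAddCommGroup H] [InnerProductSpace ℝ H] [CompleteSpace H]
    [NormedAddCommGroup V] [InnerProductSpace ℝ V] [CompleteSpace V]
    [NormedAddCommGroup W] [InnerProductSpace ℝ W] [CompleteSpace W]
    (S : EvolutionSpaces H V W)

/-- An approximate solution of the evolution problem, with consistency error of order `h`; `d`
stands for `√τ` times the derivative of `y`, and the nonlinearity is evaluated at `g`. -/
structure IsTrajectory (Φ : H → ℝ≥0∞) (pi : H → H) (T τ h : ℝ) (u : ℝ → H) (y₀ : V) (y : ℝ → V)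
    (g : ℝ → H) (μ : ℝ → W) (d : ℝ → H) : Prop where
  memLp_y : MemLp y 2 (timeMeasure T)
  memLp_g : MemLp g 2 (timeMeasure T)
  memLp_μ : MemLp μ 2 (timeMeasure T)
  memLp_d : MemLp d 2 (timeMeasure T)
  primitive_W : ∀ᵐ t ∂timeMeasure T,
    ‖S.N (S.j y₀) - (∫ s in (0 : ℝ)..t, S.proj (μ s)) - S.N (S.j (y t))‖ ≤ h * ‖S.proj (μ t)‖
  primitive_H : ∀ᵐ t ∂timeMeasure T,
    ‖√τ • S.j y₀ + (∫ s in (0 : ℝ)..t, d s) - √τ • S.j (y t)‖ ≤ h * ‖d t‖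
  mean : ∀ᵐ t ∂timeMeasure T, ⟪S.e, S.j (y t)⟫_ℝ = ⟪S.e, S.j y₀⟫_ℝ
  finite : ∀ᵐ t ∂timeMeasure T, Φ (S.j (y t)) ≠ ∞
  vi : ∀ᵐ t ∂timeMeasure T, ∀ v, Φ (S.j v) ≠ ∞ →
    √τ * ⟪d t, S.j (y t - v)⟫_ℝ + ⟪S.P (y t), S.P (y t - v)⟫_ℝ + (Φ (S.j (y t))).toReal
      + ⟪pi (g t) - u t, S.j (y t - v)⟫_ℝ ≤ ⟪S.i (μ t), S.j (y t - v)⟫_ℝ + (Φ (S.j v)).toReal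

/-- Stated for differences of two trajectories at one time: p of y, m of proj μ, D of d, U of u, G
of the nonlinearity. The vectors w and z are the primitives, which equal N j p and √τ j p up to the
errors a and b, so the left-hand side contains the derivative of ‖w‖² + ‖z‖². -/
theorem exists_stability_pointwise {L : ℝ} (hL : 0 ≤ L) : ∃ K, 0 ≤ K ∧
    ∀ (p : V) (m w : W) (D z U G : H) (s γ a b : ℝ), 0 ≤ γ → ‖G‖ ≤ L * (‖S.j p‖ + γ) →
      s * ⟪D, S.j p⟫_ℝ + ‖S.P p‖ ^ 2 + ⟪G - U, S.j p⟫_ℝ ≤ ⟪m, S.N (S.j p)⟫_ℝ →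
      ‖w - S.N (S.j p)‖ ≤ a → ‖z - s • S.j p‖ ≤ b →
      2 * ⟪-m, w⟫_ℝ + 2 * ⟪D, z⟫_ℝ + ‖p‖ ^ 2 ≤ K * ‖w‖ ^ 2 +
        (K * a ^ 2 + L ^ 2 * γ ^ 2 + ‖U‖ ^ 2 + 2 * (‖m‖ * a) + 2 * (‖D‖ * b)) := by
  -- In total 2L + 3 multiples of ‖jp‖² have to be absorbed by one ‖Pp‖²; with this ε, multiplying
  -- Ehrling's inequality by 2(L + 2) achieves it.
  obtain ⟨C, hC0, hC⟩ := S.ehrling (1 / (2 * (L + 2))) (by positivity)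
  refine ⟨4 * (C * (L + 2)), by positivity, ?_⟩
  intro p m w D z U G s γ a b hγ hG hvi hw hz
  have hE : (L + 2) * ‖S.j p‖ ^ 2 ≤ 1 / 2 * ‖S.P p‖ ^ 2
      + C * (L + 2) * ‖S.N (S.j p)‖ ^ 2 := by
    have h1 : ‖S.j p‖ ^ 2 ≤ 1 / (2 * (L + 2)) * ‖S.P p‖ ^ 2 + C * ‖S.N (S.j p)‖ ^ 2 := hC p
    have h2 := mul_le_mul_of_nonneg_left h1 (show 0 ≤ L + 2 by positivity)
    have h3 : (L + 2) * (1 / (2 * (L + 2)) * ‖S.P p‖ ^ 2) = 1 / 2 * ‖S.P p‖ ^ 2 := by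
      field_simp
    linarith
  have hN : ‖S.N (S.j p)‖ ^ 2 ≤ 2 * ‖w‖ ^ 2 + 2 * a ^ 2 := by
    have h1 : ‖S.N (S.j p)‖ ≤ ‖w‖ + a := by
      have := norm_sub_norm_le (S.N (S.j p)) w
      rw [norm_sub_rev] at this
      linarith
    have h2 : ‖S.N (S.j p)‖ ^ 2 ≤ (‖w‖ + a) ^ 2 := by gcongr
    nlinarith [sq_nonneg (‖w‖ - a)]
  have e1 : ⟪-m, w⟫_ℝ = -⟪m, S.N (S.j p)⟫_ℝ - ⟪m, w - S.N (S.j p)⟫_ℝ := by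
    rw [inner_neg_left, inner_sub_right]
    ring
  have e2 : ⟪D, z⟫_ℝ = s * ⟪D, S.j p⟫_ℝ + ⟪D, z - s • S.j p⟫_ℝ := by
    rw [inner_sub_right, real_inner_smul_right]
    ring
  have h1 : -⟪m, w - S.N (S.j p)⟫_ℝ ≤ ‖m‖ * a := by
    have h := (abs_le.1 (abs_real_inner_le_norm m (w - S.N (S.j p)))).1
    have h' : ‖m‖ * ‖w - S.N (S.j p)‖ ≤ ‖m‖ * a := by gcongr
    linarith
  have h2 : ⟪D, z - s • S.j p⟫_ℝ ≤ ‖D‖ * b :=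
    (real_inner_le_norm _ _).trans (by gcongr)
  have h3 : -⟪G, S.j p⟫_ℝ ≤ L * ‖S.j p‖ ^ 2 + (L ^ 2 * γ ^ 2 + ‖S.j p‖ ^ 2) / 2 := by
    have h := (abs_le.1 (abs_real_inner_le_norm G (S.j p))).1
    have h' : ‖G‖ * ‖S.j p‖ ≤ L * (‖S.j p‖ + γ) * ‖S.j p‖ := by gcongr
    nlinarith [sq_nonneg (L * γ - ‖S.j p‖)]
  have h4 : ⟪U, S.j p⟫_ℝ ≤ (‖U‖ ^ 2 + ‖S.j p‖ ^ 2) / 2 := by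
    have h := real_inner_le_norm U (S.j p)
    nlinarith [sq_nonneg (‖U‖ - ‖S.j p‖)]
  rw [inner_sub_left] at hvi
  rw [e1, e2, S.norm_sq]
  have hN' := mul_le_mul_of_nonneg_left hN (show 0 ≤ C * (L + 2) by positivity)
  have hP : 0 ≤ ‖S.j p‖ ^ 2 := by positivity
  linarith

/-- Continuous dependence of approximate solutions on the data. -/
theorem exists_stability {L T : ℝ} (hL : 0 ≤ L) (hT : 0 < T) : ∃ K, 0 ≤ K ∧
    ∀ {Φ : H → ℝ≥0∞} {pi : H → H} {τ h₁ h₂ : ℝ} {u₁ u₂ : ℝ → H} {y₀ : V} {y₁ y₂ : ℝ → V}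
      {g₁ g₂ : ℝ → H} {μ₁ μ₂ : ℝ → W} {d₁ d₂ : ℝ → H},
      (∀ x y, ‖pi x - pi y‖ ≤ L * ‖x - y‖) → 0 ≤ h₁ → h₁ ≤ 1 → 0 ≤ h₂ → h₂ ≤ 1 →
      MemLp u₁ 2 (timeMeasure T) → MemLp u₂ 2 (timeMeasure T) →
      S.IsTrajectory Φ pi T τ h₁ u₁ y₀ y₁ g₁ μ₁ d₁ → S.IsTrajectory Φ pi T τ h₂ u₂ y₀ y₂ g₂ μ₂ d₂ →
      ∀ t ∈ Icc 0 T,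
        (‖∫ s in (0 : ℝ)..t, (S.proj (μ₂ s) - S.proj (μ₁ s))‖ ^ 2
          + ‖∫ s in (0 : ℝ)..t, (d₁ s - d₂ s)‖ ^ 2) + ∫ s in (0 : ℝ)..t, ‖y₁ s - y₂ s‖ ^ 2 ≤
        K * ∫ s, (‖u₁ s - u₂ s‖ ^ 2 + (h₁ + h₂) * (‖S.proj (μ₁ s)‖ ^ 2 + ‖S.proj (μ₂ s)‖ ^ 2
          + ‖d₁ s‖ ^ 2 + ‖d₂ s‖ ^ 2) + (‖g₁ s - S.j (y₁ s)‖ ^ 2 + ‖g₂ s - S.j (y₂ s)‖ ^ 2))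
          ∂timeMeasure T := by
  obtain ⟨K, hK0, hK⟩ := S.exists_stability_pointwise hL
  set K₀ : ℝ := 1 + 4 * K + 4 + 2 * L ^ 2 with hK₀
  refine ⟨Real.exp (K * T) * K₀, by positivity, ?_⟩
  intro Φ pi τ h₁ h₂ u₁ u₂ y₀ y₁ y₂ g₁ g₂ μ₁ μ₂ d₁ d₂ hpi hh₁ hh₁' hh₂ hh₂' hu₁ hu₂ t₁ t₂ t ht
  have hm₁ : MemLp (fun t => S.proj (μ₁ t)) 2 (timeMeasure T) := S.proj.comp_memLp' t₁.memLp_μ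
  have hm₂ : MemLp (fun t => S.proj (μ₂ t)) 2 (timeMeasure T) := S.proj.comp_memLp' t₂.memLp_μ
  have hj₁ : MemLp (fun t => S.j (y₁ t)) 2 (timeMeasure T) := S.j.comp_memLp' t₁.memLp_y
  have hj₂ : MemLp (fun t => S.j (y₂ t)) 2 (timeMeasure T) := S.j.comp_memLp' t₂.memLp_y
  set G : ℝ → ℝ := fun s => ‖u₁ s - u₂ s‖ ^ 2 + (h₁ + h₂) * (‖S.proj (μ₁ s)‖ ^ 2
    + ‖S.proj (μ₂ s)‖ ^ 2 + ‖d₁ s‖ ^ 2 + ‖d₂ s‖ ^ 2)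
    + (‖g₁ s - S.j (y₁ s)‖ ^ 2 + ‖g₂ s - S.j (y₂ s)‖ ^ 2) with hG
  have hGi : Integrable G (timeMeasure T) :=
    ((integrable_norm_sq (hu₁.sub hu₂)).add (((((integrable_norm_sq hm₁).add (integrable_norm_sq hm₂)).add (integrable_norm_sq t₁.memLp_d)).add
      (integrable_norm_sq t₂.memLp_d)).const_mul _)).add
      ((integrable_norm_sq (t₁.memLp_g.sub hj₁)).add (integrable_norm_sq (t₂.memLp_g.sub hj₂)))
  have hmi : Integrable (fun s => S.proj (μ₂ s) - S.proj (μ₁ s)) (timeMeasure T) :=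
    (hm₂.sub hm₁).integrable (by norm_num)
  have hdi : Integrable (fun s => d₁ s - d₂ s) (timeMeasure T) :=
    (t₁.memLp_d.sub t₂.memLp_d).integrable (by norm_num)
  have hmi' := (integrable_timeMeasure_iff hT).1 hmi
  have hdi' := (integrable_timeMeasure_iff hT).1 hdi
  have hIcc : ∀ x ∈ Icc 0 T, x ∈ uIcc 0 T := fun x hx => by rwa [uIcc_of_le hT.le]
  -- The Gronwall quantity is built from the primitives, which are absolutely continuous, and not
  -- from y itself, which for interpolants is discontinuous.
  have key := add_integral_le_exp_mul_integral hT hK0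
    (φ := fun t => ‖∫ s in (0 : ℝ)..t, (S.proj (μ₂ s) - S.proj (μ₁ s))‖ ^ 2
          + ‖∫ s in (0 : ℝ)..t, (d₁ s - d₂ s)‖ ^ 2)
    (φ' := fun t => 2 * ⟪S.proj (μ₂ t) - S.proj (μ₁ t),
        ∫ s in (0 : ℝ)..t, (S.proj (μ₂ s) - S.proj (μ₁ s))⟫_ℝ
      + 2 * ⟪d₁ t - d₂ t, ∫ s in (0 : ℝ)..t, (d₁ s - d₂ s)⟫_ℝ)
    (q := fun t => ‖y₁ t - y₂ t‖ ^ 2) (G := fun t => K₀ * G t) ?_ (integrable_norm_sq (t₁.memLp_y.sub t₂.memLp_y))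
    (hGi.const_mul K₀) ?_ (fun t => by positivity) (fun t => by positivity) ?_ t ht
  · rw [integral_const_mul, ← mul_assoc] at key
    exact key
  · refine Integrable.add ?_ ?_
    · exact (integrable_timeMeasure_iff hT).2 (norm_sq_primitive hmi' left_mem_uIcc).1
    · exact (integrable_timeMeasure_iff hT).2 (norm_sq_primitive hdi' left_mem_uIcc).1
  · intro x hx
    obtain ⟨i1, e1⟩ := norm_sq_primitive hmi' (hIcc x hx)
    obtain ⟨i2, e2⟩ := norm_sq_primitive hdi' (hIcc x hx)
    rw [intervalIntegral.integral_add (intervalIntegrable_of_mem hT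
      ((integrable_timeMeasure_iff hT).2 i1) x hx) (intervalIntegrable_of_mem hT
      ((integrable_timeMeasure_iff hT).2 i2) x hx), e1, e2]
  · have hT' : ∀ᵐ t ∂timeMeasure T, t ∈ Icc 0 T :=
      ae_timeMeasure.2 (ae_of_all _ fun t ht => Ioo_subset_Icc_self ht)
    filter_upwards [hT', t₁.primitive_W, t₂.primitive_W, t₁.primitive_H, t₂.primitive_H, t₁.mean,
      t₂.mean, t₁.finite, t₂.finite, t₁.vi, t₂.vi]
      with s hs pW₁ pW₂ pH₁ pH₂ me₁ me₂ f₁ f₂ v₁ v₂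
    have im₁ := intervalIntegrable_of_mem hT ((hm₁.integrable (by norm_num))) s hs
    have im₂ := intervalIntegrable_of_mem hT ((hm₂.integrable (by norm_num))) s hs
    have id₁ := intervalIntegrable_of_mem hT ((t₁.memLp_d.integrable (by norm_num))) s hs
    have id₂ := intervalIntegrable_of_mem hT ((t₂.memLp_d.integrable (by norm_num))) s hs
    rw [intervalIntegral.integral_sub im₂ im₁, intervalIntegral.integral_sub id₁ id₂]
    set w₁ := ∫ x in (0 : ℝ)..s, S.proj (μ₁ x)
    set w₂ := ∫ x in (0 : ℝ)..s, S.proj (μ₂ x)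
    set z₁ := ∫ x in (0 : ℝ)..s, d₁ x
    set z₂ := ∫ x in (0 : ℝ)..s, d₂ x
    have hγ := hK (y₁ s - y₂ s) (S.proj (μ₁ s) - S.proj (μ₂ s)) (w₂ - w₁) (d₁ s - d₂ s) (z₁ - z₂)
      (u₁ s - u₂ s) (pi (g₁ s) - pi (g₂ s)) (√τ)
      (‖g₁ s - S.j (y₁ s)‖ + ‖g₂ s - S.j (y₂ s)‖)
      (h₁ * ‖S.proj (μ₁ s)‖ + h₂ * ‖S.proj (μ₂ s)‖) (h₁ * ‖d₁ s‖ + h₂ * ‖d₂ s‖) (by positivity)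
      ?_ ?_ ?_ ?_
    · rw [neg_sub] at hγ
      refine hγ.trans (add_le_add (mul_le_mul_of_nonneg_left
        (le_add_of_nonneg_right (sq_nonneg _)) hK0) ?_)
      exact stability_error_le hK0 hh₁ hh₁' hh₂ hh₂' (norm_nonneg _) (norm_nonneg _) (norm_nonneg _)
        (norm_nonneg _) (sq_nonneg _) (norm_sub_le _ _) (norm_sub_le _ _)
    · refine (hpi _ _).trans (mul_le_mul_of_nonneg_left ?_ hL)
      have : g₁ s - g₂ s = S.j (y₁ s - y₂ s) + ((g₁ s - S.j (y₁ s)) - (g₂ s - S.j (y₂ s))) := by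
        rw [map_sub]
        abel
      rw [this]
      exact (norm_add_le _ _).trans (add_le_add le_rfl (norm_sub_le _ _))
    -- Each inequality is tested with the other trajectory and the two are added: the potentials
    -- cancel, and equality of the means removes the component of μ along e.
    · have h1 := v₁ (y₂ s) f₂
      have h2 := v₂ (y₁ s) f₁
      rw [S.inner_i_eq, map_sub S.j, inner_sub_right S.e, me₁, me₂, sub_self, mul_zero, add_zero]
        at h1
      rw [S.inner_i_eq, map_sub S.j, inner_sub_right S.e, me₁, me₂, sub_self, mul_zero, add_zero]
        at h2
      rw [← neg_sub (S.j (y₁ s)), ← neg_sub (y₁ s), map_neg S.P, map_neg S.N] at h2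
      simp only [inner_neg_right] at h2
      have e : ‖S.P (y₁ s - y₂ s)‖ ^ 2 = ⟪S.P (y₁ s), S.P (y₁ s - y₂ s)⟫_ℝ
          - ⟪S.P (y₂ s), S.P (y₁ s - y₂ s)⟫_ℝ := by
        rw [← inner_sub_left, ← map_sub, real_inner_self_eq_norm_sq]
      rw [e, S.j.map_sub]
      simp only [inner_sub_left] at h1 h2 ⊢
      linarith
    · have : w₂ - w₁ - S.N (S.j (y₁ s - y₂ s)) = (S.N (S.j y₀) - w₁ - S.N (S.j (y₁ s)))
          - (S.N (S.j y₀) - w₂ - S.N (S.j (y₂ s))) := by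
        rw [map_sub, map_sub]
        abel
      rw [this]
      exact (norm_sub_le _ _).trans (add_le_add pW₁ pW₂)
    · have : z₁ - z₂ - √τ • S.j (y₁ s - y₂ s) = (√τ • S.j y₀ + z₁ - √τ • S.j (y₁ s))
          - (√τ • S.j y₀ + z₂ - √τ • S.j (y₂ s)) := by
        rw [map_sub, smul_sub]
        abel
      rw [this]
      exact (norm_sub_le _ _).trans (add_le_add pH₁ pH₂)

end EvolutionSpaces

/-! ### Piecewise constant functions in time -/

section StepFunctions

variable {X : Type*} [NormedAddCommGroup X]

theorem stronglyMeasurable_step (a : ℕ → X) (h : ℝ) :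
    StronglyMeasurable fun t : ℝ => a ⌊t / h⌋₊ :=
  (StronglyMeasurable.of_discrete (f := a)).comp_measurable
    (Nat.measurable_floor.comp (measurable_id.div_const h))

theorem floor_div_lt {h T t : ℝ} {n : ℕ} (hh : 0 < h) (hn : n * h = T) (ht : t ∈ Ioo 0 T) :
    ⌊t / h⌋₊ < n := by
  rw [Nat.floor_lt (div_nonneg ht.1.le hh.le), div_lt_iff₀ hh, hn]
  exact ht.2

theorem memLp_step (a : ℕ → X) {h T : ℝ} {n : ℕ} (hh : 0 < h) (hn : n * h = T) :
    MemLp (fun t : ℝ => a ⌊t / h⌋₊) 2 (timeMeasure T) := by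
  refine MemLp.of_bound (stronglyMeasurable_step a h).aestronglyMeasurable
    (∑ l ∈ Finset.range n, ‖a l‖) (ae_timeMeasure.2 (ae_of_all _ fun t ht => ?_))
  exact Finset.single_le_sum (f := fun l => ‖a l‖) (fun l _ => norm_nonneg _)
    (Finset.mem_range.2 (floor_div_lt hh hn ht))

theorem step_ae_eq {α : Type*} (a : ℕ → α) {h : ℝ} (hh : 0 < h) (k : ℕ) {t : ℝ}
    (ht : t ∈ Icc (k * h) ((k + 1) * h)) :
    ∀ᵐ s : ℝ, s ∈ uIoc (k * h) t → a ⌊s / h⌋₊ = a k := by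
  have h1 : ∀ᵐ s : ℝ, s ≠ (k + 1) * h := by simp [ae_iff]
  filter_upwards [h1] with s hs hs'
  rw [uIoc_of_le ht.1] at hs'
  have : ⌊s / h⌋₊ = k := by
    rw [Nat.floor_eq_iff (div_nonneg (le_trans (by positivity) hs'.1.le) hh.le), le_div_iff₀ hh,
      div_lt_iff₀ hh]
    exact ⟨hs'.1.le, lt_of_le_of_ne (hs'.2.trans ht.2) hs⟩
  rw [this]

theorem intervalIntegrable_step_part (a : ℕ → X) {h : ℝ} (hh : 0 < h) (k : ℕ) {t : ℝ}
    (ht : t ∈ Icc (k * h) ((k + 1) * h)) :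
    IntervalIntegrable (fun s : ℝ => a ⌊s / h⌋₊) volume (k * h) t := by
  refine (intervalIntegrable_const (c := a k)).congr_ae ?_
  refine (ae_restrict_iff' measurableSet_uIoc).2 ?_
  filter_upwards [step_ae_eq a hh k ht] with s hs hs'
  exact (hs hs').symm

variable [NormedSpace ℝ X]

theorem integral_step_part [CompleteSpace X] (a : ℕ → X) {h : ℝ} (hh : 0 < h) (k : ℕ) {t : ℝ}
    (ht : t ∈ Icc (k * h) ((k + 1) * h)) :
    ∫ s in (k * h)..t, a ⌊s / h⌋₊ = (t - k * h) • a k := by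
  rw [intervalIntegral.integral_congr_ae (step_ae_eq a hh k ht), intervalIntegral.integral_const]

theorem integral_step [CompleteSpace X] (a : ℕ → X) {h : ℝ} (hh : 0 < h) (k : ℕ) :
    IntervalIntegrable (fun s : ℝ => a ⌊s / h⌋₊) volume 0 (k * h) ∧
    ∫ s in (0 : ℝ)..(k * h), a ⌊s / h⌋₊ = h • ∑ l ∈ Finset.range k, a l := by
  induction k with
  | zero => simp
  | succ k ih =>
    have hmem : ((k + 1 : ℕ) : ℝ) * h ∈ Icc (k * h) ((k + 1) * h) := by
      push_cast
      exact ⟨by nlinarith, le_rfl⟩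
    have i2 := intervalIntegrable_step_part a hh k hmem
    refine ⟨ih.1.trans i2, ?_⟩
    rw [← intervalIntegral.integral_add_adjacent_intervals ih.1 i2, ih.2,
      integral_step_part a hh k hmem, Finset.sum_range_succ, smul_add]
    congr 2
    push_cast
    ring

/-- The primitive of the difference quotients is the piecewise affine interpolant of b. On the k-th
interval it differs from the value at the right end by (t - (k+1)h) times the slope, which is the
consistency error allowed to a trajectory. -/
theorem norm_add_primitive_step_sub_le [CompleteSpace X] (a b : ℕ → X) {h t : ℝ} (hh : 0 < h)
    (hab : ∀ k, b (k + 1) - b k = h • a k) (ht : 0 ≤ t) :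
    ‖b 0 + (∫ s in (0 : ℝ)..t, a ⌊s / h⌋₊) - b (⌊t / h⌋₊ + 1)‖ ≤ h * ‖a ⌊t / h⌋₊‖ := by
  set k := ⌊t / h⌋₊ with hk
  have hk' := (Nat.floor_eq_iff (div_nonneg ht hh.le)).1 hk.symm
  rw [le_div_iff₀ hh, div_lt_iff₀ hh] at hk'
  have hmem : t ∈ Icc (k * h) ((k + 1) * h) := ⟨hk'.1, hk'.2.le⟩
  rw [← intervalIntegral.integral_add_adjacent_intervals (integral_step a hh k).1
    (intervalIntegrable_step_part a hh k hmem), (integral_step a hh k).2,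
    integral_step_part a hh k hmem, Finset.smul_sum]
  have hsum : ∑ l ∈ Finset.range k, h • a l = b k - b 0 := by
    rw [← Finset.sum_range_sub]
    exact Finset.sum_congr rfl fun l _ => (hab l).symm
  have e : b 0 + (∑ l ∈ Finset.range k, h • a l + (t - k * h) • a k) - b (k + 1) =
      (t - k * h - h) • a k := by
    rw [hsum, sub_smul (t - k * h) h, ← hab k]
    abel
  rw [e, norm_smul, Real.norm_eq_abs]
  gcongr
  rw [abs_le]
  constructor <;> linarith

theorem integral_timeMeasure_step (a : ℕ → ℝ) {h T : ℝ} {n : ℕ} (hT : 0 < T) (hh : 0 < h)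
    (hn : n * h = T) :
    ∫ t, a ⌊t / h⌋₊ ∂timeMeasure T = h * ∑ l ∈ Finset.range n, a l := by
  rw [integral_timeMeasure hT, ← hn, (integral_step a hh n).2, smul_eq_mul]

end StepFunctions

namespace EvolutionSpaces

variable {H V W : Type*}
    [NormedAddCommGroup H] [InnerProductSpace ℝ H] [CompleteSpace H]
    [NormedAddCommGroup V] [InnerProductSpace ℝ V] [CompleteSpace V]
    [NormedAddCommGroup W] [InnerProductSpace ℝ W] [CompleteSpace W]
    {S : EvolutionSpaces H V W}

/-- The piecewise constant interpolants of a discrete solution. -/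
theorem IsScheme.isTrajectory {Φ : H → ℝ≥0∞} {pi : H → H} {τ h T : ℝ} {n : ℕ} {u : ℕ → H}
    {Y : ℕ → V} {μ : ℕ → W} (hs : S.IsScheme Φ pi τ h u Y μ) (hτ : 0 ≤ τ) (hh : 0 < h)
    (hn : n * h = T) :
    S.IsTrajectory Φ pi T τ h (fun t => u (⌊t / h⌋₊ + 1)) (Y 0) (fun t => Y (⌊t / h⌋₊ + 1))
      (fun t => S.j (Y ⌊t / h⌋₊)) (fun t => μ ⌊t / h⌋₊)
      (fun t => √τ • h⁻¹ • S.j (Y (⌊t / h⌋₊ + 1) - Y ⌊t / h⌋₊)) where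
  memLp_y := memLp_step (fun k => Y (k + 1)) hh hn
  memLp_g := memLp_step (fun k => S.j (Y k)) hh hn
  memLp_μ := memLp_step μ hh hn
  memLp_d := memLp_step (fun k => √τ • h⁻¹ • S.j (Y (k + 1) - Y k)) hh hn
  primitive_W := by
    refine ae_timeMeasure.2 (ae_of_all _ fun t ht => ?_)
    have := norm_add_primitive_step_sub_le (fun k => -S.proj (μ k)) (fun k => S.N (S.j (Y k))) hh
      (fun k => by rw [← map_sub, ← map_sub, hs.eqn, smul_neg, neg_smul]) ht.1.le
    rw [intervalIntegral.integral_neg, norm_neg, ← sub_eq_add_neg] at this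
    exact this
  primitive_H := by
    refine ae_timeMeasure.2 (ae_of_all _ fun t ht => ?_)
    exact norm_add_primitive_step_sub_le (fun k => √τ • h⁻¹ • S.j (Y (k + 1) - Y k))
      (fun k => √τ • S.j (Y k)) hh
      (fun k => by
        rw [← smul_sub, ← map_sub, smul_comm h, smul_smul h, mul_inv_cancel₀ hh.ne', one_smul])
      ht.1.le
  mean := ae_of_all _ fun t => hs.mean _
  finite := ae_of_all _ fun t => hs.finite _
  vi := by
    refine ae_of_all _ fun t v hv => ?_
    have h1 := hs.vi ⌊t / h⌋₊ v hv
    have e : ∀ x : ℝ, √τ * (√τ * (h⁻¹ * x)) = τ / h * x := fun x => by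
      rw [← mul_assoc, Real.mul_self_sqrt hτ, ← mul_assoc, div_eq_mul_inv]
    rw [real_inner_smul_left, real_inner_smul_left, e]
    exact h1

end EvolutionSpaces

/-! ### Square-integrable functions of time -/

theorem integral_congr_timeMeasure {X : Type*} [NormedAddCommGroup X] [NormedSpace ℝ X] {T t : ℝ}
    {f g : ℝ → X} (h : f =ᵐ[timeMeasure T] g) (ht : t ∈ Icc 0 T) :
    ∫ s in (0 : ℝ)..t, f s = ∫ s in (0 : ℝ)..t, g s := by
  rw [intervalIntegral.integral_of_le ht.1, intervalIntegral.integral_of_le ht.1,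
    integral_Ioc_eq_integral_Ioo, integral_Ioc_eq_integral_Ioo]
  exact integral_congr_ae (ae_restrict_of_ae_restrict_of_subset (Ioo_subset_Ioo_right ht.2) h)

theorem integral_norm_le_mul_norm {E : Type*} [NormedAddCommGroup E] {T : ℝ}
    (f : Lp E 2 (timeMeasure T)) :
    ∫ t, ‖f t‖ ∂timeMeasure T ≤ (timeMeasure T univ ^ (1 / 2 : ℝ)).toReal * ‖f‖ := by
  have hf := Lp.memLp f
  have h1 : eLpNorm f 1 (timeMeasure T) ≤ eLpNorm f 2 (timeMeasure T) *
      timeMeasure T univ ^ (1 / (1 : ℝ≥0∞).toReal - 1 / (2 : ℝ≥0∞).toReal) :=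
    eLpNorm_le_eLpNorm_mul_rpow_measure_univ (by norm_num) hf.1
  have e : 1 / (1 : ℝ≥0∞).toReal - 1 / (2 : ℝ≥0∞).toReal = 1 / 2 := by norm_num
  rw [e] at h1
  rw [integral_norm_eq_lintegral_enorm hf.1, ← eLpNorm_one_eq_lintegral_enorm, Lp.norm_def,
    mul_comm, ← ENNReal.toReal_mul]
  exact ENNReal.toReal_mono (ENNReal.mul_ne_top hf.2.ne
    (ENNReal.rpow_ne_top_of_nonneg (by norm_num) (measure_ne_top _ _))) h1

theorem convex_norm_sub_le {E F : Type*} [NormedAddCommGroup E] [NormedSpace ℝ E]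
    [NormedAddCommGroup F] [NormedSpace ℝ F] (f : E →L[ℝ] F) (a : F) (r : ℝ) :
    Convex ℝ {x | ‖f x - a‖ ≤ r} := by
  have h := (convex_closedBall a r).linear_preimage f.toLinearMap
  convert h using 1
  ext x
  simp [dist_eq_norm]

section LpLemmas

variable {E F : Type*} [NormedAddCommGroup E] [InnerProductSpace ℝ E]
  [NormedAddCommGroup F] [InnerProductSpace ℝ F] {T : ℝ}

theorem norm_sq_Lp (f : Lp E 2 (timeMeasure T)) : ‖f‖ ^ 2 = ∫ t, ‖f t‖ ^ 2 ∂timeMeasure T := by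
  rw [← real_inner_self_eq_norm_sq, L2.inner_def]
  exact integral_congr_ae (ae_of_all _ fun t => real_inner_self_eq_norm_sq _)

theorem norm_sq_toLp {f : ℝ → E} (hf : MemLp f 2 (timeMeasure T)) :
    ‖hf.toLp f‖ ^ 2 = ∫ t, ‖f t‖ ^ 2 ∂timeMeasure T := by
  rw [norm_sq_Lp]
  refine integral_congr_ae ?_
  filter_upwards [hf.coeFn_toLp] with t ht
  rw [ht]

/-- Evaluation at time `t` of the primitive of a square integrable function. -/
theorem exists_primitiveL [CompleteSpace E] (hT : 0 < T) {t : ℝ} (ht : t ∈ Icc 0 T) :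
    ∃ I : Lp E 2 (timeMeasure T) →L[ℝ] E, ∀ f, I f = ∫ s in (0 : ℝ)..t, f s := by
  have hi : ∀ f : Lp E 2 (timeMeasure T), Integrable f (timeMeasure T) := fun f =>
    (Lp.memLp f).integrable (by norm_num)
  let I₀ : Lp E 2 (timeMeasure T) →ₗ[ℝ] E :=
    { toFun := fun f => ∫ s in (0 : ℝ)..t, f s
      map_add' := fun f g => by
        rw [integral_congr_timeMeasure (Lp.coeFn_add f g) ht]
        exact intervalIntegral.integral_add (intervalIntegrable_of_mem hT (hi f) t ht)
          (intervalIntegrable_of_mem hT (hi g) t ht)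
      map_smul' := fun c f => by
        rw [integral_congr_timeMeasure (Lp.coeFn_smul c f) ht, RingHom.id_apply]
        exact intervalIntegral.integral_smul c _ }
  refine ⟨I₀.mkContinuous (timeMeasure T univ ^ (1 / 2 : ℝ)).toReal fun f => ?_, fun f => rfl⟩
  refine le_trans ?_ (integral_norm_le_mul_norm f)
  change ‖∫ s in (0 : ℝ)..t, f s‖ ≤ _
  refine (intervalIntegral.norm_integral_le_integral_norm ht.1).trans ?_
  rw [integral_timeMeasure hT]
  exact intervalIntegral.integral_mono_interval le_rfl ht.1 ht.2
    (ae_of_all _ fun s => norm_nonneg _) ((integrable_timeMeasure_iff hT).1 (hi f).norm)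

/-- Lets pointwise constraints survive a weak limit. For closedness, a subsequence of an
L²-convergent sequence converges almost everywhere; it is extracted once for each component. -/
theorem isClosed_convex_ae_mem {Q : ℝ → Set (E × F)} (hQ : ∀ t, IsClosed (Q t))
    (hQc : ∀ t, Convex ℝ (Q t)) :
    IsClosed {x : Lp E 2 (timeMeasure T) × Lp F 2 (timeMeasure T) |
      ∀ᵐ t ∂timeMeasure T, (x.1 t, x.2 t) ∈ Q t} ∧
    Convex ℝ {x : Lp E 2 (timeMeasure T) × Lp F 2 (timeMeasure T) |
      ∀ᵐ t ∂timeMeasure T, (x.1 t, x.2 t) ∈ Q t} := by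
  constructor
  · refine IsSeqClosed.isClosed fun x z hx hz => ?_
    have h1 : Tendsto (fun n => (x n).1) atTop (𝓝 z.1) := (continuous_fst.tendsto z).comp hz
    have h2 : Tendsto (fun n => (x n).2) atTop (𝓝 z.2) := (continuous_snd.tendsto z).comp hz
    obtain ⟨φ, hφ, hφ'⟩ := (tendstoInMeasure_of_tendsto_Lp h1).exists_seq_tendsto_ae
    obtain ⟨ψ, hψ, hψ'⟩ := (tendstoInMeasure_of_tendsto_Lp
      (h2.comp hφ.tendsto_atTop)).exists_seq_tendsto_ae
    filter_upwards [hφ', hψ', ae_all_iff.2 hx] with t ht1 ht2 ht3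
    exact (hQ t).mem_of_tendsto ((ht1.comp hψ.tendsto_atTop).prodMk_nhds ht2)
      (Eventually.of_forall fun n => ht3 _)
  · intro x hx z hz a b ha hb hab
    filter_upwards [hx, hz, Lp.coeFn_add (a • x.1) (b • z.1), Lp.coeFn_add (a • x.2) (b • z.2),
      Lp.coeFn_smul a x.1, Lp.coeFn_smul a x.2, Lp.coeFn_smul b z.1, Lp.coeFn_smul b z.2]
      with t h1 h2 e1 e2 e3 e4 e5 e6
    have := hQc t h1 h2 ha hb hab
    simp only [Prod.fst_add, Prod.snd_add, Prod.smul_fst, Prod.smul_snd]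
    rw [e1, e2]
    simp only [Pi.add_apply]
    rw [e3, e4, e5, e6]
    exact this

/-- The suprema of the tails: with b n as tolerance, a single constraint set contains all
approximations from the n-th on. -/
theorem exists_tail_bound {α : Type*} {m : MeasurableSpace α} {ν : Measure α} {r : ℕ → α → ℝ}
    (hr : ∀ᵐ t ∂ν, Tendsto (fun n => r n t) atTop (𝓝 0)) :
    ∃ b : ℕ → α → ℝ, ∀ᵐ t ∂ν, (∀ n k, n ≤ k → r k t ≤ b n t) ∧
      Tendsto (fun n => b n t) atTop (𝓝 0) := by
  refine ⟨fun n t => ⨆ k, r (n + k) t, ?_⟩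
  filter_upwards [hr] with t ht
  have hbd : BddAbove (range fun n => r n t) := ht.bddAbove_range
  have hbd' : ∀ n, BddAbove (range fun k => r (n + k) t) := fun n =>
    hbd.mono (by rintro _ ⟨k, rfl⟩; exact ⟨n + k, rfl⟩)
  have hle : ∀ n k, n ≤ k → r k t ≤ ⨆ l, r (n + l) t := fun n k h => by
    obtain ⟨l, rfl⟩ := Nat.exists_eq_add_of_le h
    exact le_ciSup (hbd' n) l
  refine ⟨hle, ?_⟩
  rw [Metric.tendsto_atTop] at ht ⊢
  intro ε hε
  obtain ⟨N, hN⟩ := ht (ε / 2) (by positivity)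
  refine ⟨N, fun n hn => ?_⟩
  have h1 : ⨆ l, r (n + l) t ≤ ε / 2 := ciSup_le fun l => by
    have := hN (n + l) (by omega)
    rw [Real.dist_eq, sub_zero] at this
    exact (le_abs_self _).trans this.le
  have h2 := hle n n le_rfl
  have h3 := hN n hn
  rw [Real.dist_eq, sub_zero, abs_lt] at h3 ⊢
  constructor <;> linarith

theorem exists_subseq_tendsto_zero_ae {r : ℕ → ℝ → ℝ} (hi : ∀ n, Integrable (r n) (timeMeasure T))
    (h0 : ∀ n t, 0 ≤ r n t)
    (hr : Tendsto (fun n => ∫ t, r n t ∂timeMeasure T) atTop (𝓝 0)) :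
    ∃ ns : ℕ → ℕ, StrictMono ns ∧
      ∀ᵐ t ∂timeMeasure T, Tendsto (fun n => r (ns n) t) atTop (𝓝 0) := by
  have h1 : Tendsto (fun n => eLpNorm (r n - fun _ => (0 : ℝ)) 1 (timeMeasure T)) atTop (𝓝 0) := by
    have e : ∀ n, eLpNorm (r n - fun _ => (0 : ℝ)) 1 (timeMeasure T) =
        ENNReal.ofReal (∫ t, r n t ∂timeMeasure T) := by
      intro n
      rw [eLpNorm_one_eq_lintegral_enorm, ofReal_integral_eq_lintegral_ofReal (hi n)
        (ae_of_all _ (h0 n))]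
      refine lintegral_congr fun t => ?_
      simp [Real.enorm_of_nonneg (h0 n t)]
    simp only [e]
    rw [← ENNReal.ofReal_zero]
    exact ENNReal.tendsto_ofReal hr
  exact (tendstoInMeasure_of_tendsto_eLpNorm one_ne_zero (fun n => (hi n).aestronglyMeasurable)
    aestronglyMeasurable_const h1).exists_seq_tendsto_ae

end LpLemmas

/-! ### Approximate solutions and their errors -/

theorem perturbation_error_le {p L K M δ γ ω ν : ℝ} (hp : 0 ≤ p) (hL : 0 ≤ L) (hK : 0 ≤ K)
    (hM : 0 ≤ M) (hδ : 0 ≤ δ) (hγ : 0 ≤ γ) (hω : 0 ≤ ω) (hν : 0 ≤ ν) :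
    δ * (K + ν) + K * δ + (p + L * K + M) * δ + (L * (δ + γ) + ω) * (K + ν) ≤
      (4 + p + 2 * L + M) * (K + 1) * (δ + γ + ω) * (1 + ν) := by
  obtain ⟨Q, hQ⟩ : ∃ Q, Q = (K + 1) * (1 + ν) := ⟨_, rfl⟩
  have hKν : 0 ≤ K * ν := mul_nonneg hK hν
  have h1 : K + ν ≤ Q := by rw [hQ]; linarith
  have h2 : K ≤ Q := by linarith
  have h3 : 1 ≤ Q := by rw [hQ]; linarith
  have hQ0 : 0 ≤ Q := by linarith
  have e : (4 + p + 2 * L + M) * (K + 1) * (δ + γ + ω) * (1 + ν) =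
      (4 + p + 2 * L + M) * ((δ + γ + ω) * Q) := by rw [hQ]; ring
  have s1 : δ * (K + ν) ≤ δ * Q := by gcongr
  have s2 : K * δ ≤ Q * δ := by gcongr
  have s3 : (p + L * K + M) * δ ≤ (p * Q + L * Q + M * Q) * δ := by
    gcongr
    · exact le_mul_of_one_le_right hp h3
    · exact le_mul_of_one_le_right hM h3
  have s4 : (L * (δ + γ) + ω) * (K + ν) ≤ (L * (δ + γ) + ω) * Q := by gcongr
  have s5 : 0 ≤ Q * (4 * γ + 3 * ω + 2 * δ + p * (γ + ω) + L * (2 * ω + γ) + M * (γ + ω)) := by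
    positivity
  rw [e]
  linarith

namespace EvolutionSpaces

variable {H V W : Type*}
    [NormedAddCommGroup H] [InnerProductSpace ℝ H] [CompleteSpace H]
    [NormedAddCommGroup V] [InnerProductSpace ℝ V] [CompleteSpace V]
    [NormedAddCommGroup W] [InnerProductSpace ℝ W] [CompleteSpace W]
    (S : EvolutionSpaces H V W)

/-- The effect on the variational inequality of replacing `(y', g, u')` by `(y, j y, u)`. -/
theorem vi_perturbation {pi : H → H} {L K M τ : ℝ} (hL : 0 ≤ L) (hK : 0 ≤ K) (hM : 0 ≤ M)
    (hpi : ∀ x y, ‖pi x - pi y‖ ≤ L * ‖x - y‖)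
    {y y' v : V} {g u u' d : H} {μ : W} {c Ψ : ℝ} (hy : ‖y‖ ≤ K) (hy' : ‖y'‖ ≤ K) (hg : ‖g‖ ≤ K)
    (hu : ‖u'‖ ≤ M)
    (h : √τ * ⟪d, S.j (y' - v)⟫_ℝ + ⟪S.P y', S.P (y' - v)⟫_ℝ + c + ⟪pi g - u', S.j (y' - v)⟫_ℝ ≤
      ⟪S.i μ, S.j (y' - v)⟫_ℝ + Ψ) :
    √τ * ⟪d, S.j (y - v)⟫_ℝ + ⟪S.P y, S.P (y - v)⟫_ℝ + c + ⟪pi (S.j y) - u, S.j (y - v)⟫_ℝ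
      - ((4 + ‖pi 0‖ + 2 * L + M) * (K + 1) * (‖y' - y‖ + ‖g - S.j y'‖ + ‖u' - u‖)
        + (√τ + ‖S.i‖) * ((‖μ‖ + ‖d‖) * ‖y' - y‖)) * (1 + ‖v‖) ≤
      ⟪S.i μ, S.j (y - v)⟫_ℝ + Ψ := by
  have hpi0 : ‖pi g‖ ≤ ‖pi 0‖ + L * K := by
    have h1 := hpi g 0
    rw [sub_zero] at h1
    have h2 := norm_sub_norm_le (pi g) (pi 0)
    have h3 : L * ‖g‖ ≤ L * K := by gcongr
    linarith
  obtain ⟨δ, hδ⟩ : ∃ δ, δ = ‖y' - y‖ := ⟨_, rfl⟩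
  obtain ⟨γ, hγ⟩ : ∃ γ, γ = ‖g - S.j y'‖ := ⟨_, rfl⟩
  obtain ⟨ω, hω⟩ : ∃ ω, ω = ‖u' - u‖ := ⟨_, rfl⟩
  obtain ⟨ν, hν⟩ : ∃ ν, ν = ‖v‖ := ⟨_, rfl⟩
  have hδ0 : 0 ≤ δ := hδ ▸ norm_nonneg _
  have hγ0 : 0 ≤ γ := hγ ▸ norm_nonneg _
  have hω0 : 0 ≤ ω := hω ▸ norm_nonneg _
  have hν0 : 0 ≤ ν := hν ▸ norm_nonneg _
  have hyv : ‖y - v‖ ≤ K + ν := (norm_sub_le _ _).trans (by rw [hν]; gcongr)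
  have hjδ : ‖S.j (y - y')‖ ≤ δ := (S.norm_j_le _).trans (by rw [norm_sub_rev, hδ])
  have hPδ : ‖S.P (y - y')‖ ≤ δ := (S.norm_P_le _).trans (by rw [norm_sub_rev, hδ])
  have ed : ∀ x : H, ⟪x, S.j (y - v)⟫_ℝ = ⟪x, S.j (y' - v)⟫_ℝ + ⟪x, S.j (y - y')⟫_ℝ := fun x => by
    rw [← inner_add_right, ← map_add]
    congr 2
    abel
  have eP : ⟪S.P y, S.P (y - v)⟫_ℝ = ⟪S.P y', S.P (y' - v)⟫_ℝ + ⟪S.P (y - y'), S.P (y - v)⟫_ℝ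
      + ⟪S.P y', S.P (y - y')⟫_ℝ := by
    simp only [map_sub, inner_sub_left, inner_sub_right]
    ring
  have epi : ⟪pi (S.j y) - u, S.j (y - v)⟫_ℝ = ⟪pi g - u', S.j (y - v)⟫_ℝ
      + ⟪(pi (S.j y) - pi g) + (u' - u), S.j (y - v)⟫_ℝ := by
    rw [← inner_add_left]
    congr 1
    abel
  have b1 : √τ * ⟪d, S.j (y - y')⟫_ℝ ≤ √τ * (‖d‖ * δ) := by
    gcongr
    exact (real_inner_le_norm _ _).trans (by gcongr)
  have b2 : -⟪S.i μ, S.j (y - y')⟫_ℝ ≤ ‖S.i‖ * (‖μ‖ * δ) := by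
    rw [← inner_neg_left]
    refine (real_inner_le_norm _ _).trans ?_
    rw [norm_neg, ← mul_assoc]
    gcongr
    exact S.i.le_opNorm μ
  have b3 : ⟪S.P (y - y'), S.P (y - v)⟫_ℝ ≤ δ * (K + ν) :=
    (real_inner_le_norm _ _).trans (by gcongr; exact (S.norm_P_le _).trans hyv)
  have b4 : ⟪S.P y', S.P (y - y')⟫_ℝ ≤ K * δ :=
    (real_inner_le_norm _ _).trans (by gcongr; exact (S.norm_P_le _).trans hy')
  have b5 : ⟪pi g - u', S.j (y - y')⟫_ℝ ≤ (‖pi 0‖ + L * K + M) * δ :=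
    (real_inner_le_norm _ _).trans (by
      gcongr
      exact (norm_sub_le _ _).trans (add_le_add hpi0 hu))
  have b6 : ⟪(pi (S.j y) - pi g) + (u' - u), S.j (y - v)⟫_ℝ ≤ (L * (δ + γ) + ω) * (K + ν) := by
    refine (real_inner_le_norm _ _).trans ?_
    have h1 : ‖S.j y - g‖ ≤ δ + γ := by
      have : S.j y - g = S.j (y - y') - (g - S.j y') := by
        rw [map_sub]
        abel
      rw [this, hγ]
      exact (norm_sub_le _ _).trans (by gcongr)
    gcongr
    · refine (norm_add_le _ _).trans ?_
      rw [hω]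
      gcongr
      exact (hpi _ _).trans (by gcongr)
    · exact (S.norm_j_le _).trans hyv
  rw [ed d, ed (S.i μ), eP, epi, ed (pi g - u'), ← hδ, ← hγ, ← hω, ← hν]
  have c1 : K + ν ≤ (K + 1) * (1 + ν) := by nlinarith
  have c2 : 0 ≤ √τ := Real.sqrt_nonneg _
  have t1 : √τ * (‖d‖ * δ) + ‖S.i‖ * (‖μ‖ * δ) ≤
      (√τ + ‖S.i‖) * ((‖μ‖ + ‖d‖) * δ) * (1 + ν) := by
    have e1 : √τ * (‖d‖ * δ) + ‖S.i‖ * (‖μ‖ * δ) ≤ (√τ + ‖S.i‖) * ((‖μ‖ + ‖d‖) * δ) := by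
      have : 0 ≤ √τ * (‖μ‖ * δ) + ‖S.i‖ * (‖d‖ * δ) := by positivity
      linarith
    refine e1.trans (le_mul_of_one_le_right (by positivity) (by linarith))
  have t2 := perturbation_error_le (norm_nonneg (pi 0)) hL hK hM hδ0 hγ0 hω0 hν0
  rw [add_mul]
  linarith

end EvolutionSpaces

namespace EvolutionSpaces

variable {H V W : Type*}
    [NormedAddCommGroup H] [InnerProductSpace ℝ H] [CompleteSpace H]
    [NormedAddCommGroup V] [InnerProductSpace ℝ V] [CompleteSpace V]
    [NormedAddCommGroup W] [InnerProductSpace ℝ W] [CompleteSpace W]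
    (S : EvolutionSpaces H V W)

/-- An approximate solution of the problem with right-hand side `U` that is bounded by `K`. -/
structure IsApproximation (Φ : H → ℝ≥0∞) (pi : H → H) (T τ K h : ℝ) (U : ℝ → H) (y₀ : V)
    (u : ℝ → H) (y : ℝ → V) (g : ℝ → H) (μ : ℝ → W) (d : ℝ → H) : Prop
    extends S.IsTrajectory Φ pi T τ h u y₀ y g μ d where
  memLp_u : MemLp u 2 (timeMeasure T)
  norm_y : ∀ᵐ t ∂timeMeasure T, ‖y t‖ ≤ K
  norm_g : ∀ᵐ t ∂timeMeasure T, ‖g t‖ ≤ K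
  norm_u : ∀ᵐ t ∂timeMeasure T, ‖u t‖ ≤ K
  potential : ∀ᵐ t ∂timeMeasure T, (Φ (S.j (y t))).toReal ≤ K
  integral_μ : ∫ t, ‖μ t‖ ^ 2 ∂timeMeasure T ≤ K
  integral_d : ∫ t, ‖d t‖ ^ 2 ∂timeMeasure T ≤ K
  integral_g : ∫ t, ‖g t - S.j (y t)‖ ^ 2 ∂timeMeasure T ≤ K * h
  integral_u : ∫ t, ‖u t - U t‖ ^ 2 ∂timeMeasure T ≤ K * h
  compat : ∀ᵐ t ∂timeMeasure T, S.N (√τ • d t) = -τ • S.proj (μ t)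

variable {S} {Φ : H → ℝ≥0∞} {Pi : H → ℝ} {pi : H → H} {L c C : ℝ}

/-- The interpolants of the scheme with u sampled at the grid points. Hölder continuity of exponent
1/2 makes the squared sampling error O(h), and the bound for the squared increments of Y does the
same for the explicit argument g. -/
theorem exists_isApproximation (hp : IsPotential Φ Pi pi L c C) {T τmax M ρ : ℝ}
    (hτmax : 0 ≤ τmax) (hM : 0 ≤ M) (hρ : 0 < ρ) (hT : 0 < T) :
    ∃ K h₀, 0 ≤ K ∧ 0 < h₀ ∧ ∀ {τ h : ℝ} {n : ℕ} {U : ℝ → H} {y₀ : V},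
      0 ≤ τ → τ ≤ τmax → 0 < h → h ≤ h₀ → n * h = T → ‖y₀‖ ≤ M → Φ (S.j y₀) ≠ ∞ →
      (Φ (S.j y₀)).toReal ≤ M → S.MeanCondition Φ ρ M y₀ → MemLp U 2 (timeMeasure T) →
      (∀ t ∈ Icc 0 T, ‖U t‖ ≤ M) →
      (∀ s ∈ Icc 0 T, ∀ t ∈ Icc 0 T, ‖U t - U s‖ ^ 2 ≤ M * |t - s|) →
      ∑ k ∈ Finset.range n, ‖U ((k + 1 : ℕ) * h) - U (k * h)‖ ≤ M →
      ∃ u y g μ d, S.IsApproximation Φ pi T τ K h U y₀ u y g μ d := by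
  obtain ⟨K, h₀, hK, hh₀, hbd⟩ := exists_apriori_bound (S := S) hp hτmax hM hρ hT.le
  -- K is the a priori bound, M bounds the samples of U, and MT comes from integrating the squared
  -- sampling error Mh over (0, T).
  refine ⟨K + M + M * T, h₀, by positivity, hh₀, ?_⟩
  intro τ h n U y₀ hτ hτ' hh hhh hn hy₀ hfin hΦ hmean hU hUb hUh hUv
  obtain ⟨Y, μ, hY0, hs⟩ := S.exists_isScheme hp.convex hp.lsc pi hτ hh hρ (fun k => U (k * h))
    hfin hmean
  have hmem : ∀ k ≤ n, (k : ℝ) * h ∈ Icc 0 T := fun k hk =>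
    ⟨by positivity, by rw [← hn]; gcongr⟩
  obtain ⟨b1, b2, b3, b4⟩ := hbd hs hτ hτ' hh hhh hn (hY0 ▸ hy₀) (hY0 ▸ hΦ) (hY0 ▸ hmean)
    (fun k hk => hUb _ (hmem k hk)) hUv
  have htr := hs.isTrajectory hτ hh hn
  rw [hY0] at htr
  have hKK : K ≤ K + M + M * T := by nlinarith
  have hae : ∀ {p : ℝ → Prop}, (∀ t ∈ Ioo 0 T, p t) → ∀ᵐ t ∂timeMeasure T, p t := fun hp =>
    ae_timeMeasure.2 (ae_of_all _ hp)
  refine ⟨_, _, _, _, _, ⟨htr, memLp_step (fun k => U ((k + 1 : ℕ) * h)) hh hn,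
    hae fun t ht => (b1 _ (floor_div_lt hh hn ht)).1.trans hKK,
    hae fun t ht => (S.norm_j_le _).trans ((b1 _ (floor_div_lt hh hn ht).le).1.trans hKK),
    hae fun t ht => (hUb _ (hmem _ (floor_div_lt hh hn ht))).trans (by nlinarith),
    hae fun t ht => (b1 _ (floor_div_lt hh hn ht)).2.trans hKK, ?_, ?_, ?_, ?_, ?_⟩⟩
  · rw [integral_timeMeasure_step (fun k => ‖μ k‖ ^ 2) hT hh hn]
    exact b2.trans hKK
  · rw [integral_timeMeasure_step (fun k => ‖√τ • h⁻¹ • S.j (Y (k + 1) - Y k)‖ ^ 2) hT hh hn]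
    refine le_trans (le_of_eq ?_) (b3.trans hKK)
    refine congrArg _ (Finset.sum_congr rfl fun k _ => ?_)
    rw [norm_smul √τ, mul_pow, Real.norm_of_nonneg (Real.sqrt_nonneg _), Real.sq_sqrt hτ]
  · rw [integral_timeMeasure_step (fun k => ‖S.j (Y k) - S.j (Y (k + 1))‖ ^ 2) hT hh hn, mul_comm h]
    gcongr
    refine le_trans (le_of_eq ?_) (b4.trans hKK)
    refine Finset.sum_congr rfl fun k _ => ?_
    rw [norm_sub_rev, map_sub]
  · have h1 : ∀ᵐ t ∂timeMeasure T, ‖U ((⌊t / h⌋₊ + 1 : ℕ) * h) - U t‖ ^ 2 ≤ M * h := by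
      refine hae fun t ht => ?_
      refine (hUh t ⟨ht.1.le, ht.2.le⟩ _ (hmem _ (floor_div_lt hh hn ht))).trans ?_
      gcongr
      have h2 := Nat.floor_le (div_nonneg ht.1.le hh.le)
      have h3 := Nat.lt_floor_add_one (t / h)
      rw [le_div_iff₀ hh] at h2
      rw [div_lt_iff₀ hh] at h3
      push_cast
      rw [abs_of_nonneg (by linarith)]
      linarith
    have h4 := integral_mono_ae (integrable_norm_sq
      ((memLp_step (fun k => U ((k + 1 : ℕ) * h)) hh hn).sub hU)) (integrable_const _) h1
    refine h4.trans ?_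
    rw [integral_timeMeasure hT, intervalIntegral.integral_const, sub_zero, smul_eq_mul]
    nlinarith [mul_nonneg hK hh.le, mul_nonneg hM hh.le]
  · refine ae_of_all _ fun t => ?_
    have h1 := hs.eqn ⌊t / h⌋₊
    rw [map_smul, map_smul, map_smul, h1, smul_smul, smul_smul, smul_smul]
    rw [Real.mul_self_sqrt hτ]
    congr 1
    field_simp

/-- The right-hand side of the stability estimate for two approximations of one problem is of order
h₁ + h₂, which yields both the Cauchy property and a rate. -/
theorem IsApproximation.integral_sub_le {T τ K h₁ h₂ : ℝ} {U : ℝ → H} {y₀ : V} {u₁ u₂ : ℝ → H}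
    {y₁ y₂ : ℝ → V} {g₁ g₂ : ℝ → H} {μ₁ μ₂ : ℝ → W} {d₁ d₂ : ℝ → H} (hU : MemLp U 2 (timeMeasure T))
    (a₁ : S.IsApproximation Φ pi T τ K h₁ U y₀ u₁ y₁ g₁ μ₁ d₁)
    (a₂ : S.IsApproximation Φ pi T τ K h₂ U y₀ u₂ y₂ g₂ μ₂ d₂) (hh₁ : 0 ≤ h₁) (hh₂ : 0 ≤ h₂) :
    ∫ s, (‖u₁ s - u₂ s‖ ^ 2 + (h₁ + h₂) * (‖S.proj (μ₁ s)‖ ^ 2 + ‖S.proj (μ₂ s)‖ ^ 2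
          + ‖d₁ s‖ ^ 2 + ‖d₂ s‖ ^ 2) + (‖g₁ s - S.j (y₁ s)‖ ^ 2 + ‖g₂ s - S.j (y₂ s)‖ ^ 2))
          ∂timeMeasure T ≤ (5 + 2 * ‖S.proj‖ ^ 2) * K * (h₁ + h₂) := by
  have iu₁ : Integrable (fun s => ‖u₁ s - U s‖ ^ 2) (timeMeasure T) :=
    integrable_norm_sq (a₁.memLp_u.sub hU)
  have iu₂ : Integrable (fun s => ‖u₂ s - U s‖ ^ 2) (timeMeasure T) :=
    integrable_norm_sq (a₂.memLp_u.sub hU)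
  have im₁ := integrable_norm_sq a₁.memLp_μ
  have im₂ := integrable_norm_sq a₂.memLp_μ
  have id₁ := integrable_norm_sq a₁.memLp_d
  have id₂ := integrable_norm_sq a₂.memLp_d
  have ig₁ : Integrable (fun s => ‖g₁ s - S.j (y₁ s)‖ ^ 2) (timeMeasure T) :=
    integrable_norm_sq (a₁.memLp_g.sub (S.j.comp_memLp' a₁.memLp_y))
  have ig₂ : Integrable (fun s => ‖g₂ s - S.j (y₂ s)‖ ^ 2) (timeMeasure T) :=
    integrable_norm_sq (a₂.memLp_g.sub (S.j.comp_memLp' a₂.memLp_y))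
  have hb : ∫ s, (‖u₁ s - u₂ s‖ ^ 2 + (h₁ + h₂) * (‖S.proj (μ₁ s)‖ ^ 2 + ‖S.proj (μ₂ s)‖ ^ 2
          + ‖d₁ s‖ ^ 2 + ‖d₂ s‖ ^ 2) + (‖g₁ s - S.j (y₁ s)‖ ^ 2 + ‖g₂ s - S.j (y₂ s)‖ ^ 2))
          ∂timeMeasure T ≤
      ∫ s, (2 * (‖u₁ s - U s‖ ^ 2 + ‖u₂ s - U s‖ ^ 2)
        + (h₁ + h₂) * (‖S.proj‖ ^ 2 * (‖μ₁ s‖ ^ 2 + ‖μ₂ s‖ ^ 2)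
          + (‖d₁ s‖ ^ 2 + ‖d₂ s‖ ^ 2))
        + (‖g₁ s - S.j (y₁ s)‖ ^ 2 + ‖g₂ s - S.j (y₂ s)‖ ^ 2))
        ∂timeMeasure T := by
    refine integral_mono_of_nonneg (ae_of_all _ fun s => by positivity)
      ((((iu₁.add iu₂).const_mul 2).add ((((im₁.add im₂).const_mul _).add (id₁.add id₂)).const_mul
        _)).add (ig₁.add ig₂)) (ae_of_all _ fun s => ?_)
    have e1 : ‖u₁ s - u₂ s‖ ^ 2 ≤ 2 * (‖u₁ s - U s‖ ^ 2 + ‖u₂ s - U s‖ ^ 2) := by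
      have h := norm_sub_le_norm_sub_add_norm_sub (u₁ s) (U s) (u₂ s)
      rw [norm_sub_rev (U s)] at h
      calc ‖u₁ s - u₂ s‖ ^ 2 ≤ (‖u₁ s - U s‖ + ‖u₂ s - U s‖) ^ 2 := by gcongr
        _ ≤ _ := by nlinarith [sq_nonneg (‖u₁ s - U s‖ - ‖u₂ s - U s‖)]
    have e2 : ∀ w, ‖S.proj w‖ ^ 2 ≤ ‖S.proj‖ ^ 2 * ‖w‖ ^ 2 := fun w => by
      rw [← mul_pow]
      gcongr
      exact S.proj.le_opNorm w
    have e3 := add_le_add (e2 (μ₁ s)) (e2 (μ₂ s))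
    have e4 := mul_le_mul_of_nonneg_left e3 (add_nonneg hh₁ hh₂)
    linarith
  refine hb.trans ?_
  rw [integral_add, integral_add, integral_const_mul, integral_add iu₁ iu₂, integral_const_mul,
    integral_add, integral_const_mul, integral_add im₁ im₂, integral_add id₁ id₂,
    integral_add ig₁ ig₂]
  · have k1 := a₁.integral_u
    have k2 := a₂.integral_u
    have k3 := a₁.integral_g
    have k4 := a₂.integral_g
    have k5 := add_le_add a₁.integral_μ a₂.integral_μ
    have k6 := mul_le_mul_of_nonneg_left k5 (mul_nonneg (add_nonneg hh₁ hh₂) (sq_nonneg ‖S.proj‖))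
    have k7 := mul_le_mul_of_nonneg_left (add_le_add a₁.integral_d a₂.integral_d)
      (add_nonneg hh₁ hh₂)
    linarith
  · exact (im₁.add im₂).const_mul _
  · exact id₁.add id₂
  · exact (iu₁.add iu₂).const_mul 2
  · exact (((im₁.add im₂).const_mul _).add (id₁.add id₂)).const_mul _
  · exact ((iu₁.add iu₂).const_mul 2).add ((((im₁.add im₂).const_mul _).add (id₁.add id₂)).const_mul
        _)
  · exact ig₁.add ig₂

end EvolutionSpaces

/-- The pointwise errors of the approximations are controlled by a single quantity. -/
theorem error_terms_le {h q m d δ γ ω a : ℝ} (hh : 0 < h) (hh1 : h ≤ 1) (hq : 0 ≤ q)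
    (ha : a ≤ q * m)
    (R : ℝ) (hR : R = γ ^ 2 + ω ^ 2 + √h * (m ^ 2 + d ^ 2) + (√h)⁻¹ * δ ^ 2) :
    δ ≤ (1 + q) * √R + R ∧ γ ≤ (1 + q) * √R + R ∧ ω ≤ (1 + q) * √R + R ∧
      (m + d) * δ ≤ (1 + q) * √R + R ∧ h * a ≤ (1 + q) * √R + R ∧ h * d ≤ (1 + q) * √R + R := by
  have hs : 0 < √h := Real.sqrt_pos.2 hh
  have hs1 : √h ≤ 1 := Real.sqrt_le_one.2 hh1
  have hss : √h * √h = h := Real.mul_self_sqrt hh.le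
  obtain ⟨s, hs'⟩ : ∃ s, s = √h := ⟨_, rfl⟩
  rw [← hs'] at hs hs1 hss hR
  have e1 : 0 ≤ s * (m ^ 2 + d ^ 2) := by positivity
  have e2 : 0 ≤ s⁻¹ * δ ^ 2 := by positivity
  have e3 : δ ^ 2 ≤ s⁻¹ * δ ^ 2 := le_mul_of_one_le_left (sq_nonneg _) ((one_le_inv₀ hs).2 hs1)
  have hR0 : 0 ≤ R := by rw [hR]; positivity
  have hw : √R ≤ (1 + q) * √R + R := by
    nlinarith [Real.sqrt_nonneg R, mul_nonneg hq (Real.sqrt_nonneg R)]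
  have hhs : h * h ≤ s := by
    rw [← hss]
    calc s * s * (s * s) ≤ 1 * 1 * (s * 1) := by gcongr
      _ = s := by ring
  have hm' : h * m ≤ √R := by
    refine Real.le_sqrt_of_sq_le ?_
    have : h * h * m ^ 2 ≤ s * m ^ 2 := by gcongr
    rw [hR]
    nlinarith [mul_nonneg hs.le (sq_nonneg d), sq_nonneg γ, sq_nonneg ω]
  refine ⟨(Real.le_sqrt_of_sq_le ?_).trans hw, (Real.le_sqrt_of_sq_le ?_).trans hw,
    (Real.le_sqrt_of_sq_le ?_).trans hw, ?_, ?_, (Real.le_sqrt_of_sq_le ?_).trans hw⟩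
  · rw [hR]
    nlinarith [sq_nonneg γ, sq_nonneg ω]
  · rw [hR]
    nlinarith [sq_nonneg γ, sq_nonneg ω]
  · rw [hR]
    nlinarith [sq_nonneg γ, sq_nonneg ω]
  · have h1 : (m + d) * δ ≤ R := by
      have h2 : s * ((m + d) ^ 2) ≤ s * (2 * (m ^ 2 + d ^ 2)) := by
        gcongr
        nlinarith [sq_nonneg (m - d)]
      -- Young's inequality with weight √h, the weight with which m, d and δ enter R.
      have h3 : 2 * ((m + d) * δ) ≤ s * (m + d) ^ 2 + s⁻¹ * δ ^ 2 := by
        have h4 : 0 ≤ s⁻¹ * (s * (m + d) - δ) ^ 2 := by positivity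
        have h5 : s⁻¹ * (s * (m + d) - δ) ^ 2 = s * (m + d) ^ 2 + s⁻¹ * δ ^ 2
            - 2 * ((m + d) * δ) := by
          field_simp
          ring
        linarith
      rw [hR]
      linarith [sq_nonneg γ, sq_nonneg ω]
    have : 0 ≤ (1 + q) * √R := by positivity
    linarith
  · have h1 : h * a ≤ q * √R := by
      calc h * a ≤ h * (q * m) := by gcongr
        _ = q * (h * m) := by ring
        _ ≤ q * √R := by gcongr
    have := Real.sqrt_nonneg R
    linarith
  · have : h * h * d ^ 2 ≤ s * d ^ 2 := by gcongr
    rw [hR]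
    nlinarith [mul_nonneg hs.le (sq_nonneg m), sq_nonneg γ, sq_nonneg ω]

/-! ### Passage to the limit -/

namespace EvolutionSpaces

variable {H V W : Type*}
    [NormedAddCommGroup H] [InnerProductSpace ℝ H] [CompleteSpace H]
    [NormedAddCommGroup V] [InnerProductSpace ℝ V] [CompleteSpace V]
    [NormedAddCommGroup W] [InnerProductSpace ℝ W] [CompleteSpace W]
    {S : EvolutionSpaces H V W} {Φ : H → ℝ≥0∞} {pi : H → H} {L : ℝ}

/-- Stability makes y k Cauchy in L²(0,T;V), with squared distance to the limit O(h). This rate is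
what controls the product of ‖μ‖ + ‖d‖, only bounded in L², with ‖y - z‖ pointwise along a
subsequence. -/
theorem exists_limit_of_isApproximation {T τ K : ℝ} {h : ℕ → ℝ} {U : ℝ → H} {y₀ : V}
    {u : ℕ → ℝ → H} {y : ℕ → ℝ → V} {g : ℕ → ℝ → H} {μ : ℕ → ℝ → W} {d : ℕ → ℝ → H}
    (hT : 0 < T) (hL : 0 ≤ L) (hK : 0 ≤ K) (hpi : ∀ x y, ‖pi x - pi y‖ ≤ L * ‖x - y‖)
    (hU : MemLp U 2 (timeMeasure T)) (hh : ∀ k, 0 < h k) (hh1 : ∀ k, h k ≤ 1) (hanti : Antitone h)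
    (hlim : Tendsto h atTop (𝓝 0))
    (ha : ∀ k, S.IsApproximation Φ pi T τ K (h k) U y₀ (u k) (y k) (g k) (μ k) (d k)) :
    ∃ (z : ℝ → V) (ns : ℕ → ℕ) (ρ : ℕ → ℝ → ℝ), StrictMono ns ∧ MemLp z 2 (timeMeasure T) ∧
      (∀ᵐ t ∂timeMeasure T, Tendsto (fun k => ρ k t) atTop (𝓝 0)) ∧
      ∀ k t, ‖y (ns k) t - z t‖ ≤ ρ k t ∧ ‖g (ns k) t - S.j (y (ns k) t)‖ ≤ ρ k t ∧
        ‖u (ns k) t - U t‖ ≤ ρ k t ∧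
        (‖μ (ns k) t‖ + ‖d (ns k) t‖) * ‖y (ns k) t - z t‖ ≤ ρ k t ∧
        h (ns k) * ‖S.proj (μ (ns k) t)‖ ≤ ρ k t ∧ h (ns k) * ‖d (ns k) t‖ ≤ ρ k t := by
  obtain ⟨Ks, hKs, hst⟩ := S.exists_stability hL hT
  obtain ⟨K', hK'⟩ : ∃ K', K' = Ks * ((5 + 2 * ‖S.proj‖ ^ 2) * K) := ⟨_, rfl⟩
  have hK'0 : 0 ≤ K' := by rw [hK']; positivity
  have hsub : ∀ k l, ∫ t, ‖y k t - y l t‖ ^ 2 ∂timeMeasure T ≤ K' * (h k + h l) := by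
    intro k l
    have h1 := hst hpi (hh k).le (hh1 k) (hh l).le (hh1 l) (ha k).memLp_u (ha l).memLp_u
      (ha k).toIsTrajectory (ha l).toIsTrajectory T ⟨hT.le, le_rfl⟩
    have h2 := mul_le_mul_of_nonneg_left ((ha k).integral_sub_le hU (ha l) (hh k).le (hh l).le) hKs
    rw [integral_timeMeasure hT, hK']
    have h3 : 0 ≤ ‖∫ s in (0 : ℝ)..T, (S.proj (μ l s) - S.proj (μ k s))‖ ^ 2
          + ‖∫ s in (0 : ℝ)..T, (d k s - d l s)‖ ^ 2 := by positivity
    linarith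
  let f : ℕ → Lp V 2 (timeMeasure T) := fun k => (ha k).memLp_y.toLp (y k)
  have hf : ∀ k l, ‖f k - f l‖ ^ 2 = ∫ t, ‖y k t - y l t‖ ^ 2 ∂timeMeasure T := fun k l => by
    rw [← MemLp.toLp_sub (ha k).memLp_y (ha l).memLp_y, norm_sq_toLp]
    rfl
  have hdist : ∀ N k, N ≤ k → ‖f k - f N‖ ^ 2 ≤ 2 * K' * h N := fun N k hk => by
    rw [hf]
    refine (hsub k N).trans ?_
    nlinarith [mul_le_mul_of_nonneg_left (hanti hk) hK'0]
  have hcau : CauchySeq f := by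
    refine cauchySeq_of_le_tendsto_0' (fun N => √(2 * K' * h N)) (fun N k hk => ?_) ?_
    · rw [dist_comm, dist_eq_norm]
      exact Real.le_sqrt_of_sq_le (hdist N k hk)
    · have h1 := (Real.continuous_sqrt.tendsto _).comp (hlim.const_mul (2 * K'))
      rwa [mul_zero, Real.sqrt_zero] at h1
  obtain ⟨z, hz⟩ := cauchySeq_tendsto_of_complete hcau
  have hrate : ∀ k, ∫ t, ‖y k t - z t‖ ^ 2 ∂timeMeasure T ≤ 2 * K' * h k := fun k => by
    have h1 : ‖f k - z‖ ^ 2 ≤ 2 * K' * h k := by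
      rw [norm_sub_rev]
      exact le_of_tendsto ((hz.sub_const (f k)).norm.pow 2)
        (eventually_atTop.2 ⟨k, fun l hl => hdist k l hl⟩)
    refine le_trans (le_of_eq ?_) h1
    rw [norm_sq_Lp]
    refine integral_congr_ae ?_
    filter_upwards [Lp.coeFn_sub (f k) z, (ha k).memLp_y.coeFn_toLp] with t h2 h3
    rw [h2, Pi.sub_apply, h3]
  -- The weights balance: ∫(‖μ‖² + ‖d‖²) is bounded and ∫‖y - z‖² is O(h), so both weighted terms
  -- have integral O(√h). By `error_terms_le`, r dominates all the errors pointwise.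
  let r : ℕ → ℝ → ℝ := fun k t => ‖g k t - S.j (y k t)‖ ^ 2 + ‖u k t - U t‖ ^ 2
    + √(h k) * (‖μ k t‖ ^ 2 + ‖d k t‖ ^ 2) + (√(h k))⁻¹ * ‖y k t - z t‖ ^ 2
  have ig : ∀ k, Integrable (fun t => ‖g k t - S.j (y k t)‖ ^ 2) (timeMeasure T) := fun k =>
    integrable_norm_sq ((ha k).memLp_g.sub (S.j.comp_memLp' (ha k).memLp_y))
  have iu : ∀ k, Integrable (fun t => ‖u k t - U t‖ ^ 2) (timeMeasure T) := fun k =>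
    integrable_norm_sq ((ha k).memLp_u.sub hU)
  have im := fun k => integrable_norm_sq (ha k).memLp_μ
  have id := fun k => integrable_norm_sq (ha k).memLp_d
  have iy : ∀ k, Integrable (fun t => ‖y k t - z t‖ ^ 2) (timeMeasure T) := fun k =>
    integrable_norm_sq ((ha k).memLp_y.sub (Lp.memLp z))
  have ir : ∀ k, Integrable (r k) (timeMeasure T) := fun k =>
    (((ig k).add (iu k)).add (((im k).add (id k)).const_mul _)).add ((iy k).const_mul _)
  have hr0 : ∀ k t, 0 ≤ r k t := fun k t => by positivity
  have hrb : ∀ k, ∫ t, r k t ∂timeMeasure T ≤ (4 * K + 2 * K') * √(h k) := fun k => by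
    have e : ∫ t, r k t ∂timeMeasure T = ∫ t, ‖g k t - S.j (y k t)‖ ^ 2 ∂timeMeasure T
        + ∫ t, ‖u k t - U t‖ ^ 2 ∂timeMeasure T
        + √(h k) * (∫ t, ‖μ k t‖ ^ 2 ∂timeMeasure T + ∫ t, ‖d k t‖ ^ 2 ∂timeMeasure T)
        + (√(h k))⁻¹ * ∫ t, ‖y k t - z t‖ ^ 2 ∂timeMeasure T := by
      change ∫ t, (‖g k t - S.j (y k t)‖ ^ 2 + ‖u k t - U t‖ ^ 2
        + √(h k) * (‖μ k t‖ ^ 2 + ‖d k t‖ ^ 2) + (√(h k))⁻¹ * ‖y k t - z t‖ ^ 2) ∂timeMeasure T = _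
      rw [integral_add, integral_add, integral_add (ig k) (iu k), integral_const_mul,
        integral_add (im k) (id k), integral_const_mul]
      · exact (ig k).add (iu k)
      · exact ((im k).add (id k)).const_mul _
      · exact ((ig k).add (iu k)).add (((im k).add (id k)).const_mul _)
      · exact (iy k).const_mul _
    have hs : 0 < √(h k) := Real.sqrt_pos.2 (hh k)
    have hs1 : h k ≤ √(h k) := by
      have h1 : √(h k) ≤ 1 := Real.sqrt_le_one.2 (hh1 k)
      have h2 : √(h k) * √(h k) = h k := Real.mul_self_sqrt (hh k).le
      nlinarith
    have k1 := (ha k).integral_g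
    have k2 := (ha k).integral_u
    have k3 := mul_le_mul_of_nonneg_left (add_le_add (ha k).integral_μ (ha k).integral_d) hs.le
    have k4 : (√(h k))⁻¹ * ∫ t, ‖y k t - z t‖ ^ 2 ∂timeMeasure T ≤ 2 * K' * √(h k) := by
      rw [inv_mul_le_iff₀ hs]
      refine (hrate k).trans (le_of_eq ?_)
      nth_rewrite 1 [← Real.mul_self_sqrt (hh k).le]
      ring
    have k5 := mul_le_mul_of_nonneg_left hs1 hK
    rw [e]
    linarith
  have hrlim : Tendsto (fun k => ∫ t, r k t ∂timeMeasure T) atTop (𝓝 0) := by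
    refine squeeze_zero (fun k => integral_nonneg (hr0 k)) hrb ?_
    have h1 := ((Real.continuous_sqrt.tendsto _).comp hlim).const_mul (4 * K + 2 * K')
    rwa [Real.sqrt_zero, mul_zero] at h1
  obtain ⟨ns, hns, hae⟩ := exists_subseq_tendsto_zero_ae ir hr0 hrlim
  refine ⟨z, ns, fun k t => (1 + ‖S.proj‖) * √(r (ns k) t) + r (ns k) t, hns, Lp.memLp z, ?_,
    fun k t => error_terms_le (hh _) (hh1 _) (norm_nonneg _) (S.proj.le_opNorm _) _ rfl⟩
  filter_upwards [hae] with t ht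
  have h1 := (((Real.continuous_sqrt.tendsto _).comp ht).const_mul (1 + ‖S.proj‖)).add ht
  rwa [Real.sqrt_zero, mul_zero, add_zero] at h1

end EvolutionSpaces

namespace EvolutionSpaces

variable {H V W : Type*}
    [NormedAddCommGroup H] [InnerProductSpace ℝ H] [CompleteSpace H]
    [NormedAddCommGroup V] [InnerProductSpace ℝ V] [CompleteSpace V]
    [NormedAddCommGroup W] [InnerProductSpace ℝ W] [CompleteSpace W]
    {S : EvolutionSpaces H V W} {Φ : H → ℝ≥0∞} {pi : H → H} {L : ℝ}

variable (S) in
/-- The pairs `(μ, d)` that satisfy the variational inequality for `y` up to an error `b`, with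
the potential energy of `y` replaced by any `c` satisfying `p c`. -/
def viSet (Φ : H → ℝ≥0∞) (τ b : ℝ) (f : H) (y : V) (p : ℝ → Prop) : Set (W × H) :=
  {x | ∀ v c, Φ (S.j v) ≠ ∞ → p c →
    √τ * ⟪x.2, S.j (y - v)⟫_ℝ + ⟪S.P y, S.P (y - v)⟫_ℝ + c + ⟪f, S.j (y - v)⟫_ℝ - b * (1 + ‖v‖) ≤
      ⟪S.i x.1, S.j (y - v)⟫_ℝ + (Φ (S.j v)).toReal}

theorem isClosed_viSet (τ b : ℝ) (f : H) (y : V) (p : ℝ → Prop) :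
    IsClosed (S.viSet Φ τ b f y p) := by
  simp only [viSet, ofPred_forall]
  refine isClosed_iInter fun v => isClosed_iInter fun c => isClosed_iInter fun _ =>
    isClosed_iInter fun _ => isClosed_le ?_ ?_
  · fun_prop
  · fun_prop

theorem convex_viSet (τ b : ℝ) (f : H) (y : V) (p : ℝ → Prop) :
    Convex ℝ (S.viSet Φ τ b f y p) := by
  intro x hx z hz α β hα hβ hαβ v c hv hc
  have h1 := mul_le_mul_of_nonneg_left (hx v c hv hc) hα
  have h2 := mul_le_mul_of_nonneg_left (hz v c hv hc) hβ
  simp only [Prod.fst_add, Prod.snd_add, Prod.smul_fst, Prod.smul_snd, map_add, map_smul,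
    inner_add_left, real_inner_smul_left]
  obtain rfl : β = 1 - α := by linarith
  linarith

/-- Moves the approximate pair to a set that depends only on the limit z, with a tolerance
proportional to ρ. -/
theorem IsApproximation.mem_viSet {T τ K h : ℝ} {U : ℝ → H} {y₀ : V}
    {u : ℝ → H} {y : ℝ → V} {g : ℝ → H} {μ : ℝ → W} {d : ℝ → H} (hL : 0 ≤ L) (hK : 0 ≤ K)
    (hpi : ∀ x y, ‖pi x - pi y‖ ≤ L * ‖x - y‖)
    (ha : S.IsApproximation Φ pi T τ K h U y₀ u y g μ d) {z : ℝ → V} {ρ : ℝ → ℝ}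
    (hz : ∀ᵐ t ∂timeMeasure T, ‖z t‖ ≤ K)
    (hρ : ∀ t, ‖y t - z t‖ ≤ ρ t ∧ ‖g t - S.j (y t)‖ ≤ ρ t ∧
        ‖u t - U t‖ ≤ ρ t ∧ (‖μ t‖ + ‖d t‖) * ‖y t - z t‖ ≤ ρ t) :
    ∀ᵐ t ∂timeMeasure T, ∀ b : ℝ, ∀ p : ℝ → Prop,
      ((4 + ‖pi 0‖ + 2 * L + K) * (K + 1) * 3 + (√τ + ‖S.i‖)) * ρ t ≤ b →
      (∀ c, p c → c ≤ (Φ (S.j (y t))).toReal) →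
      (μ t, d t) ∈ S.viSet Φ τ b (pi (S.j (z t)) - U t) (z t) p := by
  filter_upwards [hz, ha.norm_y, ha.norm_g, ha.norm_u, ha.vi] with t h1 h2 h3 h4 h5
  intro b p hb hp v c hv hc
  obtain ⟨r1, r2, r3, r4⟩ := hρ t
  have h6 := h5 v hv
  have h7 := hp c hc
  have h8 := S.vi_perturbation hL hK hK hpi h1 h2 h3 h4 (c := c) (τ := τ) (v := v) (u := U t)
    (d := d t) (μ := μ t) (Ψ := (Φ (S.j v)).toReal) (by linarith)
  refine le_trans ?_ h8
  have h9 : (4 + ‖pi 0‖ + 2 * L + K) * (K + 1) * (‖y t - z t‖ + ‖g t - S.j (y t)‖ + ‖u t - U t‖)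
      + (√τ + ‖S.i‖) * ((‖μ t‖ + ‖d t‖) * ‖y t - z t‖) ≤ b := by
    refine le_trans ?_ hb
    have k1 : (4 + ‖pi 0‖ + 2 * L + K) * (K + 1) *
        (‖y t - z t‖ + ‖g t - S.j (y t)‖ + ‖u t - U t‖) ≤
        (4 + ‖pi 0‖ + 2 * L + K) * (K + 1) * (3 * ρ t) := by
      gcongr
      linarith
    have k2 : (√τ + ‖S.i‖) * ((‖μ t‖ + ‖d t‖) * ‖y t - z t‖) ≤ (√τ + ‖S.i‖) * ρ t := by
      gcongr
    linarith
  have h10 := mul_le_mul_of_nonneg_right h9 (show 0 ≤ 1 + ‖v‖ by positivity)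
  linarith

/-- As y converges strongly, each relation for fixed z confines (μ, d) to a closed convex set that
eventually contains the approximate pairs. The pair w supplied by
`exists_prod_mem_of_eventually_mem_convex` satisfies all of them. -/
theorem exists_isTrajectory_of_isApproximation {T τ K : ℝ} {h : ℕ → ℝ} {U : ℝ → H} {y₀ : V}
    {u : ℕ → ℝ → H} {y : ℕ → ℝ → V} {g : ℕ → ℝ → H} {μ : ℕ → ℝ → W} {d : ℕ → ℝ → H}
    {z : ℝ → V} {ρ : ℕ → ℝ → ℝ} (hT : 0 < T) (hL : 0 ≤ L) (hK : 0 ≤ K)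
    (hlsc : LowerSemicontinuous Φ)
    (hpi : ∀ x y, ‖pi x - pi y‖ ≤ L * ‖x - y‖)
    (ha : ∀ k, S.IsApproximation Φ pi T τ K (h k) U y₀ (u k) (y k) (g k) (μ k) (d k))
    (hz : MemLp z 2 (timeMeasure T))
    (hρ0 : ∀ᵐ t ∂timeMeasure T, Tendsto (fun k => ρ k t) atTop (𝓝 0))
    (hρ : ∀ k t, ‖y k t - z t‖ ≤ ρ k t ∧ ‖g k t - S.j (y k t)‖ ≤ ρ k t ∧
        ‖u k t - U t‖ ≤ ρ k t ∧ (‖μ k t‖ + ‖d k t‖) * ‖y k t - z t‖ ≤ ρ k t ∧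
        h k * ‖S.proj (μ k t)‖ ≤ ρ k t ∧ h k * ‖d k t‖ ≤ ρ k t) :
    ∃ (m : ℝ → W) (D : ℝ → H), S.IsTrajectory Φ pi T τ 0 U y₀ z (fun t => S.j (z t)) m D ∧
      (∀ᵐ t ∂timeMeasure T, ‖z t‖ ≤ K ∧ Φ (S.j (z t)) ≤ ENNReal.ofReal K) ∧
      ∫ t, ‖m t‖ ^ 2 ∂timeMeasure T ≤ K ∧ ∫ t, ‖D t‖ ^ 2 ∂timeMeasure T ≤ K ∧
      ∀ᵐ t ∂timeMeasure T, S.N (√τ • D t) = -τ • S.proj (m t) := by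
  have hyz : ∀ᵐ t ∂timeMeasure T, Tendsto (fun k => y k t) atTop (𝓝 (z t)) := by
    filter_upwards [hρ0] with t ht
    exact tendsto_iff_norm_sub_tendsto_zero.2
      (squeeze_zero (fun k => norm_nonneg _) (fun k => (hρ k t).1) ht)
  have hjz : ∀ᵐ t ∂timeMeasure T, Tendsto (fun k => S.j (y k t)) atTop (𝓝 (S.j (z t))) := by
    filter_upwards [hyz] with t ht
    exact (S.j.continuous.tendsto _).comp ht
  have hzK : ∀ᵐ t ∂timeMeasure T, ‖z t‖ ≤ K := by
    filter_upwards [hyz, ae_all_iff.2 fun k => (ha k).norm_y] with t ht h1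
    exact le_of_tendsto ht.norm (Eventually.of_forall h1)
  have hΦK : ∀ᵐ t ∂timeMeasure T, Φ (S.j (z t)) ≤ ENNReal.ofReal K := by
    filter_upwards [hjz, ae_all_iff.2 fun k => (ha k).potential,
      ae_all_iff.2 fun k => (ha k).finite] with t ht h1 h2
    refine hlsc.le_of_tendsto_of_eventually_le ht (Eventually.of_forall fun k => ?_)
    exact (ENNReal.le_ofReal_iff_toReal_le (h2 k) hK).2 (h1 k)
  let x : ℕ → Lp W 2 (timeMeasure T) × Lp H 2 (timeMeasure T) := fun k =>
    ((ha k).memLp_μ.toLp (μ k), (ha k).memLp_d.toLp (d k))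
  have hx1 : ∀ k, ‖(x k).1‖ ≤ √K := fun k => Real.le_sqrt_of_sq_le (by
    rw [norm_sq_toLp]
    exact (ha k).integral_μ)
  have hx2 : ∀ k, ‖(x k).2‖ ≤ √K := fun k => Real.le_sqrt_of_sq_le (by
    rw [norm_sq_toLp]
    exact (ha k).integral_d)
  have hxe : ∀ k, ∀ᵐ t ∂timeMeasure T, (x k).1 t = μ k t ∧ (x k).2 t = d k t := fun k => by
    filter_upwards [(ha k).memLp_μ.coeFn_toLp, (ha k).memLp_d.coeFn_toLp] with t h1 h2
    exact ⟨h1, h2⟩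
  obtain ⟨w, hw⟩ := exists_prod_mem_of_eventually_mem_convex (x := x) (C := √K)
    fun k => norm_prod_le_iff.2 ⟨hx1 k, hx2 k⟩
  have hb1 : ‖w.1‖ ≤ √K := by
    have hc := convex_norm_sub_le
      (ContinuousLinearMap.fst ℝ (Lp W 2 (timeMeasure T)) (Lp H 2 (timeMeasure T))) 0 √K
    simp only [sub_zero] at hc
    exact hw _ (isClosed_le (by fun_prop) (by fun_prop)) hc (Eventually.of_forall hx1)
  have hb2 : ‖w.2‖ ≤ √K := by
    have hc := convex_norm_sub_le
      (ContinuousLinearMap.snd ℝ (Lp W 2 (timeMeasure T)) (Lp H 2 (timeMeasure T))) 0 √K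
    simp only [sub_zero] at hc
    exact hw _ (isClosed_le (by fun_prop) (by fun_prop)) hc (Eventually.of_forall hx2)
  have hcompat : ∀ᵐ t ∂timeMeasure T, S.N (√τ • w.2 t) = -τ • S.proj (w.1 t) := by
    obtain ⟨c1, c2⟩ := isClosed_convex_ae_mem (T := T)
      (Q := fun _ => {p : W × H | S.N (√τ • p.2) = -τ • S.proj p.1})
      (fun _ => isClosed_eq (by fun_prop) (by fun_prop)) (fun _ => by
        intro p hp q hq a b _ _ _
        simp only [mem_ofPred_eq, Prod.fst_add, Prod.snd_add, Prod.smul_fst, Prod.smul_snd,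
          map_add, map_smul, smul_add] at hp hq ⊢
        rw [smul_comm √τ a, smul_comm √τ b, hp, hq, smul_comm a, smul_comm b])
    refine hw _ c1 c2 (Eventually.of_forall fun k => ?_)
    filter_upwards [hxe k, (ha k).compat] with t h1 h2
    rw [h1.1, h1.2, h2]
  have hIcc : ∀ᵐ t ∂timeMeasure T, t ∈ Icc 0 T :=
    ae_timeMeasure.2 (ae_of_all _ fun t ht => Ioo_subset_Icc_self ht)
  have hpW : ∀ᵐ t ∂timeMeasure T,
      ‖S.N (S.j y₀) - (∫ s in (0 : ℝ)..t, S.proj (w.1 s)) - S.N (S.j (z t))‖ ≤ 0 := by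
    filter_upwards [hIcc, hρ0, hjz, ae_all_iff.2 fun k => (ha k).primitive_W] with t ht h1 h2 h3
    obtain ⟨I, hI⟩ := exists_primitiveL (E := W) hT ht
    rw [S.proj.intervalIntegral_comp_comm (intervalIntegrable_of_mem hT
      ((Lp.memLp w.1).integrable (by norm_num)) t ht), ← hI]
    refine le_of_forall_pos_le_add fun ε hε => ?_
    rw [zero_add]
    -- At a fixed time the primitive is a continuous linear map on L², so for each ε the equation up
    -- to ε is a closed convex condition; it holds for all late approximations since their error
    -- tends to zero.
    refine hw {x | ‖S.N (S.j y₀) - S.proj (I x.1) - S.N (S.j (z t))‖ ≤ ε}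
      (isClosed_le (by fun_prop) (by fun_prop)) ?_ ?_
    · have hc := convex_norm_sub_le (S.proj.comp (I.comp (ContinuousLinearMap.fst ℝ
        (Lp W 2 (timeMeasure T)) (Lp H 2 (timeMeasure T))))) (S.N (S.j y₀) - S.N (S.j (z t))) ε
      have he : ∀ p : Lp W 2 (timeMeasure T) × Lp H 2 (timeMeasure T),
          ‖S.N (S.j y₀) - S.proj (I p.1) - S.N (S.j (z t))‖ =
          ‖S.proj (I p.1) - (S.N (S.j y₀) - S.N (S.j (z t)))‖ := fun p => by
        rw [← norm_neg]
        congr 1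
        abel
      simp only [he]
      exact hc
    · have h4 : Tendsto (fun k => ρ k t + ‖S.N (S.j (y k t)) - S.N (S.j (z t))‖) atTop (𝓝 0) := by
        have := h1.add (tendsto_iff_norm_sub_tendsto_zero.1 ((S.N.continuous.tendsto _).comp h2))
        rwa [zero_add] at this
      filter_upwards [h4.eventually (gt_mem_nhds hε)] with k hk
      have h5 := h3 k
      rw [S.proj.intervalIntegral_comp_comm (intervalIntegrable_of_mem hT
        ((ha k).memLp_μ.integrable (by norm_num)) t ht),
        ← integral_congr_timeMeasure (ha k).memLp_μ.coeFn_toLp ht, ← hI] at h5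
      have h6 := norm_sub_le_norm_sub_add_norm_sub (S.N (S.j y₀) - S.proj (I (x k).1))
        (S.N (S.j (y k t))) (S.N (S.j (z t)))
      have h7 := (hρ k t).2.2.2.2.1
      change ‖_‖ ≤ ε
      refine (h6.trans (add_le_add (h5.trans h7) le_rfl)).trans hk.le
  have hpH : ∀ᵐ t ∂timeMeasure T,
      ‖√τ • S.j y₀ + (∫ s in (0 : ℝ)..t, w.2 s) - √τ • S.j (z t)‖ ≤ 0 := by
    filter_upwards [hIcc, hρ0, hjz, ae_all_iff.2 fun k => (ha k).primitive_H] with t ht h1 h2 h3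
    obtain ⟨I, hI⟩ := exists_primitiveL (E := H) hT ht
    rw [← hI]
    refine le_of_forall_pos_le_add fun ε hε => ?_
    rw [zero_add]
    refine hw {x | ‖√τ • S.j y₀ + I x.2 - √τ • S.j (z t)‖ ≤ ε}
      (isClosed_le (by fun_prop) (by fun_prop)) ?_ ?_
    · have hc := convex_norm_sub_le (I.comp (ContinuousLinearMap.snd ℝ
        (Lp W 2 (timeMeasure T)) (Lp H 2 (timeMeasure T)))) (√τ • S.j (z t) - √τ • S.j y₀) ε
      have he : ∀ p : Lp W 2 (timeMeasure T) × Lp H 2 (timeMeasure T),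
          √τ • S.j y₀ + I p.2 - √τ • S.j (z t) = I p.2 - (√τ • S.j (z t) - √τ • S.j y₀) :=
        fun p => by abel
      simp only [he]
      exact hc
    · have h4 : Tendsto (fun k => ρ k t + ‖√τ • S.j (y k t) - √τ • S.j (z t)‖) atTop (𝓝 0) := by
        have := h1.add (tendsto_iff_norm_sub_tendsto_zero.1 (h2.const_smul √τ))
        rwa [zero_add] at this
      filter_upwards [h4.eventually (gt_mem_nhds hε)] with k hk
      have h5 := h3 k
      rw [← integral_congr_timeMeasure (ha k).memLp_d.coeFn_toLp ht, ← hI] at h5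
      have h6 := norm_sub_le_norm_sub_add_norm_sub (√τ • S.j y₀ + I (x k).2)
        (√τ • S.j (y k t)) (√τ • S.j (z t))
      have h7 := (hρ k t).2.2.2.2.2
      change ‖_‖ ≤ ε
      refine (h6.trans (add_le_add (h5.trans h7) le_rfl)).trans hk.le
  obtain ⟨C₀, hC₀⟩ : ∃ C₀, C₀ = (4 + ‖pi 0‖ + 2 * L + K) * (K + 1) * 3 + (√τ + ‖S.i‖) := ⟨_, rfl⟩
  have hC₀0 : 0 ≤ C₀ := by rw [hC₀]; positivity
  obtain ⟨b, hb⟩ := exists_tail_bound hρ0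
  -- For fixed n the set has to contain all pairs with k ≥ n. Hence the tail bound as tolerance, and
  -- numbers c below all the potentials from n on instead of the potential of z.
  have hviw : ∀ n, ∀ᵐ t ∂timeMeasure T, (w.1 t, w.2 t) ∈
      S.viSet Φ τ (C₀ * b n t) (pi (S.j (z t)) - U t) (z t)
        fun c => ∀ k, n ≤ k → c ≤ (Φ (S.j (y k t))).toReal := fun n => by
    obtain ⟨c1, c2⟩ := isClosed_convex_ae_mem (T := T)
      (Q := fun t => S.viSet Φ τ (C₀ * b n t) (pi (S.j (z t)) - U t) (z t)
        fun c => ∀ k, n ≤ k → c ≤ (Φ (S.j (y k t))).toReal)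
      (fun _ => isClosed_viSet _ _ _ _ _) (fun _ => convex_viSet _ _ _ _ _)
    refine hw _ c1 c2 (eventually_atTop.2 ⟨n, fun k hk => ?_⟩)
    filter_upwards [hxe k, hb, (ha k).mem_viSet hL hK hpi hzK (ρ := ρ k)
      (fun t => ⟨(hρ k t).1, (hρ k t).2.1, (hρ k t).2.2.1, (hρ k t).2.2.2.1⟩)] with t h1 h2 h3
    rw [h1.1, h1.2]
    refine h3 _ _ ?_ fun c hc => hc k hk
    rw [← hC₀]
    exact mul_le_mul_of_nonneg_left (h2.1 n k hk) hC₀0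
  refine ⟨w.1, w.2, ⟨hz, S.j.comp_memLp' hz, Lp.memLp _, Lp.memLp _, ?_, ?_, ?_, ?_, ?_⟩, ?_,
    ?_, ?_, hcompat⟩
  · simpa only [zero_mul] using hpW
  · simpa only [zero_mul] using hpH
  · filter_upwards [hjz, ae_all_iff.2 fun k => (ha k).mean] with t h1 h2
    refine tendsto_nhds_unique (tendsto_const_nhds.inner h1) ?_
    simp only [h2]
    exact tendsto_const_nhds
  · filter_upwards [hΦK] with t h1
    exact ne_top_of_le_ne_top ENNReal.ofReal_ne_top h1
  · filter_upwards [hjz, ae_all_iff.2 hviw, hb, hΦK, ae_all_iff.2 fun k => (ha k).finite]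
      with t h1 h2 h3 h4 h5 v hv
    have hfin : Φ (S.j (z t)) ≠ ∞ := ne_top_of_le_ne_top ENNReal.ofReal_ne_top h4
    refine le_of_forall_pos_le_add fun ε hε => ?_
    -- Lower semicontinuity makes Φ(j z) - ε an admissible c for large n; then n → ∞ removes the
    -- tolerance and ε is arbitrary.
    have h6 : ∀ᶠ k in atTop, (Φ (S.j (z t))).toReal - ε ≤ (Φ (S.j (y k t))).toReal := by
      rcases lt_or_ge ((Φ (S.j (z t))).toReal - ε) 0 with h7 | h7
      · exact Eventually.of_forall fun k => h7.le.trans ENNReal.toReal_nonneg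
      · have h8 : ENNReal.ofReal ((Φ (S.j (z t))).toReal - ε) < Φ (S.j (z t)) := by
          rw [ENNReal.ofReal_lt_iff_lt_toReal h7 hfin]
          linarith
        filter_upwards [h1.eventually (hlsc _ _ h8)] with k hk
        exact ((ENNReal.ofReal_lt_iff_lt_toReal h7 (h5 k)).1 hk).le
    obtain ⟨n₀, hn₀⟩ := eventually_atTop.1 h6
    have h9 : Tendsto (fun n => √τ * ⟪w.2 t, S.j (z t - v)⟫_ℝ + ⟪S.P (z t), S.P (z t - v)⟫_ℝ
        + ((Φ (S.j (z t))).toReal - ε) + ⟪pi (S.j (z t)) - U t, S.j (z t - v)⟫_ℝ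
        - C₀ * b n t * (1 + ‖v‖)) atTop (𝓝 (√τ * ⟪w.2 t, S.j (z t - v)⟫_ℝ
        + ⟪S.P (z t), S.P (z t - v)⟫_ℝ
        + ((Φ (S.j (z t))).toReal - ε) + ⟪pi (S.j (z t)) - U t, S.j (z t - v)⟫_ℝ
        - C₀ * 0 * (1 + ‖v‖))) :=
      tendsto_const_nhds.sub ((h3.2.const_mul C₀).mul_const _)
    have h10 := le_of_tendsto h9 (eventually_atTop.2 ⟨n₀, fun n hn =>
      h2 n v _ hv fun k hk => hn₀ k (hn.trans hk)⟩)
    simp only [mul_zero, zero_mul, sub_zero] at h10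
    linarith
  · filter_upwards [hzK, hΦK] with t h1 h2
    exact ⟨h1, h2⟩
  · rw [← norm_sq_Lp, ← Real.sq_sqrt hK]
    gcongr
  · rw [← norm_sq_Lp, ← Real.sq_sqrt hK]
    gcongr

theorem exists_isTrajectory {Pi : H → ℝ} {c C : ℝ} (hp : IsPotential Φ Pi pi L c C)
    {T τmax M ρ : ℝ} (hτmax : 0 ≤ τmax) (hM : 0 ≤ M) (hρ : 0 < ρ) (hT : 0 < T) :
    ∃ K, 0 ≤ K ∧ ∀ {τ : ℝ} {U : ℝ → H} {y₀ : V},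
      0 ≤ τ → τ ≤ τmax → ‖y₀‖ ≤ M → Φ (S.j y₀) ≠ ∞ →
      (Φ (S.j y₀)).toReal ≤ M → S.MeanCondition Φ ρ M y₀ → MemLp U 2 (timeMeasure T) →
      (∀ t ∈ Icc 0 T, ‖U t‖ ≤ M) →
      (∀ s ∈ Icc 0 T, ∀ t ∈ Icc 0 T, ‖U t - U s‖ ^ 2 ≤ M * |t - s|) →
      (∀ (n : ℕ) (h : ℝ), 0 < h → n * h = T →
        ∑ k ∈ Finset.range n, ‖U ((k + 1 : ℕ) * h) - U (k * h)‖ ≤ M) →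
      ∃ (y : ℝ → V) (μ : ℝ → W) (d : ℝ → H),
        S.IsTrajectory Φ pi T τ 0 U y₀ y (fun t => S.j (y t)) μ d ∧
        (∀ᵐ t ∂timeMeasure T, ‖y t‖ ≤ K ∧ Φ (S.j (y t)) ≤ ENNReal.ofReal K) ∧
        ∫ t, ‖μ t‖ ^ 2 ∂timeMeasure T ≤ K ∧ ∫ t, ‖d t‖ ^ 2 ∂timeMeasure T ≤ K ∧
        ∀ᵐ t ∂timeMeasure T, S.N (√τ • d t) = -τ • S.proj (μ t) := by
  obtain ⟨K, h₀, hK, hh₀, happ⟩ := exists_isApproximation (S := S) hp hτmax hM hρ hT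
  refine ⟨K, hK, ?_⟩
  intro τ U y₀ hτ hτ' hy₀ hfin hΦ hmean hU hUb hUh hUv
  -- The steps T/(N + k) divide T exactly, and N is large enough for all of them to be at most h₀
  -- and 1.
  obtain ⟨N, hN⟩ := exists_nat_gt (T / min h₀ 1)
  have hmin : 0 < min h₀ 1 := lt_min hh₀ one_pos
  have hN0 : 0 < (N : ℝ) := lt_trans (by positivity) hN
  have hh : ∀ k : ℕ, 0 < T / (N + k : ℕ) := fun k => by
    push_cast
    positivity
  have hhm : ∀ k : ℕ, T / (N + k : ℕ) ≤ min h₀ 1 := fun k => by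
    push_cast
    rw [div_le_iff₀ (by positivity)]
    rw [div_lt_iff₀ hmin] at hN
    nlinarith [mul_nonneg hmin.le (Nat.cast_nonneg (α := ℝ) k)]
  have hn : ∀ k : ℕ, ((N + k : ℕ) : ℝ) * (T / (N + k : ℕ)) = T := fun k => by
    have : ((N + k : ℕ) : ℝ) ≠ 0 := by
      push_cast
      positivity
    field_simp
  have hex := fun k : ℕ => happ hτ hτ' (hh k) ((hhm k).trans (min_le_left _ _)) (hn k) hy₀ hfin hΦ
    hmean hU hUb hUh (hUv _ _ (hh k) (hn k))
  choose u y g μ d ha using hex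
  obtain ⟨z, ns, r, hns, hz, hr0, hr⟩ := exists_limit_of_isApproximation hT hp.L_nonneg hK
    hp.lipschitz hU hh (fun k => (hhm k).trans (min_le_right _ _)) (fun k l hkl => by
      have h1 : (0 : ℝ) < (N + k : ℕ) := by
        push_cast
        positivity
      gcongr) (by
      refine tendsto_const_nhds.div_atTop ?_
      exact tendsto_natCast_atTop_atTop.comp (tendsto_atTop_mono (fun k => Nat.le_add_left k N)
        tendsto_id)) ha
  obtain ⟨m, D, hmD⟩ := exists_isTrajectory_of_isApproximation hT hp.L_nonneg hK hp.lsc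
    hp.lipschitz (fun k => ha (ns k)) hz hr0 hr
  exact ⟨z, m, D, hmD⟩

end EvolutionSpaces

/-! ### The spectral spaces and the Ehrling inequality -/

section Spectral

variable {H : Type*} [NormedAddCommGroup H] [InnerProductSpace ℝ H]

namespace EigenSystem

variable {A : H →ₗ.[ℝ] H} (E : EigenSystem A)

theorem ext_inner_vec {x y : H} (h : ∀ j, ⟪E.vec j, x⟫_ℝ = ⟪E.vec j, y⟫_ℝ) : x = y := by
  apply E.vec.repr.injective
  ext j
  rw [E.vec.repr_apply_apply, E.vec.repr_apply_apply]
  exact h j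

theorem hasSum_inner_sq (x : H) : HasSum (fun j => ⟪E.vec j, x⟫_ℝ ^ 2) (‖x‖ ^ 2) := by
  have h := E.vec.hasSum_inner_mul_inner x x
  rw [real_inner_self_eq_norm_sq] at h
  have e : (fun j => ⟪E.vec j, x⟫_ℝ ^ 2) = fun j => ⟪x, E.vec j⟫_ℝ * ⟪E.vec j, x⟫_ℝ :=
    funext fun j => by rw [sq, real_inner_comm (E.vec j) x]
  rwa [e]

theorem exists_mem_pow {s : ℝ} {x y : H}
    (h : ∀ j, E.val j ^ s * ⟪E.vec j, x⟫_ℝ = ⟪E.vec j, y⟫_ℝ) :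
    ∃ hx : x ∈ (E.pow s).domain, E.pow s ⟨x, hx⟩ = y := by
  have hx : x ∈ (E.pow s).domain := by
    change Summable fun j => (E.val j ^ s * ⟪E.vec j, x⟫_ℝ) ^ 2
    simp only [h]
    exact (E.hasSum_inner_sq y).summable
  refine ⟨hx, E.ext_inner_vec fun j => ?_⟩
  rw [E.inner_vec_pow]
  exact h j

theorem exists_vec_mem_pow (s : ℝ) (j : ℕ) :
    ∃ hx : E.vec j ∈ (E.pow s).domain, E.pow s ⟨E.vec j, hx⟩ = E.val j ^ s • E.vec j := by
  refine E.exists_mem_pow fun k => ?_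
  rw [real_inner_smul_right]
  by_cases hk : k = j
  · rw [hk]
  · rw [E.vec.orthonormal.2 hk, mul_zero, mul_zero]

/-- The powers are closed operators, because each Fourier coefficient passes to the limit;
completeness of the graph spaces follows. -/
theorem exists_pow_eq_of_tendsto {s : ℝ} {v : ℕ → (E.pow s).domain} {x y : H}
    (hx : Tendsto (fun n => (v n : H)) atTop (𝓝 x))
    (hy : Tendsto (fun n => E.pow s (v n)) atTop (𝓝 y)) :
    ∃ hx : x ∈ (E.pow s).domain, E.pow s ⟨x, hx⟩ = y := by
  refine E.exists_mem_pow fun j => ?_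
  have h1 : Tendsto (fun n => ⟪E.vec j, E.pow s (v n)⟫_ℝ) atTop (𝓝 ⟪E.vec j, y⟫_ℝ) :=
    tendsto_const_nhds.inner hy
  simp only [E.inner_vec_pow] at h1
  exact tendsto_nhds_unique ((tendsto_const_nhds.inner hx).const_mul _) h1

end EigenSystem

namespace GraphSpace

variable {P : H →ₗ.[ℝ] H}

theorem norm_sq_eq (v : GraphSpace P) : ‖v‖ ^ 2 = ‖toH v‖ ^ 2 + ‖op v‖ ^ 2 := by
  rw [← real_inner_self_eq_norm_sq, ← real_inner_self_eq_norm_sq (toH v),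
    ← real_inner_self_eq_norm_sq (op v)]
  rfl

/-- The inclusion of the domain of `P` in `H`, as a continuous linear map. -/
noncomputable def toHL : GraphSpace P →L[ℝ] H :=
  (toH : GraphSpace P →ₗ[ℝ] H).mkContinuous 1 fun v => by
    rw [one_mul]
    refine le_of_sq_le_sq ?_ (norm_nonneg _)
    rw [norm_sq_eq]
    exact le_add_of_nonneg_right (sq_nonneg _)

/-- The operator `P` on its domain, as a continuous linear map. -/
noncomputable def opL : GraphSpace P →L[ℝ] H :=
  (op : GraphSpace P →ₗ[ℝ] H).mkContinuous 1 fun v => by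
    rw [one_mul]
    refine le_of_sq_le_sq ?_ (norm_nonneg _)
    rw [norm_sq_eq]
    exact le_add_of_nonneg_left (sq_nonneg _)

theorem toHL_apply (v : GraphSpace P) : toHL v = toH v := rfl

theorem opL_apply (v : GraphSpace P) : opL v = op v := rfl

variable [CompleteSpace H]

theorem completeSpace_pow {A : H →ₗ.[ℝ] H} (E : EigenSystem A) (s : ℝ) :
    CompleteSpace (GraphSpace (E.pow s)) := by
  refine Metric.complete_of_cauchySeq_tendsto fun v hv => ?_
  obtain ⟨x, hx⟩ := cauchySeq_tendsto_of_complete (toHL.uniformContinuous.comp_cauchySeq hv)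
  obtain ⟨y, hy⟩ := cauchySeq_tendsto_of_complete (opL.uniformContinuous.comp_cauchySeq hv)
  obtain ⟨hxm, hxy⟩ := E.exists_pow_eq_of_tendsto (v := v) hx hy
  let w : GraphSpace (E.pow s) := (⟨x, hxm⟩ : (E.pow s).domain)
  have hw1 : toHL w = x := rfl
  have hw2 : opL w = y := hxy
  refine ⟨w, tendsto_iff_norm_sub_tendsto_zero.2 ?_⟩
  have h : Tendsto (fun n => √(‖toHL (v n) - x‖ ^ 2 + ‖opL (v n) - y‖ ^ 2)) atTop (𝓝 0) := by
    have h1 := (Real.continuous_sqrt.tendsto _).comp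
      (((hx.sub_const x).norm.pow 2).add ((hy.sub_const y).norm.pow 2))
    simpa [Function.comp_def] using h1
  refine h.congr fun n => ?_
  rw [← hw1, ← hw2, ← map_sub, ← map_sub, toHL_apply, opL_apply, ← norm_sq_eq,
    Real.sqrt_sq (norm_nonneg _)]

end GraphSpace

namespace EigenSystem

variable {A : H →ₗ.[ℝ] H} {E : EigenSystem A} {r : ℝ}

namespace SpecSpace

theorem toHL_apply (hr : 0 < r) (v : E.SpecSpace r) : toHL hr v = toH v := rfl

theorem inner_eq (v w : E.SpecSpace r) :
    ⟪v, w⟫_ℝ = ∑ j ∈ E.zeroIndices, ⟪toH v, E.vec j⟫_ℝ * ⟪toH w, E.vec j⟫_ℝ + ⟪op v, op w⟫_ℝ :=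
  rfl

/-- The operator `A ^ r` as a continuous linear map. -/
noncomputable def opL : E.SpecSpace r →L[ℝ] H :=
  (op : E.SpecSpace r →ₗ[ℝ] H).mkContinuous 1 fun v => by
    rw [one_mul]
    refine le_of_sq_le_sq ?_ (norm_nonneg _)
    rw [norm_sq_eq]
    exact le_add_of_nonneg_left (Finset.sum_nonneg fun j _ => sq_nonneg _)

theorem opL_apply (v : E.SpecSpace r) : opL v = op v := rfl

theorem completeSpace [CompleteSpace H] (hr : 0 < r) : CompleteSpace (E.SpecSpace r) := by
  refine Metric.complete_of_cauchySeq_tendsto fun v hv => ?_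
  obtain ⟨x, hx⟩ := cauchySeq_tendsto_of_complete ((toHL hr).uniformContinuous.comp_cauchySeq hv)
  obtain ⟨y, hy⟩ := cauchySeq_tendsto_of_complete (opL.uniformContinuous.comp_cauchySeq hv)
  obtain ⟨hxm, hxy⟩ := E.exists_pow_eq_of_tendsto (v := v) hx hy
  let w : E.SpecSpace r := (⟨x, hxm⟩ : (E.pow r).domain)
  have hw1 : toHL hr w = x := rfl
  have hw2 : opL w = y := hxy
  refine ⟨w, tendsto_iff_norm_sub_tendsto_zero.2 ?_⟩
  have h : Tendsto (fun n => √(∑ j ∈ E.zeroIndices, ⟪toHL hr (v n) - x, E.vec j⟫_ℝ ^ 2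
      + ‖opL (v n) - y‖ ^ 2)) atTop (𝓝 0) := by
    have h1 := (Real.continuous_sqrt.tendsto _).comp
      ((tendsto_finsetSum E.zeroIndices fun j _ =>
        ((hx.sub_const x).inner (tendsto_const_nhds (x := E.vec j))).pow 2).add
        ((hy.sub_const y).norm.pow 2))
    simpa [Function.comp_def] using h1
  refine h.congr fun n => ?_
  rw [← hw1, ← hw2, ← map_sub, ← map_sub, toHL_apply, opL_apply, ← norm_sq_eq,
    Real.sqrt_sq (norm_nonneg _)]

variable (E r) in
/-- The eigenvectors as elements of `V_A^r`. -/
noncomputable def vec (j : ℕ) : E.SpecSpace r :=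
  (⟨E.vec j, (E.exists_vec_mem_pow r j).1⟩ : (E.pow r).domain)

theorem toH_vec (j : ℕ) : toH (vec E r j) = E.vec j := rfl

theorem op_vec (j : ℕ) : op (vec E r j) = E.val j ^ r • E.vec j := (E.exists_vec_mem_pow r j).2

end SpecSpace

theorem zeroIndices_eq (h : 0 < E.val 0 ∨ (E.val 0 = 0 ∧ 0 < E.val 1)) :
    E.zeroIndices = if E.val 0 = 0 then {0} else ∅ := by
  ext j
  rw [zeroIndices, Set.Finite.mem_toFinset, Set.mem_ofPred_eq]
  rcases h with h | ⟨h, h1⟩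
  · rw [if_neg h.ne']
    simpa using (h.trans_le (E.mono (Nat.zero_le j))).ne'
  · rw [if_pos h, Finset.mem_singleton]
    refine ⟨fun hj => ?_, fun hj => hj ▸ h⟩
    by_contra h0
    exact (h1.trans_le (E.mono (Nat.one_le_iff_ne_zero.2 h0))).ne' hj

end EigenSystem

/-- A consequence of the compactness of the embedding of the domain of `B ^ σ` in `H`. -/
theorem EigenSystem.ehrling [CompleteSpace H] {B : H →ₗ.[ℝ] H} (EB : EigenSystem B) {σ : ℝ}
    (hσ : 0 < σ) {W : Type*} [NormedAddCommGroup W] [InnerProductSpace ℝ W] [CompleteSpace W]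
    (i : W →L[ℝ] H) (hi : ∀ f, ContinuousLinearMap.adjoint i f = 0 → f = 0) {ε : ℝ} (hε : 0 < ε) :
    ∃ C, 0 ≤ C ∧ ∀ v : GraphSpace (EB.pow σ), ‖GraphSpace.toH v‖ ^ 2 ≤
      ε * ‖GraphSpace.op v‖ ^ 2 + C * ‖ContinuousLinearMap.adjoint i (GraphSpace.toH v)‖ ^ 2 := by
  -- The orthogonal complement of the range of i is the kernel of its adjoint, which is trivial by
  -- hypothesis.
  have hdense : DenseRange i := by
    have h1 : (LinearMap.range i.toLinearMap)ᗮ = ⊥ := by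
      rw [Submodule.eq_bot_iff]
      intro f hf
      refine hi f (ext_inner_right ℝ fun w => ?_)
      rw [ContinuousLinearMap.adjoint_inner_left, inner_zero_left, real_inner_comm]
      exact hf (i w) ⟨w, rfl⟩
    have h2 := (Submodule.dense_iff_topologicalClosure_eq_top (s := LinearMap.range i.toLinearMap)).2
      (Submodule.topologicalClosure_eq_top_iff.2 h1)
    exact h2
  have hlim : Tendsto (fun k => EB.val k ^ σ) atTop atTop :=
    (tendsto_rpow_atTop hσ).comp EB.tendsto
  -- From n on, λ_k^σ exceeds both 1 and 2/ε, hence its square exceeds 2/ε and the tail is at most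
  -- ε/2 of ‖B^σ v‖². The n remaining modes are approximated by elements of W with squared error
  -- 1/(4(n+1)), so that their total error is at most ‖x‖²/2 and can be absorbed.
  obtain ⟨n, hn⟩ := eventually_atTop.1 (hlim.eventually_ge_atTop (max 1 (2 / ε)))
  have hη : (0 : ℝ) < 1 / (4 * (n + 1)) := by positivity
  have happ : ∀ k, ∃ w : W, ‖EB.vec k - i w‖ ^ 2 ≤ 1 / (4 * (n + 1)) := fun k => by
    obtain ⟨w, hw⟩ := hdense.exists_dist_lt (EB.vec k) (Real.sqrt_pos.2 hη)
    rw [dist_eq_norm] at hw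
    refine ⟨w, ?_⟩
    rw [← Real.sq_sqrt hη.le]
    gcongr
  choose w hw using happ
  refine ⟨4 * ∑ k ∈ Finset.range n, ‖w k‖ ^ 2, by positivity, fun v => ?_⟩
  obtain ⟨x, hx⟩ : ∃ x, x = GraphSpace.toH v := ⟨_, rfl⟩
  rw [← hx]
  have hop : ∀ k, ⟪EB.vec k, GraphSpace.op v⟫_ℝ = EB.val k ^ σ * ⟪EB.vec k, x⟫_ℝ := fun k => by
    rw [hx]
    exact EB.inner_vec_pow σ v k
  -- A low mode is split into its approximation i(w k), against which x is seen only through the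
  -- adjoint of i, and a small remainder.
  have hhead : ∀ k, ⟪EB.vec k, x⟫_ℝ ^ 2 ≤ 2 * (1 / (4 * (n + 1))) * ‖x‖ ^ 2
      + 2 * (‖w k‖ ^ 2 * ‖ContinuousLinearMap.adjoint i x‖ ^ 2) := fun k => by
    have e : ⟪EB.vec k, x⟫_ℝ = ⟪EB.vec k - i (w k), x⟫_ℝ
        + ⟪w k, ContinuousLinearMap.adjoint i x⟫_ℝ := by
      rw [ContinuousLinearMap.adjoint_inner_right, ← inner_add_left, sub_add_cancel]
    have h1 : ⟪EB.vec k - i (w k), x⟫_ℝ ^ 2 ≤ 1 / (4 * (n + 1)) * ‖x‖ ^ 2 := by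
      have := abs_real_inner_le_norm (EB.vec k - i (w k)) x
      calc ⟪EB.vec k - i (w k), x⟫_ℝ ^ 2 = |⟪EB.vec k - i (w k), x⟫_ℝ| ^ 2 := (sq_abs _).symm
        _ ≤ (‖EB.vec k - i (w k)‖ * ‖x‖) ^ 2 := by gcongr
        _ = ‖EB.vec k - i (w k)‖ ^ 2 * ‖x‖ ^ 2 := mul_pow _ _ _
        _ ≤ _ := by gcongr; exact hw k
    have h2 : ⟪w k, ContinuousLinearMap.adjoint i x⟫_ℝ ^ 2 ≤
        ‖w k‖ ^ 2 * ‖ContinuousLinearMap.adjoint i x‖ ^ 2 := by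
      have := abs_real_inner_le_norm (w k) (ContinuousLinearMap.adjoint i x)
      rw [← sq_abs, ← mul_pow]
      gcongr
    rw [e]
    nlinarith [sq_nonneg (⟪EB.vec k - i (w k), x⟫_ℝ - ⟪w k, ContinuousLinearMap.adjoint i x⟫_ℝ)]
  have htail : ∀ k, n ≤ k → ⟪EB.vec k, x⟫_ℝ ^ 2 ≤ ε / 2 * ⟪EB.vec k, GraphSpace.op v⟫_ℝ ^ 2 := by
    intro k hk
    have h1 := hn k hk
    have h2 : 1 ≤ EB.val k ^ σ := (le_max_left _ _).trans h1
    have h3 : 2 / ε ≤ EB.val k ^ σ := (le_max_right _ _).trans h1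
    have h4 : 1 ≤ ε / 2 * (EB.val k ^ σ) ^ 2 := by
      have h5 : 2 / ε ≤ (EB.val k ^ σ) ^ 2 := by nlinarith
      calc (1 : ℝ) = ε / 2 * (2 / ε) := by field_simp
        _ ≤ _ := by gcongr
    rw [hop, mul_pow, ← mul_assoc]
    exact le_mul_of_one_le_left (sq_nonneg _) h4
  have hs : HasSum (fun k => ⟪EB.vec k, x⟫_ℝ ^ 2) (‖x‖ ^ 2) := EB.hasSum_inner_sq x
  have hs' := (EB.hasSum_inner_sq (GraphSpace.op v)).mul_left (ε / 2)
  have hsplit := hs.summable.sum_add_tsum_nat_add n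
  rw [hs.tsum_eq] at hsplit
  have ht1 : ∑' k, ⟪EB.vec (k + n), x⟫_ℝ ^ 2 ≤ ε / 2 * ‖GraphSpace.op v‖ ^ 2 := by
    have h1 : ∑' k, ⟪EB.vec (k + n), x⟫_ℝ ^ 2 ≤
        ∑' k, ε / 2 * ⟪EB.vec (k + n), GraphSpace.op v⟫_ℝ ^ 2 :=
      ((summable_nat_add_iff n).2 hs.summable).tsum_le_tsum (fun k => htail _ (by omega))
        ((summable_nat_add_iff n).2 hs'.summable)
    have h2 := hs'.summable.sum_add_tsum_nat_add n
    rw [hs'.tsum_eq] at h2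
    have h3 : 0 ≤ ∑ k ∈ Finset.range n, ε / 2 * ⟪EB.vec k, GraphSpace.op v⟫_ℝ ^ 2 :=
      Finset.sum_nonneg fun k _ => by positivity
    linarith
  have ht2 := Finset.sum_le_sum fun k (_ : k ∈ Finset.range n) => hhead k
  rw [Finset.sum_add_distrib, Finset.sum_const, Finset.card_range, nsmul_eq_mul, ← Finset.mul_sum,
    ← Finset.sum_mul] at ht2
  have h5 : (n : ℝ) * (2 * (1 / (4 * (n + 1))) * ‖x‖ ^ 2) ≤ 1 / 2 * ‖x‖ ^ 2 := by
    have : (n : ℝ) * (2 * (1 / (4 * (n + 1)))) ≤ 1 / 2 := by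
      rw [mul_one_div, mul_div_assoc', div_le_iff₀ (by positivity)]
      linarith
    rw [← mul_assoc]
    gcongr
  linarith

/-- The spaces `H`, `V_B^σ` and `V_A^r`. -/
noncomputable def EigenSystem.evolutionSpaces [CompleteSpace H] {A B : H →ₗ.[ℝ] H}
    (EA : EigenSystem A) (EB : EigenSystem B) {r σ : ℝ} (hr : 0 < r) (hσ : 0 < σ)
    [CompleteSpace (EA.SpecSpace r)] [CompleteSpace (GraphSpace (EB.pow σ))]
    (hA : 0 < EA.val 0 ∨ (EA.val 0 = 0 ∧ 0 < EA.val 1)) :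
    EvolutionSpaces H (GraphSpace (EB.pow σ)) (EA.SpecSpace r) :=
  -- The eigenvectors of A belong to V_A^r, so an element annihilated by the adjoint is orthogonal
  -- to a complete system.
  have hinj : ∀ f, ContinuousLinearMap.adjoint (SpecSpace.toHL (E := EA) hr) f = 0 → f = 0 :=
    fun f hf => EA.ext_inner_vec fun k => by
      have h := ContinuousLinearMap.adjoint_inner_left (SpecSpace.toHL (E := EA) hr)
        (SpecSpace.vec EA r k) f
      rw [hf, inner_zero_left, SpecSpace.toHL_apply, SpecSpace.toH_vec] at h
      rw [inner_zero_right, real_inner_comm, ← h]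
  { i := SpecSpace.toHL hr
    j := GraphSpace.toHL
    P := GraphSpace.opL
    e := if EA.val 0 = 0 then EA.vec 0 else 0
    eW := if EA.val 0 = 0 then SpecSpace.vec EA r 0 else 0
    norm_sq := GraphSpace.norm_sq_eq
    i_eW := by
      split_ifs
      · rfl
      · exact map_zero _
    inner_eW := fun w => by
      split_ifs with h
      · rw [SpecSpace.inner_eq, EA.zeroIndices_eq hA, if_pos h, SpecSpace.op_vec, h,
          Real.zero_rpow hr.ne', zero_smul, inner_zero_left, add_zero, Finset.sum_singleton,
          SpecSpace.toH_vec, real_inner_self_eq_norm_sq, EA.vec.orthonormal.1, one_pow, one_mul,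
          real_inner_comm]
        rfl
      · rw [inner_zero_left, inner_zero_left]
    e_unit := by
      split_ifs
      · exact Or.inr (EA.vec.orthonormal.1 0)
      · exact Or.inl rfl
    adjoint_injective := hinj
    ehrling := fun ε hε => EB.ehrling hσ _ hinj hε }

end Spectral

/-! ### The potential as a functional on L² -/

section Nemytskii

variable {α : Type*} [MeasurableSpace α] {ν : Measure α}

theorem convexENN_lintegral {φ : ℝ → ℝ≥0∞} (hφ : ConvexOn ℝ≥0 univ φ) (hm : Measurable φ) :
    ConvexENN fun v : Lp ℝ 2 ν => ∫⁻ x, φ (v x) ∂ν := by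
  intro v w a b ha hb hab
  have hv : AEMeasurable (fun x => φ (v x)) ν :=
    hm.comp_aemeasurable (Lp.aestronglyMeasurable v).aemeasurable
  have hw : AEMeasurable (fun x => φ (w x)) ν :=
    hm.comp_aemeasurable (Lp.aestronglyMeasurable w).aemeasurable
  have h1 : ∀ᵐ x ∂ν, φ ((a • v + b • w : Lp ℝ 2 ν) x) ≤
      ENNReal.ofReal a * φ (v x) + ENNReal.ofReal b * φ (w x) := by
    filter_upwards [Lp.coeFn_add (a • v) (b • w), Lp.coeFn_smul a v, Lp.coeFn_smul b w]
      with x e1 e2 e3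
    rw [e1, Pi.add_apply, e2, e3]
    have h2 := hφ.2 (mem_univ (v x)) (mem_univ (w x)) (zero_le (a := a.toNNReal))
      (zero_le (a := b.toNNReal)) (by
      rw [← Real.toNNReal_add ha hb, hab, Real.toNNReal_one])
    simp only [NNReal.smul_def, ENNReal.smul_def, Real.coe_toNNReal a ha,
      Real.coe_toNNReal b hb] at h2
    exact h2
  refine (lintegral_mono_ae h1).trans ?_
  rw [lintegral_add_left' (hv.const_mul _), lintegral_const_mul'' _ hv, lintegral_const_mul'' _ hw]

/-- Fatou's lemma along a subsequence that converges almost everywhere. -/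
theorem lowerSemicontinuous_lintegral {φ : ℝ → ℝ≥0∞} (hφ : LowerSemicontinuous φ) :
    LowerSemicontinuous fun v : Lp ℝ 2 ν => ∫⁻ x, φ (v x) ∂ν := by
  rw [lowerSemicontinuous_iff_isClosed_preimage]
  intro c
  refine IsSeqClosed.isClosed fun v z hv hz => ?_
  obtain ⟨ns, hns, hae⟩ := (tendstoInMeasure_of_tendsto_Lp hz).exists_seq_tendsto_ae
  have h1 : ∀ᵐ x ∂ν, φ (z x) ≤ liminf (fun n => φ (v (ns n) x)) atTop := by
    filter_upwards [hae] with x hx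
    refine le_of_forall_lt fun b hb => ?_
    obtain ⟨b', hb1, hb2⟩ := exists_between hb
    refine lt_of_lt_of_le hb1 (le_liminf_of_le (by isBoundedDefault) ?_)
    filter_upwards [hx.eventually (hφ _ _ hb2)] with n hn using hn.le
  have h2 := (lintegral_mono_ae h1).trans (lintegral_liminf_le' fun n =>
    hφ.measurable.comp_aemeasurable (Lp.aestronglyMeasurable (v (ns n))).aemeasurable)
  refine h2.trans (liminf_le_of_le (by isBoundedDefault) fun b hb => ?_)
  obtain ⟨n, hn⟩ := hb.exists
  exact hn.trans (hv (ns n))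

theorem norm_sq_L2 (v : Lp ℝ 2 ν) : ‖v‖ ^ 2 = ∫ x, v x ^ 2 ∂ν := by
  rw [← real_inner_self_eq_norm_sq, L2.inner_def]
  exact integral_congr_ae (ae_of_all _ fun x => (sq (v x)).symm)

theorem integrable_sq_L2 (v : Lp ℝ 2 ν) : Integrable (fun x => v x ^ 2) ν :=
  (Lp.memLp v).integrable_sq

variable [IsFiniteMeasure ν]

theorem memLp_comp_lipschitz {g : ℝ → ℝ} {L : ℝ≥0} (hg : LipschitzWith L g) (v : Lp ℝ 2 ν) :
    MemLp (fun x => g (v x)) 2 ν := by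
  have h1 : LipschitzWith L fun s => g s - g 0 := LipschitzWith.of_dist_le_mul fun x y => by
    rw [dist_sub_right]
    exact hg.dist_le_mul x y
  have h2 := (h1.comp_memLp (by simp) (Lp.memLp v)).add (memLp_const (g 0))
  refine h2.congr_norm ?_ ?_
  · exact hg.continuous.comp_aestronglyMeasurable (Lp.aestronglyMeasurable v)
  · exact ae_of_all _ fun x => by simp

/-- The superposition operator on `L²` associated with a Lipschitz continuous function. -/
noncomputable def superposition {g : ℝ → ℝ} {L : ℝ≥0} (hg : LipschitzWith L g) (v : Lp ℝ 2 ν) :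
    Lp ℝ 2 ν :=
  (memLp_comp_lipschitz hg v).toLp

theorem coeFn_superposition {g : ℝ → ℝ} {L : ℝ≥0} (hg : LipschitzWith L g) (v : Lp ℝ 2 ν) :
    superposition hg v =ᵐ[ν] fun x => g (v x) :=
  (memLp_comp_lipschitz hg v).coeFn_toLp

theorem norm_superposition_sub_le {g : ℝ → ℝ} {L : ℝ≥0} (hg : LipschitzWith L g) (v w : Lp ℝ 2 ν) :
    ‖superposition hg v - superposition hg w‖ ≤ L * ‖v - w‖ := by
  refine Lp.norm_le_mul_norm_of_ae_le_mul ?_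
  filter_upwards [Lp.coeFn_sub (superposition hg v) (superposition hg w), Lp.coeFn_sub v w,
    coeFn_superposition hg v, coeFn_superposition hg w] with x h1 h2 h3 h4
  rw [h1, h2, Pi.sub_apply, Pi.sub_apply, h3, h4]
  exact hg.norm_sub_le _ _

theorem inner_superposition_sub {g : ℝ → ℝ} {L : ℝ≥0} (hg : LipschitzWith L g)
    (v u w z : Lp ℝ 2 ν) :
    ⟪superposition hg v - u, w - z⟫_ℝ = ∫ x, (g (v x) - u x) * (w x - z x) ∂ν := by
  rw [L2.inner_def]
  refine integral_congr_ae ?_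
  filter_upwards [Lp.coeFn_sub (superposition hg v) u, coeFn_superposition hg v,
    Lp.coeFn_sub w z] with x h1 h2 h3
  rw [h1, h3, Pi.sub_apply, Pi.sub_apply, h2]
  exact mul_comm _ _

/-- Mean value inequality for f minus its tangent at b. The constant L, instead of the optimal L/2,
is why the potential is later given the Lipschitz constant 2L. -/
theorem abs_sub_sub_deriv_mul_le {f : ℝ → ℝ} {L : ℝ≥0} (hf : Differentiable ℝ f)
    (hL : LipschitzWith L (deriv f)) (a b : ℝ) :
    |f a - f b - deriv f b * (a - b)| ≤ L * (a - b) ^ 2 := by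
  have h := (convex_uIcc b a).norm_image_sub_le_of_norm_hasDerivWithin_le
    (f := fun s => f s - deriv f b * s) (f' := fun s => deriv f s - deriv f b)
    (C := L * |a - b|) (x := b) (y := a) (fun s _ => by
      have h1 := (hf s).hasDerivAt.sub ((hasDerivAt_id s).const_mul (deriv f b))
      rw [mul_one] at h1
      exact h1.hasDerivWithinAt) (fun s hs => by
      refine (hL.norm_sub_le s b).trans ?_
      rw [Real.norm_eq_abs]
      exact mul_le_mul_of_nonneg_left (abs_sub_left_of_mem_uIcc hs) L.2) left_mem_uIcc right_mem_uIcc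
  rw [Real.norm_eq_abs, Real.norm_eq_abs, mul_assoc, ← sq, sq_abs] at h
  convert h using 2
  ring

theorem integrable_comp_of_lipschitz_deriv {f : ℝ → ℝ} {L : ℝ≥0} (hf : Differentiable ℝ f)
    (hL : LipschitzWith L (deriv f)) (v : Lp ℝ 2 ν) : Integrable (fun x => f (v x)) ν := by
  have hv := Lp.memLp v
  have h2 : Integrable (fun x => ‖v x‖ ^ 2) ν := by simpa using hv.integrable_norm_pow (by norm_num)
  have h1 : Integrable (fun x => v x) ν := hv.integrable (by norm_num)
  refine Integrable.mono' (g := fun x => |f 0| + |deriv f 0| * ‖v x‖ + L * ‖v x‖ ^ 2)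
    (((integrable_const _).add (h1.norm.const_mul _)).add (h2.const_mul _))
    (hf.continuous.comp_aestronglyMeasurable (Lp.aestronglyMeasurable v)) (ae_of_all _ fun x => ?_)
  have h3 := abs_sub_sub_deriv_mul_le hf hL (v x) 0
  rw [sub_zero] at h3
  rw [Real.norm_eq_abs, Real.norm_eq_abs, sq_abs, ← abs_mul]
  have e : f (v x) = (f (v x) - f 0 - deriv f 0 * v x) + f 0 + deriv f 0 * v x := by ring
  rw [e]
  have h4 := abs_add_three (f (v x) - f 0 - deriv f 0 * v x) (f 0) (deriv f 0 * v x)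
  linarith

theorem abs_integral_taylor_le {f : ℝ → ℝ} {L : ℝ≥0} (hf : Differentiable ℝ f)
    (hL : LipschitzWith L (deriv f)) (v w : Lp ℝ 2 ν) :
    |∫ x, f (v x) ∂ν - ∫ x, f (w x) ∂ν - ⟪superposition hL w, v - w⟫_ℝ| ≤ L * ‖v - w‖ ^ 2 := by
  have iv := integrable_comp_of_lipschitz_deriv hf hL v
  have iw := integrable_comp_of_lipschitz_deriv hf hL w
  have ivw : Integrable (fun x => f (v x) - f (w x)) ν := iv.sub iw
  have ii := L2.integrable_inner (𝕜 := ℝ) (superposition hL w) (v - w)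
  rw [L2.inner_def, ← integral_sub iv iw, ← integral_sub ivw ii, norm_sq_L2,
    ← integral_const_mul, ← Real.norm_eq_abs]
  refine norm_integral_le_of_norm_le ((integrable_sq_L2 _).const_mul _) ?_
  filter_upwards [coeFn_superposition hL w, Lp.coeFn_sub v w] with x h1 h2
  rw [h1, h2, Pi.sub_apply, Real.norm_eq_abs]
  have := abs_sub_sub_deriv_mul_le hf hL (v x) (w x)
  have e : ⟪deriv f (w x), v x - w x⟫_ℝ = deriv f (w x) * (v x - w x) := mul_comm _ _
  rw [e]
  exact this

namespace IsAdmissiblePotential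

variable {βhat : ℝ → ℝ≥0∞} {πhat : ℝ → ℝ} {L : ℝ≥0} (h : IsAdmissiblePotential βhat πhat L)

include h

theorem differentiable : Differentiable ℝ πhat := h.contDiff.differentiable (by norm_num)

/-- The liminf provides c for large |s|; on the remaining compact interval βhat ≥ 0 and πhat is
bounded below by continuity. -/
theorem exists_coercive : ∃ c C : ℝ, 0 < c ∧ 0 ≤ C ∧
    ∀ s, βhat s ≠ ∞ → c * s ^ 2 - C ≤ (βhat s).toReal + πhat s := by
  obtain ⟨c, hc0, hc⟩ := EReal.lt_iff_exists_real_btwn.1 h.coercive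
  have hc0' : 0 < c := by exact_mod_cast hc0
  have h1 := eventually_lt_of_lt_liminf hc
  rw [eventually_comap] at h1
  obtain ⟨R, hR⟩ := eventually_atTop.1 h1
  obtain ⟨m, hm⟩ := (isCompact_Icc (a := -max R 1) (b := max R 1)).bddBelow_image
    h.contDiff.continuous.continuousOn
  refine ⟨c, c * (max R 1) ^ 2 + |m|, hc0', by positivity, fun s hs => ?_⟩
  rcases le_or_gt |s| (max R 1) with hs' | hs'
  · have h2 : m ≤ πhat s := hm ⟨s, abs_le.1 hs', rfl⟩
    have h3 : s ^ 2 ≤ (max R 1) ^ 2 := by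
      rw [← sq_abs]
      gcongr
    have h4 := mul_le_mul_of_nonneg_left h3 hc0'.le
    have h5 := neg_abs_le m
    have h6 : 0 ≤ (βhat s).toReal := ENNReal.toReal_nonneg
    linarith
  · have h2 := hR |s| ((le_max_left _ _).trans hs'.le) s rfl
    have hs0 : 0 < s ^ 2 := by
      rw [← sq_abs]
      have : 1 ≤ max R 1 := le_max_right _ _
      have : 0 < |s| := by linarith
      positivity
    rw [EReal.lt_div_iff (by exact_mod_cast hs0) (EReal.coe_ne_top _),
      ← EReal.coe_ennreal_toReal hs] at h2
    have h3 : c * s ^ 2 < (βhat s).toReal + πhat s := by exact_mod_cast h2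
    have : 0 ≤ c * (max R 1) ^ 2 + |m| := by positivity
    linarith

theorem exists_isPotential : ∃ (Pi : Lp ℝ 2 ν → ℝ) (c C : ℝ),
    IsPotential (fun v : Lp ℝ 2 ν => ∫⁻ x, βhat (v x) ∂ν) Pi (superposition h.lipschitz)
      (2 * L) c C := by
  obtain ⟨c, C, hc, hC, hcoer⟩ := h.exists_coercive
  refine ⟨fun v => ∫ x, πhat (v x) ∂ν, c, ν.real univ * C, ?_⟩
  refine ⟨convexENN_lintegral h.convex h.lsc.measurable, lowerSemicontinuous_lintegral h.lsc,
    by positivity, hc, by positivity, fun x y => ?_, fun x y => ?_, fun v hv => ?_⟩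
  · refine (norm_superposition_sub_le _ _ _).trans ?_
    have : (0 : ℝ) ≤ L * ‖x - y‖ := by positivity
    linarith
  · refine (abs_integral_taylor_le h.differentiable h.lipschitz x y).trans (le_of_eq ?_)
    ring
  · have hm : AEMeasurable (fun x => βhat (v x)) ν :=
      h.lsc.measurable.comp_aemeasurable (Lp.aestronglyMeasurable v).aemeasurable
    have hfin := ae_lt_top' hm hv
    have hi := integrable_toReal_of_lintegral_ne_top hm hv
    have iv := integrable_comp_of_lipschitz_deriv h.differentiable h.lipschitz v
    rw [← integral_toReal hm hfin, ← integral_add hi iv, norm_sq_L2, ← integral_const_mul,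
      ← smul_eq_mul (ν.real univ), ← integral_const, ← integral_sub
      ((integrable_sq_L2 v).const_mul c) (integrable_const _)]
    refine integral_mono_ae (((integrable_sq_L2 v).const_mul c).sub (integrable_const _))
      (hi.add iv) ?_
    filter_upwards [hfin] with x hx
    exact hcoer _ hx.ne

theorem ne_top_of_mem_subdiffDomain {s : ℝ} (hs : s ∈ subdiffDomain βhat) : βhat s ≠ ∞ := by
  obtain ⟨ξ, hξ⟩ := hs
  intro htop
  have h1 := hξ 0
  rw [htop, h.zero, EReal.coe_ennreal_top, EReal.top_add_coe, EReal.coe_ennreal_zero] at h1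
  exact absurd h1 (by simp)

theorem le_add_of_mem_Icc {a b s : ℝ} (hs : s ∈ Icc a b) : βhat s ≤ βhat a + βhat b := by
  rcases hs.1.eq_or_lt with rfl | h1
  · exact le_self_add
  have hab : 0 < b - a := by linarith [hs.2]
  have h2 := h.convex.2 (mem_univ a) (mem_univ b) (zero_le (a := ((b - s) / (b - a)).toNNReal))
    (zero_le (a := ((s - a) / (b - a)).toNNReal)) (by
      rw [← Real.toNNReal_add (div_nonneg (by linarith [hs.2]) hab.le)
        (div_nonneg (by linarith [hs.1]) hab.le), ← add_div]
      rw [show b - s + (s - a) = b - a by ring, div_self hab.ne', Real.toNNReal_one])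
  have e : ((b - s) / (b - a)).toNNReal • a + ((s - a) / (b - a)).toNNReal • b = s := by
    rw [NNReal.smul_def, NNReal.smul_def, Real.coe_toNNReal _ (div_nonneg (by linarith [hs.2]) hab.le),
      Real.coe_toNNReal _ (div_nonneg (by linarith [hs.1]) hab.le), smul_eq_mul, smul_eq_mul]
    field_simp
    ring
  rw [e] at h2
  refine h2.trans (add_le_add ?_ ?_)
  · rw [ENNReal.smul_def]
    refine mul_le_of_le_one_left (zero_le) ?_
    rw [ENNReal.coe_le_one_iff, Real.toNNReal_le_one, div_le_one hab]
    linarith [hs.1]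
  · rw [ENNReal.smul_def]
    refine mul_le_of_le_one_left (zero_le) ?_
    rw [ENNReal.coe_le_one_iff, Real.toNNReal_le_one, div_le_one hab]
    linarith [hs.2]

/-- A bound of the potential near the admissible mean values. -/
theorem exists_bound_of_Icc_subset {δ : ℝ} (hδ : 0 < δ) (R : ℝ) : ∃ C : ℝ≥0, ∀ m, |m| ≤ R →
    Icc (m - δ) (m + δ) ⊆ subdiffDomain βhat → ∀ s ∈ Icc (m - δ / 2) (m + δ / 2), βhat s ≤ C := by
  let G : Set ℝ := {m | |m| ≤ R ∧ Icc (m - δ) (m + δ) ⊆ subdiffDomain βhat}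
  rcases G.eq_empty_or_nonempty with hG | hG
  · refine ⟨0, fun m h1 h2 => ?_⟩
    have : m ∈ G := ⟨h1, h2⟩
    rw [hG] at this
    exact this.elim
  have hup : BddAbove G := ⟨R, fun m hm => (abs_le.1 hm.1).2⟩
  have hlow : BddBelow G := ⟨-R, fun m hm => (abs_le.1 hm.1).1⟩
  -- The potential may blow up at the ends of its domain, so means close to the supremum and to the
  -- infimum of the admissible ones are used. All intervals of radius δ/2 lie in [m₂ - δ, m₁ + δ],
  -- at whose ends βhat is finite, and convexity bounds it in between.
  obtain ⟨m₁, hm₁, hs₁⟩ := exists_lt_of_lt_csSup hG (show sSup G - δ / 2 < sSup G by linarith)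
  obtain ⟨m₂, hm₂, hs₂⟩ := exists_lt_of_csInf_lt hG (show sInf G < sInf G + δ / 2 by linarith)
  have ht₁ := h.ne_top_of_mem_subdiffDomain (hm₁.2 ⟨by linarith, le_rfl⟩)
  have ht₂ := h.ne_top_of_mem_subdiffDomain (hm₂.2 ⟨le_rfl, by linarith⟩)
  refine ⟨(βhat (m₂ - δ) + βhat (m₁ + δ)).toNNReal, fun m h1 h2 s hs => ?_⟩
  rw [ENNReal.coe_toNNReal (ENNReal.add_ne_top.2 ⟨ht₂, ht₁⟩)]
  have h3 := le_csSup hup (show m ∈ G from ⟨h1, h2⟩)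
  have h4 := csInf_le hlow (show m ∈ G from ⟨h1, h2⟩)
  exact h.le_add_of_mem_Icc ⟨by linarith [hs.1], by linarith [hs.2]⟩

end IsAdmissiblePotential

end Nemytskii

/-! ### Regularity of the datum u in time -/

theorem sq_integral_norm_le {X : Type*} [NormedAddCommGroup X] {T : ℝ} {f : ℝ → X} (hT : 0 < T)
    (hf : MemLp f 2 (timeMeasure T)) {s t : ℝ}
    (hs : s ∈ Icc 0 T) (ht : t ∈ Icc 0 T) (hst : s ≤ t) :
    (∫ x in s..t, ‖f x‖) ^ 2 ≤ (t - s) * ∫ x, ‖f x‖ ^ 2 ∂timeMeasure T := by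
  have hsub : uIcc s t ⊆ uIcc 0 T := by
    rw [uIcc_of_le hst, uIcc_of_le hT.le]
    exact Icc_subset_Icc hs.1 ht.2
  have i1 : IntervalIntegrable (fun x => ‖f x‖) volume s t :=
    ((integrable_timeMeasure_iff hT).1 (hf.integrable (by norm_num)).norm).mono_set hsub
  have i2' := (integrable_timeMeasure_iff hT).1 (integrable_norm_sq hf)
  have i2 : IntervalIntegrable (fun x => ‖f x‖ ^ 2) volume s t := i2'.mono_set hsub
  have h1 : ∫ x in s..t, ‖f x‖ ^ 2 ≤ ∫ x, ‖f x‖ ^ 2 ∂timeMeasure T := by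
    rw [integral_timeMeasure hT]
    exact intervalIntegral.integral_mono_interval hs.1 hst ht.2
      (ae_of_all _ fun x => sq_nonneg _) i2'
  obtain ⟨a, ha⟩ : ∃ a, a = ∫ x in s..t, ‖f x‖ := ⟨_, rfl⟩
  -- The Cauchy–Schwarz inequality, by integrating ((t - s)‖f‖ - a)² ≥ 0 where a is the integral of
  -- the norm.
  have h2 : 2 * a * a * (t - s) ≤ (t - s) ^ 2 * (∫ x in s..t, ‖f x‖ ^ 2) + a ^ 2 * (t - s) := by
    have h3 : ∫ x in s..t, 2 * a * (t - s) * ‖f x‖ ≤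
        ∫ x in s..t, ((t - s) ^ 2 * ‖f x‖ ^ 2 + a ^ 2) :=
      intervalIntegral.integral_mono_on hst (i1.const_mul _)
        ((i2.const_mul _).add intervalIntegrable_const)
        (fun x _ => by nlinarith [sq_nonneg ((t - s) * ‖f x‖ - a)])
    rw [intervalIntegral.integral_const_mul, intervalIntegral.integral_add (i2.const_mul _)
      intervalIntegrable_const, intervalIntegral.integral_const_mul,
      intervalIntegral.integral_const, smul_eq_mul, ← ha] at h3
    linarith
  rw [← ha]
  rcases hst.eq_or_lt with rfl | hlt
  · rw [intervalIntegral.integral_same] at ha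
    rw [ha]
    simp
  · have h4 : 0 < t - s := by linarith
    have h5 : a ^ 2 ≤ (t - s) * ∫ x in s..t, ‖f x‖ ^ 2 := by
      refine le_of_mul_le_mul_left ?_ h4
      linarith
    exact h5.trans (by gcongr)

section Data

variable {X : Type*} [NormedAddCommGroup X] [InnerProductSpace ℝ X] {T : ℝ}

theorem eLpNorm_two_eq {f : ℝ → X} (hf : MemLp f 2 (timeMeasure T)) :
    eLpNorm f 2 (timeMeasure T) = ENNReal.ofReal √(∫ t, ‖f t‖ ^ 2 ∂timeMeasure T) := by
  rw [← norm_sq_toLp hf, Real.sqrt_sq (norm_nonneg _), Lp.norm_toLp, ENNReal.ofReal_toReal hf.2.ne]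

theorem integral_norm_sq_le_of_eLpNorm_le {f : ℝ → X} (hf : MemLp f 2 (timeMeasure T)) {M : ℝ≥0}
    (h : eLpNorm f 2 (timeMeasure T) ≤ M) : ∫ t, ‖f t‖ ^ 2 ∂timeMeasure T ≤ M ^ 2 := by
  rw [← norm_sq_toLp hf, Lp.norm_toLp]
  have : (eLpNorm f 2 (timeMeasure T)).toReal ≤ M := ENNReal.toReal_le_coe_of_le_coe h
  gcongr

variable [CompleteSpace X]

/-- Bounds of the continuous representative of a function in `H¹(0, T; X)`. -/
theorem exists_bound_representative (hT : 0 < T) (M : ℝ≥0) : ∃ M', 0 ≤ M' ∧ ∀ u du : ℝ → X,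
    IsH1 T u du → h1Norm T u du ≤ M → ∃ U : ℝ → X, u =ᵐ[timeMeasure T] U ∧
      (∀ t ∈ Icc 0 T, ‖U t‖ ≤ M') ∧
      (∀ s ∈ Icc 0 T, ∀ t ∈ Icc 0 T, ‖U t - U s‖ ^ 2 ≤ M' * |t - s|) ∧
      ∀ (n : ℕ) (h : ℝ), 0 < h → n * h = T →
        ∑ k ∈ Finset.range n, ‖U ((k + 1 : ℕ) * h) - U (k * h)‖ ≤ M' := by
  -- C bounds the squared initial value c of the representative: average ‖c‖² ≤ 2‖u(t)‖² + 2‖∫₀ᵗ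
  -- du‖² over (0, T), the primitive being bounded by Cauchy–Schwarz.
  obtain ⟨C, hC⟩ : ∃ C : ℝ, C = 2 * (M ^ 2 + T * (T * M ^ 2)) / T := ⟨_, rfl⟩
  have hC0 : 0 ≤ C := by rw [hC]; positivity
  refine ⟨1 + 2 * C + 2 * (T * M ^ 2) + M ^ 2 + T * M ^ 2, by positivity, fun u du hu hM => ?_⟩
  have hMu : ∫ t, ‖u t‖ ^ 2 ∂timeMeasure T ≤ M ^ 2 :=
    integral_norm_sq_le_of_eLpNorm_le hu.memLp (le_self_add.trans hM)
  have hMdu : ∫ t, ‖du t‖ ^ 2 ∂timeMeasure T ≤ M ^ 2 :=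
    integral_norm_sq_le_of_eLpNorm_le hu.memLp_deriv (le_add_self.trans hM)
  have idu := hu.memLp_deriv.integrable (q := 2) (by norm_num)
  have idu' := (integrable_timeMeasure_iff hT).1 idu
  obtain ⟨c, hc⟩ := hu.weakDeriv.exists_ae_eq_add_primitive hT (hu.memLp.integrable (by norm_num)) idu
  have hint : ∀ t ∈ Icc 0 T, IntervalIntegrable du volume 0 t :=
    intervalIntegrable_of_mem hT idu
  have hdiff : ∀ s ∈ Icc 0 T, ∀ t ∈ Icc 0 T, s ≤ t →
      ‖(∫ x in (0 : ℝ)..t, du x) - ∫ x in (0 : ℝ)..s, du x‖ ≤ ∫ x in s..t, ‖du x‖ := by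
    intro s hs t ht hst
    rw [intervalIntegral.integral_interval_sub_left (hint t ht) (hint s hs)]
    exact intervalIntegral.norm_integral_le_integral_norm hst
  have hsq : ∀ s ∈ Icc 0 T, ∀ t ∈ Icc 0 T, s ≤ t →
      (∫ x in s..t, ‖du x‖) ^ 2 ≤ (t - s) * M ^ 2 := by
    intro s hs t ht hst
    refine (sq_integral_norm_le hT hu.memLp_deriv hs ht hst).trans ?_
    have : 0 ≤ t - s := by linarith
    gcongr
  have h0 : (0 : ℝ) ∈ Icc 0 T := ⟨le_rfl, hT.le⟩
  have hprim : ∀ t ∈ Icc 0 T, ‖∫ x in (0 : ℝ)..t, du x‖ ^ 2 ≤ T * M ^ 2 := by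
    intro t ht
    have h1 := hdiff 0 h0 t ht ht.1
    rw [intervalIntegral.integral_same, sub_zero] at h1
    calc ‖∫ x in (0 : ℝ)..t, du x‖ ^ 2 ≤ (∫ x in (0 : ℝ)..t, ‖du x‖) ^ 2 := by gcongr
      _ ≤ (t - 0) * M ^ 2 := hsq 0 h0 t ht ht.1
      _ ≤ T * M ^ 2 := by
          rw [sub_zero]
          gcongr
          exact ht.2
  have hcC : ‖c‖ ^ 2 ≤ C := by
    have h1 : ∀ᵐ t ∂timeMeasure T, ‖c‖ ^ 2 ≤ 2 * ‖u t‖ ^ 2 + 2 * (T * M ^ 2) := by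
      have hIcc : ∀ᵐ t ∂timeMeasure T, t ∈ Icc 0 T :=
        ae_timeMeasure.2 (ae_of_all _ fun t ht => Ioo_subset_Icc_self ht)
      filter_upwards [hc, hIcc] with t ht1 ht2
      have e : c = u t - ∫ x in (0 : ℝ)..t, du x := by rw [ht1, add_sub_cancel_right]
      have h2 : ‖c‖ ≤ ‖u t‖ + ‖∫ x in (0 : ℝ)..t, du x‖ := by
        nth_rewrite 1 [e]
        exact norm_sub_le _ _
      have h3 : ‖c‖ ^ 2 ≤ (‖u t‖ + ‖∫ x in (0 : ℝ)..t, du x‖) ^ 2 := by gcongr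
      nlinarith [hprim t ht2, sq_nonneg (‖u t‖ - ‖∫ x in (0 : ℝ)..t, du x‖)]
    have h2 := integral_mono_ae (integrable_const _)
      (((integrable_norm_sq hu.memLp).const_mul 2).add (integrable_const _)) h1
    simp only [Pi.add_apply] at h2
    rw [integral_add ((integrable_norm_sq hu.memLp).const_mul 2) (integrable_const _),
      integral_const_mul, integral_timeMeasure hT, integral_timeMeasure hT (fun _ => 2 * (T * _)),
      intervalIntegral.integral_const, intervalIntegral.integral_const, sub_zero, smul_eq_mul,
      smul_eq_mul] at h2
    rw [hC, le_div_iff₀ hT]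
    linarith
  have hTM : 0 ≤ T * (M : ℝ) ^ 2 := by positivity
  refine ⟨fun t => c + ∫ x in (0 : ℝ)..t, du x, hc, fun t ht => ?_, fun s hs t ht => ?_,
    fun n h hh hn => ?_⟩
  · have h1 := norm_add_le c (∫ x in (0 : ℝ)..t, du x)
    have h2 := hprim t ht
    nlinarith [sq_nonneg (‖c‖ - 1), sq_nonneg (‖∫ x in (0 : ℝ)..t, du x‖ - 1), sq_nonneg (M : ℝ)]
  · rw [add_sub_add_left_eq_sub]
    have key : ∀ s ∈ Icc 0 T, ∀ t ∈ Icc 0 T, s ≤ t →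
        ‖(∫ x in (0 : ℝ)..t, du x) - ∫ x in (0 : ℝ)..s, du x‖ ^ 2 ≤
        (1 + 2 * C + 2 * (T * M ^ 2) + M ^ 2 + T * M ^ 2) * |t - s| := by
      intro s hs t ht hst
      have h1 := hdiff s hs t ht hst
      calc _ ≤ (∫ x in s..t, ‖du x‖) ^ 2 := by gcongr
        _ ≤ (t - s) * M ^ 2 := hsq s hs t ht hst
        _ = M ^ 2 * |t - s| := by rw [abs_of_nonneg (by linarith), mul_comm]
        _ ≤ _ := by
          gcongr
          linarith
    rcases le_total s t with h | h
    · exact key s hs t ht h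
    · rw [norm_sub_rev, abs_sub_comm]
      exact key t ht s hs h
  · have hmem : ∀ k ≤ n, (k : ℝ) * h ∈ Icc 0 T := fun k hk =>
      ⟨by positivity, by rw [← hn]; gcongr⟩
    have hle : ∀ k : ℕ, (k : ℝ) * h ≤ (k + 1 : ℕ) * h := fun k => by
      gcongr
      omega
    have h1 : ∑ k ∈ Finset.range n, ‖(c + ∫ x in (0 : ℝ)..((k + 1 : ℕ) * h), du x)
        - (c + ∫ x in (0 : ℝ)..(k * h), du x)‖ ≤
        ∑ k ∈ Finset.range n, ∫ x in (k * h)..((k + 1 : ℕ) * h), ‖du x‖ := by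
      refine Finset.sum_le_sum fun k hk => ?_
      rw [add_sub_add_left_eq_sub]
      have hk' := Finset.mem_range.1 hk
      exact hdiff _ (hmem k hk'.le) _ (hmem (k + 1) hk') (hle k)
    have h2 : ∑ k ∈ Finset.range n, ∫ x in (k * h)..((k + 1 : ℕ) * h), ‖du x‖ =
        ∫ x in (0 : ℝ)..T, ‖du x‖ := by
      rw [intervalIntegral.sum_integral_adjacent_intervals (a := fun k : ℕ => (k : ℝ) * h)
        (fun k hk => idu'.norm.mono_set ?_)]
      · rw [hn, Nat.cast_zero, zero_mul]
      · rw [uIcc_of_le (hle k), uIcc_of_le hT.le]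
        exact Icc_subset_Icc (hmem k hk.le).1 (hmem (k + 1) hk).2
    have h3 := hsq 0 h0 T ⟨hT.le, le_rfl⟩ hT.le
    rw [sub_zero] at h3
    rw [h2] at h1
    refine h1.trans ?_
    nlinarith [sq_nonneg ((∫ x in (0 : ℝ)..T, ‖du x‖) - 1), sq_nonneg (M : ℝ)]

end Data

/-! ### Equivalence of solutions and exact trajectories -/

theorem ereal_add_le_iff {a c d : ℝ} {b e : ℝ≥0∞} (hb : b ≠ ∞) (he : e ≠ ∞) :
    (a : EReal) + (b : EReal) + (c : EReal) ≤ (d : EReal) + (e : EReal) ↔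
      a + b.toReal + c ≤ d + e.toReal := by
  rw [← EReal.coe_ennreal_toReal hb, ← EReal.coe_ennreal_toReal he]
  norm_cast

theorem HasInitialValue.eq {X : Type*} [NormedAddCommGroup X] {T : ℝ} (hT : 0 < T) {f : ℝ → X}
    {x : X} (h : HasInitialValue T f x) {c : ℝ → X} (hc : ContinuousOn c (Icc 0 T))
    (hcf : f =ᵐ[timeMeasure T] c) : c 0 = x := by
  obtain ⟨c', hc', hcf', rfl⟩ := h
  have h1 : c =ᵐ[volume.restrict (Icc 0 T)] c' := by
    rw [← Measure.restrict_congr_set Ioo_ae_eq_Icc]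
    exact (hcf'.trans hcf).symm
  exact Measure.eqOn_Icc_of_ae_eq volume hT.ne h1 hc hc' ⟨le_rfl, hT.le⟩

theorem HasWeakTimeDeriv.congr_left {X : Type*} [NormedAddCommGroup X] [NormedSpace ℝ X] {T : ℝ}
    {f g f' : ℝ → X} (h : HasWeakTimeDeriv T f f') (hfg : f =ᵐ[timeMeasure T] g) :
    HasWeakTimeDeriv T g f' := by
  intro φ hφ hφc hφs
  rw [← h φ hφ hφc hφs]
  refine integral_congr_ae ?_
  filter_upwards [hfg] with t ht
  rw [ht]

/-- Includes τ = 0, where the inverse is zero; this allows one definition of the H-valued derivative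
for all τ ≥ 0. -/
theorem mul_inv_sqrt_self {τ : ℝ} (hτ : 0 ≤ τ) : τ * (√τ)⁻¹ = √τ := by
  rcases hτ.eq_or_lt with rfl | h
  · simp
  · have : √τ ≠ 0 := (Real.sqrt_pos.2 h).ne'
    rw [← div_eq_mul_inv, Real.div_sqrt]

section Riesz

variable {W : Type*} [NormedAddCommGroup W] [InnerProductSpace ℝ W] {T : ℝ}

theorem memLp_innerSL {p : ℝ → W} (hp : MemLp p 2 (timeMeasure T)) :
    MemLp (fun t => innerSL ℝ (p t)) 2 (timeMeasure T) :=
  hp.congr_norm ((innerSL ℝ).continuous.comp_aestronglyMeasurable hp.1)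
    (ae_of_all _ fun t => (innerSL_apply_norm (𝕜 := ℝ) (p t)).symm)

theorem memLp_neg_innerSL {p : ℝ → W} (hp : MemLp p 2 (timeMeasure T)) :
    MemLp (fun t => -innerSL ℝ (p t)) 2 (timeMeasure T) :=
  (memLp_innerSL hp).neg

/-- The Riesz map is injective and commutes with integrals, so an integrated equation in V_A^{-r} is
one in V_A^r. -/
theorem innerSL_eq_add_integral_iff [CompleteSpace W] {dy : ℝ → StrongDual ℝ W} {p : ℝ → W}
    (hT : 0 < T) (hp : MemLp p 2 (timeMeasure T))
    (h : dy =ᵐ[timeMeasure T] fun t => -innerSL ℝ (p t)) {t : ℝ} (ht : t ∈ Icc 0 T) (a b : W) :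
    innerSL ℝ b = innerSL ℝ a + ∫ s in (0 : ℝ)..t, dy s ↔
      a - (∫ s in (0 : ℝ)..t, p s) - b = 0 := by
  let J : W →L[ℝ] StrongDual ℝ W := innerSL ℝ
  have hi := intervalIntegrable_of_mem hT (hp.integrable (by norm_num)) t ht
  have e : ∫ s in (0 : ℝ)..t, dy s = -J (∫ s in (0 : ℝ)..t, p s) := by
    rw [integral_congr_timeMeasure h ht, intervalIntegral.integral_neg,
      ← J.intervalIntegral_comp_comm hi]
  rw [e, sub_eq_zero, eq_comm, ← sub_eq_add_neg]
  change J a - J _ = J b ↔ _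
  rw [← map_sub]
  exact ⟨fun h => ext_inner_right ℝ fun w => congrArg (fun φ : StrongDual ℝ W => φ w) h,
    fun h => congrArg J h⟩

end Riesz

section Solution

variable {Ω : Set Space3} {A B : L2 Ω →ₗ.[ℝ] L2 Ω} {EA : EigenSystem A} {EB : EigenSystem B}
  {r σ : ℝ} {hr : 0 < r} {hσ : 0 < σ} [CompleteSpace (EA.SpecSpace r)]
  [CompleteSpace (GraphSpace (EB.pow σ))] {hA : 0 < EA.val 0 ∨ (EA.val 0 = 0 ∧ 0 < EA.val 1)}

theorem toNeg_eq_innerSL (f : L2 Ω) :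
    EA.toNeg hr f = innerSL ℝ ((EA.evolutionSpaces EB hr hσ hA).N f) := by
  ext w
  rw [innerSL_apply_apply, EvolutionSpaces.inner_N]
  rfl

theorem norm_toNeg_eq (f : L2 Ω) :
    ‖EA.toNeg hr f‖ = ‖(EA.evolutionSpaces EB hr hσ hA).N f‖ := by
  rw [← innerSL_apply_norm (𝕜 := ℝ), ← toNeg_eq_innerSL]

theorem inner_proj_eq (μ v : EA.SpecSpace r) :
    ⟪(EA.evolutionSpaces EB hr hσ hA).proj μ, v⟫_ℝ =
      ⟪EigenSystem.SpecSpace.op μ, EigenSystem.SpecSpace.op v⟫_ℝ := by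
  rw [EvolutionSpaces.inner_i_proj, EigenSystem.SpecSpace.inner_eq, EA.zeroIndices_eq hA]
  change _ - ⟪if EA.val 0 = 0 then EA.vec 0 else 0, EigenSystem.SpecSpace.toH μ⟫_ℝ *
    ⟪if EA.val 0 = 0 then EA.vec 0 else 0, EigenSystem.SpecSpace.toH v⟫_ℝ = _
  split_ifs
  · rw [Finset.sum_singleton, real_inner_comm, real_inner_comm (EA.vec 0)]
    ring
  · simp

theorem first_equation_iff (φ : EA.NegSpace r) (μ : EA.SpecSpace r) :
    (∀ v, φ v + ⟪EigenSystem.SpecSpace.op μ, EigenSystem.SpecSpace.op v⟫_ℝ = 0) ↔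
      φ = -innerSL ℝ ((EA.evolutionSpaces EB hr hσ hA).proj μ) := by
  constructor
  · intro h
    ext v
    rw [neg_apply, innerSL_apply_apply, inner_proj_eq]
    linarith [h v]
  · rintro rfl v
    rw [neg_apply, innerSL_apply_apply, inner_proj_eq, neg_add_cancel]

variable {T τ : ℝ} {βhat : ℝ → ℝ≥0∞} {πhat : ℝ → ℝ} {L : ℝ≥0} {u : ℝ → L2 Ω}
  {y₀ : GraphSpace (EB.pow σ)} {y : ℝ → GraphSpace (EB.pow σ)} {μ : ℝ → EA.SpecSpace r}

variable [IsFiniteMeasure (volume.restrict Ω)]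

/-- Brings arbitrary solutions, not just constructed ones, within reach of the stability estimate,
as trajectories with h = 0 and d = √τ ∂ₜy. -/
theorem IsSolution.isTrajectory {dy : ℝ → EA.NegSpace r} {dyH : ℝ → L2 Ω} (hT : 0 < T)
    (hτ : 0 ≤ τ) (hp : IsAdmissiblePotential βhat πhat L)
    (hy₀ : betaIntegral βhat (GraphSpace.toH y₀) < ∞)
    (h : IsSolution EA EB hr σ T τ βhat πhat u y₀ y μ dy dyH) :
    (EA.evolutionSpaces EB hr hσ hA).IsTrajectory (betaIntegral βhat) (superposition hp.lipschitz)
      T τ 0 u y₀ y (fun t => GraphSpace.toH (y t)) μ (fun t => √τ • dyH t) := by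
  set S := EA.evolutionSpaces EB hr hσ hA with hS
  have hy : MemLp y 2 (timeMeasure T) := h.memLinfty_y.mono_exponent le_top
  have hd : MemLp (fun t => √τ • dyH t) 2 (timeMeasure T) := by
    rcases hτ.eq_or_lt with rfl | hτ'
    · simp
    · have h1 := h.memL2_tau_dy.const_smul (√τ)⁻¹
      have e : (fun t => √τ • dyH t) = (√τ)⁻¹ • fun t => τ • dyH t := by
        funext t
        rw [Pi.smul_apply, smul_smul, mul_comm, mul_inv_sqrt_self hτ]
      rwa [e]
  have hdy := h.memH1_y.memLp_deriv.integrable (q := 2) (by norm_num)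
  have hIcc : ∀ᵐ t ∂timeMeasure T, t ∈ Icc 0 T :=
    ae_timeMeasure.2 (ae_of_all _ fun t ht => Ioo_subset_Icc_self ht)
  have hdyeq : dy =ᵐ[timeMeasure T] fun t => -innerSL ℝ (S.proj (μ t)) :=
    h.first_equation.mono fun t ht => (first_equation_iff _ _).1 ht
  have hpW : ∀ᵐ t ∂timeMeasure T,
      S.N (S.j y₀) - (∫ s in (0 : ℝ)..t, S.proj (μ s)) - S.N (S.j (y t)) = 0 := by
    obtain ⟨c, hc⟩ := h.memH1_y.weakDeriv.exists_ae_eq_add_primitive hT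
      (h.memH1_y.memLp.integrable (by norm_num)) hdy
    have hc0 : c + ∫ s in (0 : ℝ)..0, dy s = _ := h.initial_value.eq hT
      (continuousOn_const.add (continuousOn_primitive hT hdy)) hc
    rw [intervalIntegral.integral_same, add_zero] at hc0
    filter_upwards [hc, hIcc] with t ht1 ht2
    rw [hc0, toNeg_eq_innerSL (EB := EB) (hσ := hσ) (hA := hA),
      toNeg_eq_innerSL (EB := EB) (hσ := hσ) (hA := hA)] at ht1
    exact (innerSL_eq_add_integral_iff hT (S.proj.comp_memLp' h.memL2_μ) hdyeq ht2 _ _).1 ht1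
  have hN : 0 < τ → ∀ᵐ t ∂timeMeasure T, S.N (dyH t) = -S.proj (μ t) := by
    intro hτ'
    filter_upwards [h.tau_dy_eq, hdyeq] with t h1 h2
    refine ext_inner_right ℝ fun w => ?_
    have h3 := congrArg (fun φ : EA.NegSpace r => φ w) h1
    simp only [map_smul, smul_apply, smul_eq_mul] at h3
    have h4 := mul_left_cancel₀ hτ'.ne' h3
    rw [h2, toNeg_eq_innerSL (EB := EB) (hσ := hσ) (hA := hA)] at h4
    rw [inner_neg_left]
    exact h4
  -- Testing with y₀, whose potential is finite, makes the right-hand side finite and excludes an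
  -- infinite potential of y.
  have hfin : ∀ᵐ t ∂timeMeasure T, betaIntegral βhat (S.j (y t)) ≠ ∞ := by
    filter_upwards [h.second_inequality] with t h1 htop
    have h2 := h1 y₀
    rw [show betaIntegral βhat (GraphSpace.toH (y t)) = ∞ from htop, EReal.coe_ennreal_top,
      EReal.coe_add_top, EReal.top_add_coe, top_le_iff, ← EReal.coe_ennreal_toReal hy₀.ne] at h2
    exact absurd h2 (by rw [← EReal.coe_add]; exact EReal.coe_ne_top _)
  refine ⟨hy, S.j.comp_memLp' hy, h.memL2_μ, hd, ?_, ?_, ?_, hfin, ?_⟩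
  · filter_upwards [hpW] with t ht
    rw [ht]
    simp
  · rcases hτ.eq_or_lt with rfl | hτ'
    · simp
    · filter_upwards [hpW, hIcc] with t h1 h2
      rw [zero_mul, norm_le_zero_iff]
      -- The primitive identity in H follows from the one in W by injectivity of N, since N ∂ₜy =
      -- -proj μ when τ > 0.
      refine S.adjoint_injective _ ?_
      change S.N _ = 0
      have i1 := intervalIntegrable_of_mem hT (hd.integrable (by norm_num)) t h2
      rw [map_sub, map_add, ← S.N.intervalIntegral_comp_comm i1, map_smul, map_smul]
      have e : ∫ s in (0 : ℝ)..t, S.N (√τ • dyH s) = -√τ • ∫ s in (0 : ℝ)..t, S.proj (μ s) := by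
        rw [← intervalIntegral.integral_smul]
        refine integral_congr_timeMeasure (T := T) ?_ h2
        filter_upwards [hN hτ'] with s hs
        rw [map_smul, hs, smul_neg, neg_smul]
      rw [e, neg_smul, ← sub_eq_add_neg, ← smul_sub, ← smul_sub, h1, smul_zero]
  -- Conservation of the mean: the integrated equation is paired with eW, to which `proj μ` is
  -- orthogonal.
  · filter_upwards [hpW, hIcc] with t h1 h2
    have h3 := congrArg (fun φ => ⟪S.eW, φ⟫_ℝ) h1
    have i1 : IntervalIntegrable (fun s => S.proj (μ s)) volume 0 t :=
      intervalIntegrable_of_mem hT ((S.proj.comp_memLp' h.memL2_μ).integrable (by norm_num)) t h2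
    have e1 := (innerSL ℝ S.eW).intervalIntegral_comp_comm i1
    simp only [innerSL_apply_apply, S.inner_eW, S.inner_e_i_proj] at e1
    rw [← S.inner_eW, intervalIntegral.integral_zero] at e1
    simp only [inner_sub_right, S.inner_N', S.i_eW, inner_zero_right, ← e1] at h3
    linarith
  · filter_upwards [h.second_inequality, hfin] with t h1 h2 v hv
    have h3 := (ereal_add_le_iff h2 hv).1 (h1 v)
    have e1 : √τ * ⟪√τ • dyH t, S.j (y t - v)⟫_ℝ = τ * ⟪dyH t, S.j (y t - v)⟫_ℝ := by
      rw [real_inner_smul_left, ← mul_assoc, Real.mul_self_sqrt hτ]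
    have e2 := inner_superposition_sub hp.lipschitz (GraphSpace.toH (y t)) (u t)
      (GraphSpace.toH (y t)) (GraphSpace.toH v)
    rw [e1]
    have e3 : S.j (y t - v) = GraphSpace.toH (y t) - GraphSpace.toH v := map_sub S.j _ _
    rw [← e2, ← e3] at h3
    exact h3

end Solution

section Solution

variable {Ω : Set Space3} {A B : L2 Ω →ₗ.[ℝ] L2 Ω} {EA : EigenSystem A} {EB : EigenSystem B}
  {r σ : ℝ} {hr : 0 < r} {hσ : 0 < σ} [CompleteSpace (EA.SpecSpace r)]
  [CompleteSpace (GraphSpace (EB.pow σ))] {hA : 0 < EA.val 0 ∨ (EA.val 0 = 0 ∧ 0 < EA.val 1)}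

variable {T τ : ℝ} {βhat : ℝ → ℝ≥0∞} {πhat : ℝ → ℝ} {L : ℝ≥0} {u : ℝ → L2 Ω}
  {y₀ : GraphSpace (EB.pow σ)} {y : ℝ → GraphSpace (EB.pow σ)} {μ : ℝ → EA.SpecSpace r}

variable [IsFiniteMeasure (volume.restrict Ω)]

/-- The derivative in V_A^{-r} is defined by the first equation, and the primitive identity shows
that it is the weak derivative of y. The hypothesis `hcompat` identifies it, multiplied by τ, with
the one in H. -/
theorem EvolutionSpaces.IsTrajectory.isSolution {U : ℝ → L2 Ω} {d : ℝ → L2 Ω} {K : ℝ} (hT : 0 < T)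
    (hτ : 0 ≤ τ) (hp : IsAdmissiblePotential βhat πhat L) (huU : u =ᵐ[timeMeasure T] U)
    (h : (EA.evolutionSpaces EB hr hσ hA).IsTrajectory (betaIntegral βhat)
      (superposition hp.lipschitz) T τ 0 U y₀ y (fun t => GraphSpace.toH (y t)) μ d)
    (hy : ∀ᵐ t ∂timeMeasure T, ‖y t‖ ≤ K ∧
      betaIntegral βhat (GraphSpace.toH (y t)) ≤ ENNReal.ofReal K)
    (hcompat : ∀ᵐ t ∂timeMeasure T, (EA.evolutionSpaces EB hr hσ hA).N (√τ • d t) =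
      -τ • (EA.evolutionSpaces EB hr hσ hA).proj (μ t)) :
    IsSolution EA EB hr σ T τ βhat πhat u y₀ y μ
      (fun t => -innerSL ℝ ((EA.evolutionSpaces EB hr hσ hA).proj (μ t)))
      (fun t => (√τ)⁻¹ • d t) := by
  set S := EA.evolutionSpaces EB hr hσ hA with hS
  have hpμ : MemLp (fun t => S.proj (μ t)) 2 (timeMeasure T) := S.proj.comp_memLp' h.memLp_μ
  have hdy := memLp_neg_innerSL hpμ
  have hdyi := hdy.integrable (q := 2) (by norm_num)
  have hIcc : ∀ᵐ t ∂timeMeasure T, t ∈ Icc 0 T :=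
    ae_timeMeasure.2 (ae_of_all _ fun t ht => Ioo_subset_Icc_self ht)
  have hprim : (fun t => EA.toNeg hr (GraphSpace.toH y₀)
      + ∫ s in (0 : ℝ)..t, -innerSL ℝ (S.proj (μ s))) =ᵐ[timeMeasure T]
      fun t => EA.toNeg hr (GraphSpace.toH (y t)) := by
    filter_upwards [h.primitive_W, hIcc] with t h1 h2
    rw [zero_mul, norm_le_zero_iff] at h1
    rw [toNeg_eq_innerSL (EB := EB) (hσ := hσ) (hA := hA),
      toNeg_eq_innerSL (EB := EB) (hσ := hσ) (hA := hA)]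
    exact ((innerSL_eq_add_integral_iff hT hpμ EventuallyEq.rfl h2 _ _).2 h1).symm
  have hyN : MemLp (fun t => innerSL ℝ (S.N (S.j (y t)))) 2 (timeMeasure T) :=
    memLp_innerSL (S.N.comp_memLp' (S.j.comp_memLp' h.memLp_y))
  have eyN : (fun t => EA.toNeg hr (GraphSpace.toH (y t))) = fun t => innerSL ℝ (S.N (S.j (y t))) :=
    funext fun t => toNeg_eq_innerSL _
  have hH1 : IsH1 T (fun t => EA.toNeg hr (GraphSpace.toH (y t)))
      (fun t => -innerSL ℝ (S.proj (μ t))) :=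
    ⟨by rw [eyN]; exact hyN, hdy,
      (hasWeakTimeDeriv_add_primitive hT _ hdyi).congr_left hprim⟩
  have hinit : HasInitialValue T (fun t => EA.toNeg hr (GraphSpace.toH (y t)))
      (EA.toNeg hr (GraphSpace.toH y₀)) :=
    ⟨_, continuousOn_const.add (continuousOn_primitive hT hdyi), hprim, by
      rw [Pi.add_apply, intervalIntegral.integral_same, add_zero]⟩
  have htau : MemLp (fun t => τ • (√τ)⁻¹ • d t) 2 (timeMeasure T) :=
    (h.memLp_d.const_smul (√τ)⁻¹).const_smul τ
  have hinf : MemLp y ∞ (timeMeasure T) :=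
    memLp_top_of_bound h.memLp_y.1 K (hy.mono fun t ht => ht.1)
  have hfirst : ∀ᵐ t ∂timeMeasure T, ∀ v : EA.SpecSpace r, (-innerSL ℝ (S.proj (μ t))) v
      + ⟪EigenSystem.SpecSpace.op (μ t), EigenSystem.SpecSpace.op v⟫_ℝ = 0 :=
    ae_of_all _ fun t => (first_equation_iff _ _).2 rfl
  refine ⟨hH1, hinf, htau, ?_, h.memLp_μ, ?_, hfirst, ?_, hinit⟩
  · filter_upwards [hcompat] with t ht
    rw [smul_smul, mul_inv_sqrt_self hτ, toNeg_eq_innerSL (EB := EB) (hσ := hσ) (hA := hA),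
      ← hS, ht, map_smul, neg_smul, smul_neg]
  · refine (lintegral_mono_ae (hy.mono fun t ht => ht.2)).trans_lt ?_
    rw [lintegral_const]
    exact ENNReal.mul_lt_top ENNReal.ofReal_lt_top (measure_lt_top _ _)
  · filter_upwards [h.vi, h.finite, huU] with t h1 h2 h3 v
    by_cases hv : betaIntegral βhat (GraphSpace.toH v) = ∞
    · rw [hv, EReal.coe_ennreal_top, EReal.coe_add_top]
      exact le_top
    · refine (ereal_add_le_iff h2 hv).2 ?_
      have h4 := h1 v hv
      have e1 : S.j (y t - v) = GraphSpace.toH (y t) - GraphSpace.toH v := map_sub S.j _ _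
      have e2 := inner_superposition_sub hp.lipschitz (GraphSpace.toH (y t)) (U t)
        (GraphSpace.toH (y t)) (GraphSpace.toH v)
      have e3 : τ * ⟪(√τ)⁻¹ • d t, S.j (y t - v)⟫_ℝ = √τ * ⟪d t, S.j (y t - v)⟫_ℝ := by
        rw [real_inner_smul_left, ← mul_assoc, mul_inv_sqrt_self hτ]
      rw [← e3] at h4
      rw [h3, ← e2, ← e1]
      exact h4

end Solution

/-! ### Continuous dependence in terms of norms -/

theorem norm_neg_innerSL {W : Type*} [NormedAddCommGroup W] [InnerProductSpace ℝ W] (x : W) :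
    ‖-innerSL ℝ x‖ = ‖x‖ := by
  rw [norm_neg, innerSL_apply_norm]

namespace EvolutionSpaces

variable {H V W : Type*} [NormedAddCommGroup H] [InnerProductSpace ℝ H] [CompleteSpace H]
  [NormedAddCommGroup V] [InnerProductSpace ℝ V] [CompleteSpace V]
  [NormedAddCommGroup W] [InnerProductSpace ℝ W] [CompleteSpace W] (S : EvolutionSpaces H V W)

variable {S} in
theorem MeanCondition.mono {Φ : H → ℝ≥0∞} {ρ M M' : ℝ} {y₀ : V}
    (h : S.MeanCondition Φ ρ M y₀) (hM : M ≤ M') : S.MeanCondition Φ ρ M' y₀ := by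
  rcases h with h | ⟨v₁, v₂, h1, h2, h3, h4, h5, h6, h7, h8⟩
  · exact Or.inl h
  · exact Or.inr ⟨v₁, v₂, h1, h2, h3, h4, h5.trans hM, h6.trans hM, h7.trans hM, h8.trans hM⟩

/-- For exact trajectories the consistency errors in `exists_stability` vanish, and the primitives
are N j(y₁ - y₂) and √τ j(y₁ - y₂). -/
theorem exists_eLpNorm_sub_le {L T : ℝ} (hL : 0 ≤ L) (hT : 0 < T) : ∃ K : ℝ≥0,
    ∀ {Φ : H → ℝ≥0∞} {pi : H → H} {τ : ℝ} {u₁ u₂ : ℝ → H} {y₀ : V} {y₁ y₂ : ℝ → V}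
      {μ₁ μ₂ : ℝ → W} {d₁ d₂ : ℝ → H},
      (∀ x y, ‖pi x - pi y‖ ≤ L * ‖x - y‖) →
      MemLp u₁ 2 (timeMeasure T) → MemLp u₂ 2 (timeMeasure T) →
      S.IsTrajectory Φ pi T τ 0 u₁ y₀ y₁ (fun t => S.j (y₁ t)) μ₁ d₁ →
      S.IsTrajectory Φ pi T τ 0 u₂ y₀ y₂ (fun t => S.j (y₂ t)) μ₂ d₂ →
      eLpNorm (fun t => S.N (S.j (y₁ t - y₂ t))) ∞ (timeMeasure T)
        + eLpNorm (fun t => y₁ t - y₂ t) 2 (timeMeasure T)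
        + eLpNorm (fun t => √τ • S.j (y₁ t - y₂ t)) ∞ (timeMeasure T)
        ≤ K * eLpNorm (fun t => u₁ t - u₂ t) 2 (timeMeasure T) := by
  obtain ⟨K, hK, hst⟩ := S.exists_stability hL hT
  -- Each of the three norms is at most √K times the norm of u₁ - u₂.
  refine ⟨(3 * √K).toNNReal, ?_⟩
  intro Φ pi τ u₁ u₂ y₀ y₁ y₂ μ₁ μ₂ d₁ d₂ hpi hu₁ hu₂ t₁ t₂
  obtain ⟨D, hD⟩ : ∃ D, D = ∫ t, ‖u₁ t - u₂ t‖ ^ 2 ∂timeMeasure T := ⟨_, rfl⟩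
  have hD0 : 0 ≤ D := by
    rw [hD]
    exact integral_nonneg fun t => by positivity
  have hbd : ∀ t ∈ Icc 0 T, (‖∫ s in (0 : ℝ)..t, (S.proj (μ₂ s) - S.proj (μ₁ s))‖ ^ 2
      + ‖∫ s in (0 : ℝ)..t, (d₁ s - d₂ s)‖ ^ 2)
      + ∫ s in (0 : ℝ)..t, ‖y₁ s - y₂ s‖ ^ 2 ≤ K * D := by
    intro t ht
    have h := hst hpi le_rfl zero_le_one le_rfl zero_le_one
      hu₁ hu₂ t₁ t₂ t ht
    refine h.trans (le_of_eq ?_)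
    rw [hD]
    congr 1
    refine integral_congr_ae (ae_of_all _ fun s => ?_)
    change ‖u₁ s - u₂ s‖ ^ 2 + (0 + 0) * _ +
      (‖S.j (y₁ s) - S.j (y₁ s)‖ ^ 2 + ‖S.j (y₂ s) - S.j (y₂ s)‖ ^ 2) = ‖u₁ s - u₂ s‖ ^ 2
    rw [sub_self, sub_self, norm_zero]
    ring
  have hpos : ∀ t ∈ Icc 0 T, 0 ≤ ∫ s in (0 : ℝ)..t, ‖y₁ s - y₂ s‖ ^ 2 := fun t ht =>
    intervalIntegral.integral_nonneg ht.1 fun s _ => by positivity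
  have hIcc : ∀ᵐ t ∂timeMeasure T, t ∈ Icc 0 T :=
    ae_timeMeasure.2 (ae_of_all _ fun t ht => Ioo_subset_Icc_self ht)
  have b1 : ∀ᵐ t ∂timeMeasure T, ‖S.N (S.j (y₁ t - y₂ t))‖ ≤ √(K * D) := by
    filter_upwards [hIcc, t₁.primitive_W, t₂.primitive_W] with t ht p₁ p₂
    rw [zero_mul, norm_le_zero_iff, sub_eq_zero] at p₁ p₂
    have i₁ := intervalIntegrable_of_mem hT
      ((S.proj.comp_memLp' t₁.memLp_μ).integrable (by norm_num)) t ht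
    have i₂ := intervalIntegrable_of_mem hT
      ((S.proj.comp_memLp' t₂.memLp_μ).integrable (by norm_num)) t ht
    have e : S.N (S.j (y₁ t - y₂ t)) = ∫ s in (0 : ℝ)..t, (S.proj (μ₂ s) - S.proj (μ₁ s)) := by
      rw [map_sub, map_sub, ← p₁, ← p₂, sub_sub_sub_cancel_left]
      exact (intervalIntegral.integral_sub i₂ i₁).symm
    rw [e]
    refine Real.le_sqrt_of_sq_le ?_
    have := hbd t ht
    have := hpos t ht
    nlinarith [sq_nonneg ‖∫ s in (0 : ℝ)..t, (d₁ s - d₂ s)‖]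
  have b3 : ∀ᵐ t ∂timeMeasure T, ‖√τ • S.j (y₁ t - y₂ t)‖ ≤ √(K * D) := by
    filter_upwards [hIcc, t₁.primitive_H, t₂.primitive_H] with t ht p₁ p₂
    rw [zero_mul, norm_le_zero_iff, sub_eq_zero] at p₁ p₂
    have i₁ := intervalIntegrable_of_mem hT (t₁.memLp_d.integrable (by norm_num)) t ht
    have i₂ := intervalIntegrable_of_mem hT (t₂.memLp_d.integrable (by norm_num)) t ht
    have e : √τ • S.j (y₁ t - y₂ t) = ∫ s in (0 : ℝ)..t, (d₁ s - d₂ s) := by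
      rw [map_sub, smul_sub, ← p₁, ← p₂, add_sub_add_left_eq_sub]
      exact (intervalIntegral.integral_sub i₁ i₂).symm
    rw [e]
    refine Real.le_sqrt_of_sq_le ?_
    have := hbd t ht
    have := hpos t ht
    nlinarith [sq_nonneg ‖∫ s in (0 : ℝ)..t, (S.proj (μ₂ s) - S.proj (μ₁ s))‖]
  have b2 : ∫ t, ‖y₁ t - y₂ t‖ ^ 2 ∂timeMeasure T ≤ K * D := by
    rw [integral_timeMeasure hT]
    have := hbd T ⟨hT.le, le_rfl⟩
    nlinarith [sq_nonneg ‖∫ s in (0 : ℝ)..T, (S.proj (μ₂ s) - S.proj (μ₁ s))‖,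
      sq_nonneg ‖∫ s in (0 : ℝ)..T, (d₁ s - d₂ s)‖]
  have hsum : eLpNorm (fun t => S.N (S.j (y₁ t - y₂ t))) ∞ (timeMeasure T)
          + eLpNorm (fun t => y₁ t - y₂ t) 2 (timeMeasure T)
          + eLpNorm (fun t => √τ • S.j (y₁ t - y₂ t)) ∞ (timeMeasure T)
      ≤ ENNReal.ofReal √(K * D) + ENNReal.ofReal √(K * D) + ENNReal.ofReal √(K * D) := by
    gcongr ?_ + ?_ + ?_
    · rw [eLpNorm_exponent_top]
      exact eLpNormEssSup_le_of_ae_bound b1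
    · have h := eLpNorm_two_eq (t₁.memLp_y.sub t₂.memLp_y)
      refine (le_of_eq h).trans ?_
      gcongr
      exact b2
    · rw [eLpNorm_exponent_top]
      exact eLpNormEssSup_le_of_ae_bound b3
  refine hsum.trans (le_of_eq ?_)
  have h := eLpNorm_two_eq (hu₁.sub hu₂)
  rw [show (fun t => u₁ t - u₂ t) = u₁ - u₂ from rfl, h]
  simp only [Pi.sub_apply]
  rw [← hD, ← ENNReal.ofReal, ← ENNReal.ofReal_mul (by positivity), Real.sqrt_mul hK,
    ← ENNReal.ofReal_add (by positivity) (by positivity),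
    ← ENNReal.ofReal_add (by positivity) (by positivity)]
  congr 1
  ring

end EvolutionSpaces

/-! ### Existence with estimates, and continuous dependence, in the concrete spaces -/

section WellPosedness

variable {Ω : Set Space3} {A B : L2 Ω →ₗ.[ℝ] L2 Ω} {EA : EigenSystem A} {EB : EigenSystem B}
  {r σ : ℝ} {hr : 0 < r} {hσ : 0 < σ} [CompleteSpace (EA.SpecSpace r)]
  [CompleteSpace (GraphSpace (EB.pow σ))] {hA : 0 < EA.val 0 ∨ (EA.val 0 = 0 ∧ 0 < EA.val 1)}
  [IsFiniteMeasure (volume.restrict Ω)] {βhat : ℝ → ℝ≥0∞} {πhat : ℝ → ℝ} {L : ℝ≥0}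

/-- If λ₁ = 0 and e₁ = c, then (e₁, v) is c|Ω| times the mean of v. The constants m₀ ± δ/2 therefore
serve as comparison elements with ρ = |c||Ω|δ/2; they belong to V_B^σ, and their potential is
bounded uniformly in m₀. If λ₁ > 0, nothing is required. -/
theorem exists_meanCondition (hp : IsAdmissiblePotential βhat πhat L)
    (hconst : EA.val 0 = 0 → IsConstFun (EA.vec 0))
    (hVB : EA.val 0 = 0 → ∀ v : L2 Ω, IsConstFun v → v ∈ (EB.pow σ).domain)
    {δ M : ℝ} (hδ : 0 < δ) :
    ∃ ρ M', 0 < ρ ∧ 0 ≤ M' ∧ ∀ y₀ : GraphSpace (EB.pow σ), ‖y₀‖ ≤ M →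
      (EA.val 0 = 0 → Icc ((⨍ x in Ω, GraphSpace.toH y₀ x) - δ)
        ((⨍ x in Ω, GraphSpace.toH y₀ x) + δ) ⊆ subdiffDomain βhat) →
      (EA.evolutionSpaces EB hr hσ hA).MeanCondition (betaIntegral βhat) ρ M' y₀ := by
  by_cases h0 : EA.val 0 = 0
  swap
  · exact ⟨1, 0, one_pos, le_rfl, fun y₀ _ _ => Or.inl (if_neg h0)⟩
  obtain ⟨c, hc⟩ := hconst h0
  obtain ⟨m, hm⟩ : ∃ m, m = (volume.restrict Ω).real univ := ⟨_, rfl⟩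
  -- Normalization of e₁; in particular neither c nor |Ω| vanishes.
  have hcm : c ^ 2 * m = 1 := by
    have h1 := norm_sq_L2 (EA.vec 0)
    rw [EA.vec.orthonormal.1, integral_congr_ae (hc.mono fun x hx => by rw [hx]), integral_const,
      smul_eq_mul, ← hm] at h1
    linarith
  have hm0 : m ≠ 0 := by
    rintro rfl
    simp at hcm
  have hc0 : c ≠ 0 := by
    rintro rfl
    simp at hcm
  have hκ : c * m ≠ 0 := mul_ne_zero hc0 hm0
  let one : GraphSpace (EB.pow σ) :=
    (⟨Lp.const 2 (volume.restrict Ω) (1 : ℝ), hVB h0 _ ⟨1, Lp.coeFn_const _ _ _⟩⟩ :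
      (EB.pow σ).domain)
  have hone : ∀ s : ℝ, ((GraphSpace.toH (s • one) : L2 Ω) : Space3 → ℝ) =ᵐ[volume.restrict Ω]
      fun _ => s := by
    intro s
    rw [map_smul]
    filter_upwards [Lp.coeFn_smul s (GraphSpace.toH one),
      Lp.coeFn_const 2 (volume.restrict Ω) (1 : ℝ)] with x h1 h2
    rw [h1, Pi.smul_apply, show GraphSpace.toH one x = 1 from h2, smul_eq_mul, mul_one]
  set S := EA.evolutionSpaces EB hr hσ hA with hS
  have he : S.e = EA.vec 0 := if_pos h0
  have hinner : ∀ v : L2 Ω, ⟪S.e, v⟫_ℝ = c * ∫ x in Ω, v x := by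
    intro v
    rw [he, L2.inner_def, ← integral_const_mul]
    refine integral_congr_ae ?_
    filter_upwards [hc] with x hx
    rw [hx]
    exact mul_comm _ _
  have hinner1 : ∀ s : ℝ, ⟪S.e, S.j (s • one)⟫_ℝ = c * m * s := by
    intro s
    have h : ∫ x in Ω, (S.j (s • one) : L2 Ω) x = m * s := by
      refine (integral_congr_ae (hone s)).trans ?_
      rw [integral_const, smul_eq_mul, ← hm]
    rw [hinner, h, mul_assoc]
  have hinner0 : ∀ y₀ : GraphSpace (EB.pow σ),
      ⟪S.e, S.j y₀⟫_ℝ = c * m * ⨍ x in Ω, GraphSpace.toH y₀ x := by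
    intro y₀
    rw [hinner, average_eq, ← hm, smul_eq_mul, mul_assoc, mul_inv_cancel_left₀ hm0]
    rfl
  obtain ⟨C, hC⟩ := hp.exists_bound_of_Icc_subset hδ (M / |c * m|)
  obtain ⟨C', hC'⟩ : ∃ C' : ℝ, C' = (C * volume.restrict Ω univ).toReal := ⟨_, rfl⟩
  refine ⟨|c * m| * (δ / 2), C' + (|M| / |c * m| + δ / 2) * ‖one‖, by positivity, ?_, ?_⟩
  · rw [hC']
    positivity
  intro y₀ hy₀ hsub
  obtain ⟨m₀, hm₀⟩ : ∃ m₀, m₀ = ⨍ x in Ω, GraphSpace.toH y₀ x := ⟨_, rfl⟩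
  have hi0 := hinner0 y₀
  rw [← hm₀] at hi0
  have hsub := hsub h0
  rw [← hm₀] at hsub
  have hR : |m₀| ≤ M / |c * m| := by
    rw [le_div_iff₀ (abs_pos.2 hκ), mul_comm, ← abs_mul, ← hi0]
    refine (abs_real_inner_le_norm _ _).trans ?_
    have h1 := S.norm_e_le
    have h2 := S.norm_j_le y₀
    calc ‖S.e‖ * ‖S.j y₀‖ ≤ 1 * ‖y₀‖ := by gcongr
      _ ≤ M := by rw [one_mul]; exact hy₀
  have hΦ : ∀ s ∈ Icc (m₀ - δ / 2) (m₀ + δ / 2), betaIntegral βhat (S.j (s • one)) ≤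
      C * volume.restrict Ω univ := by
    intro s hs
    have e : betaIntegral βhat (S.j (s • one)) = ∫⁻ _ in Ω, βhat s :=
      lintegral_congr_ae ((hone s).mono fun x hx => congrArg βhat hx)
    rw [e, lintegral_const]
    gcongr
    exact hC m₀ hR hsub s hs
  have htop : (C : ℝ≥0∞) * volume.restrict Ω univ ≠ ∞ :=
    ENNReal.mul_ne_top ENNReal.coe_ne_top (measure_ne_top _ _)
  have hnorm : ∀ s ∈ Icc (m₀ - δ / 2) (m₀ + δ / 2),
      ‖s • one‖ ≤ C' + (|M| / |c * m| + δ / 2) * ‖one‖ := by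
    intro s hs
    have h1 : |s| ≤ |M| / |c * m| + δ / 2 := by
      have h2 : |m₀| ≤ |M| / |c * m| := hR.trans (by gcongr; exact le_abs_self M)
      have h3 := abs_le.1 h2
      exact abs_le.2 ⟨by linarith [hs.1], by linarith [hs.2]⟩
    rw [norm_smul, Real.norm_eq_abs]
    have h4 : 0 ≤ C' := by rw [hC']; positivity
    have : |s| * ‖one‖ ≤ (|M| / |c * m| + δ / 2) * ‖one‖ := by gcongr
    linarith
  have hle : ∀ s ∈ Icc (m₀ - δ / 2) (m₀ + δ / 2), betaIntegral βhat (S.j (s • one)) ≠ ∞ ∧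
      (betaIntegral βhat (S.j (s • one))).toReal ≤ C' + (|M| / |c * m| + δ / 2) * ‖one‖ := by
    intro s hs
    refine ⟨ne_top_of_le_ne_top htop (hΦ s hs), ?_⟩
    have h1 := ENNReal.toReal_mono htop (hΦ s hs)
    rw [← hC'] at h1
    have : 0 ≤ (|M| / |c * m| + δ / 2) * ‖one‖ := by positivity
    linarith
  have hmem₁ : m₀ - δ / 2 ∈ Icc (m₀ - δ / 2) (m₀ + δ / 2) := ⟨le_rfl, by linarith⟩
  have hmem₂ : m₀ + δ / 2 ∈ Icc (m₀ - δ / 2) (m₀ + δ / 2) := ⟨by linarith, le_rfl⟩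
  right
  -- The sign of the constant eigenfunction is not prescribed; a negative sign interchanges the two
  -- comparison elements.
  rcases lt_or_gt_of_ne hκ with hneg | hpos
  · refine ⟨(m₀ + δ / 2) • one, (m₀ - δ / 2) • one, (hle _ hmem₂).1, (hle _ hmem₁).1, ?_, ?_,
      (hle _ hmem₂).2, (hle _ hmem₁).2, hnorm _ hmem₂, hnorm _ hmem₁⟩
    · rw [hinner1, hi0, abs_of_neg hneg]
      ring
    · rw [hinner1, hi0, abs_of_neg hneg]
      ring
  · refine ⟨(m₀ - δ / 2) • one, (m₀ + δ / 2) • one, (hle _ hmem₁).1, (hle _ hmem₂).1, ?_, ?_,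
      (hle _ hmem₁).2, (hle _ hmem₂).2, hnorm _ hmem₁, hnorm _ hmem₂⟩
    · rw [hinner1, hi0, abs_of_pos hpos]
      ring
    · rw [hinner1, hi0, abs_of_pos hpos]
      ring

theorem exists_solution_bound (hp : IsAdmissiblePotential βhat πhat L)
    (hσ : 0 < σ) (hA : 0 < EA.val 0 ∨ (EA.val 0 = 0 ∧ 0 < EA.val 1))
    (hconst : EA.val 0 = 0 → IsConstFun (EA.vec 0))
    (hVB : EA.val 0 = 0 → ∀ v : L2 Ω, IsConstFun v → v ∈ (EB.pow σ).domain)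
    {T : ℝ} (hT : 0 < T) (τmax : ℝ) (M : ℝ≥0) {δ : ℝ} (hδ : 0 < δ) :
    ∃ K₁ : ℝ≥0, ∀ τ : ℝ, 0 ≤ τ → τ ≤ τmax →
      ∀ (u du : ℝ → L2 Ω) (y₀ : GraphSpace (EB.pow σ)),
        IsH1 T u du → h1Norm T u du ≤ M →
        ‖y₀‖ ≤ M → betaIntegral βhat (GraphSpace.toH y₀) ≤ M →
        (EA.val 0 = 0 → Icc ((⨍ x in Ω, GraphSpace.toH y₀ x) - δ)
          ((⨍ x in Ω, GraphSpace.toH y₀ x) + δ) ⊆ subdiffDomain βhat) →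
        ∃ (y : ℝ → GraphSpace (EB.pow σ)) (μ : ℝ → EA.SpecSpace r)
          (dy : ℝ → EA.NegSpace r) (dyH : ℝ → L2 Ω),
          IsSolution EA EB hr σ T τ βhat πhat u y₀ y μ dy dyH ∧
          h1Norm T (fun t => EA.toNeg hr (GraphSpace.toH (y t))) dy
            + eLpNorm y ∞ (timeMeasure T)
            + eLpNorm μ 2 (timeMeasure T)
            + (∫⁻ t, betaIntegral βhat (GraphSpace.toH (y t)) ∂timeMeasure T)
            + eLpNorm (fun t => √τ • dyH t) 2 (timeMeasure T) ≤ K₁ := by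
  obtain ⟨ρ, M₁, hρ, hM₁, hmean⟩ := exists_meanCondition (EA := EA) (EB := EB) (hr := hr)
    (hσ := hσ) (hA := hA) (M := M) hp hconst hVB hδ
  obtain ⟨M₂, hM₂, hrep⟩ := exists_bound_representative (X := L2 Ω) hT M
  obtain ⟨Pi, c, C, hpot⟩ := hp.exists_isPotential (ν := volume.restrict Ω)
  set S := EA.evolutionSpaces EB hr hσ hA with hS
  -- The maximum with 0 covers a negative τmax, for which the claim is void.
  obtain ⟨K, hK, hex⟩ := EvolutionSpaces.exists_isTrajectory (S := S) hpot
    (τmax := max τmax 0) (M := M + M₁ + M₂) (le_max_right _ _) (by positivity) hρ hT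
  have hMM : (M : ℝ) ≤ M + M₁ + M₂ := by linarith
  have hMM₁ : M₁ ≤ M + M₁ + M₂ := by linarith [M.2]
  have hMM₂ : M₂ ≤ M + M₁ + M₂ := by linarith [M.2]
  -- One summand for each norm in the estimate, in the same order; the first two are those of the H¹
  -- norm of y.
  obtain ⟨C₀, hC₀⟩ : ∃ C₀ : ℝ≥0∞, C₀ =
      timeMeasure T univ ^ ((2 : ℝ≥0∞).toReal)⁻¹ * ENNReal.ofReal (‖S.N‖ * K)
      + ENNReal.ofReal √(‖S.proj‖ ^ 2 * K) + ENNReal.ofReal K + ENNReal.ofReal √K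
      + ENNReal.ofReal K * timeMeasure T univ + ENNReal.ofReal √K := ⟨_, rfl⟩
  have hC₀top : C₀ ≠ ∞ := by
    rw [hC₀]
    simp only [ne_eq, ENNReal.add_eq_top, not_or, ENNReal.ofReal_ne_top, not_false_eq_true,
      and_true]
    exact ⟨ENNReal.mul_ne_top (ENNReal.rpow_ne_top_of_nonneg (by positivity) (measure_ne_top _ _))
      ENNReal.ofReal_ne_top, ENNReal.mul_ne_top ENNReal.ofReal_ne_top (measure_ne_top _ _)⟩
  refine ⟨C₀.toNNReal, fun τ hτ hτ' u du y₀ hu hu' hy₀ hΦ hD => ?_⟩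
  obtain ⟨U, huU, hUb, hUh, hUv⟩ := hrep u du hu hu'
  obtain ⟨y, μ, d, htr, hyK, hμK, hdK, hcompat⟩ := hex (y₀ := y₀) (U := U) hτ
    (hτ'.trans (le_max_left _ _)) (hy₀.trans hMM) (ne_top_of_le_ne_top ENNReal.coe_ne_top hΦ)
    ((ENNReal.toReal_le_coe_of_le_coe hΦ).trans hMM) ((hmean y₀ hy₀ hD).mono hMM₁)
    (hu.memLp.ae_eq huU) (fun t ht => (hUb t ht).trans hMM₂)
    (fun s hs t ht => (hUh s hs t ht).trans (by gcongr))
    (fun n h hh hn => (hUv n h hh hn).trans hMM₂)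
  refine ⟨y, μ, _, _, htr.isSolution hT hτ hp huU hyK hcompat, ?_⟩
  rw [ENNReal.coe_toNNReal hC₀top, hC₀, h1Norm]
  have hpμ : MemLp (fun t => S.proj (μ t)) 2 (timeMeasure T) := S.proj.comp_memLp' htr.memLp_μ
  gcongr ?_ + ?_ + ?_ + ?_ + ?_ + ?_
  · rw [eLpNorm_congr_norm_ae (g := fun t => S.N (S.j (y t)))
      (ae_of_all _ fun t => norm_toNeg_eq _)]
    refine eLpNorm_le_of_ae_bound ?_
    filter_upwards [hyK] with t ht
    refine (S.N.le_opNorm _).trans ?_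
    gcongr
    exact (S.norm_j_le _).trans ht.1
  · rw [eLpNorm_congr_norm_ae (g := fun t => S.proj (μ t))
      (ae_of_all _ fun t => norm_neg_innerSL _), eLpNorm_two_eq hpμ]
    gcongr
    calc ∫ t, ‖S.proj (μ t)‖ ^ 2 ∂timeMeasure T
        ≤ ∫ t, ‖S.proj‖ ^ 2 * ‖μ t‖ ^ 2 ∂timeMeasure T := by
          refine integral_mono (integrable_norm_sq hpμ)
            ((integrable_norm_sq htr.memLp_μ).const_mul _) fun t => ?_
          rw [← mul_pow]
          gcongr
          exact S.proj.le_opNorm _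
      _ ≤ _ := by
          rw [integral_const_mul]
          gcongr
  · rw [eLpNorm_exponent_top]
    exact eLpNormEssSup_le_of_ae_bound (hyK.mono fun t ht => ht.1)
  · rw [eLpNorm_two_eq htr.memLp_μ]
    gcongr
  · rw [← lintegral_const]
    exact lintegral_mono_ae (hyK.mono fun t ht => ht.2)
  · refine (eLpNorm_mono (g := d) fun t => ?_).trans ?_
    · rw [smul_smul, norm_smul]
      refine mul_le_of_le_one_left (norm_nonneg _) ?_
      rw [Real.norm_of_nonneg (by positivity)]
      exact mul_inv_le_one
    · rw [eLpNorm_two_eq htr.memLp_d]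
      gcongr

theorem exists_continuous_dependence (hσ : 0 < σ)
    (hA : 0 < EA.val 0 ∨ (EA.val 0 = 0 ∧ 0 < EA.val 1)) {T : ℝ} (hT : 0 < T) (L : ℝ≥0) :
    ∃ K₂ : ℝ≥0, ∀ (βhat : ℝ → ℝ≥0∞) (πhat : ℝ → ℝ), IsAdmissiblePotential βhat πhat L →
      ∀ τ : ℝ, 0 ≤ τ →
      ∀ y₀ : GraphSpace (EB.pow σ), betaIntegral βhat (GraphSpace.toH y₀) < ∞ →
      ∀ u₁ u₂ : ℝ → L2 Ω, MemLp u₁ 2 (timeMeasure T) → MemLp u₂ 2 (timeMeasure T) →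
      ∀ (y₁ y₂ : ℝ → GraphSpace (EB.pow σ)) (μ₁ μ₂ : ℝ → EA.SpecSpace r)
        (dy₁ dy₂ : ℝ → EA.NegSpace r) (dyH₁ dyH₂ : ℝ → L2 Ω),
        IsSolution EA EB hr σ T τ βhat πhat u₁ y₀ y₁ μ₁ dy₁ dyH₁ →
        IsSolution EA EB hr σ T τ βhat πhat u₂ y₀ y₂ μ₂ dy₂ dyH₂ →
        eLpNorm (fun t => EA.toNeg hr (GraphSpace.toH (y₁ t - y₂ t))) ∞ (timeMeasure T)
          + eLpNorm (fun t => y₁ t - y₂ t) 2 (timeMeasure T)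
          + eLpNorm (fun t => √τ • GraphSpace.toH (y₁ t - y₂ t)) ∞ (timeMeasure T)
          ≤ K₂ * eLpNorm (fun t => u₁ t - u₂ t) 2 (timeMeasure T) := by
  obtain ⟨K, hK⟩ := (EA.evolutionSpaces EB hr hσ hA).exists_eLpNorm_sub_le L.2 hT
  refine ⟨K, ?_⟩
  intro βhat πhat hp τ hτ y₀ hy₀ u₁ u₂ hu₁ hu₂ y₁ y₂ μ₁ μ₂ dy₁ dy₂ dyH₁ dyH₂ h₁ h₂
  have h := hK (norm_superposition_sub_le hp.lipschitz) hu₁ hu₂ (h₁.isTrajectory hT hτ hp hy₀)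
    (h₂.isTrajectory hT hτ hp hy₀)
  rw [eLpNorm_congr_norm_ae (f := fun t => EA.toNeg hr (GraphSpace.toH (y₁ t - y₂ t)))
    (ae_of_all _ fun t =>
      norm_toNeg_eq (EB := EB) (hσ := hσ) (hA := hA) (GraphSpace.toH (y₁ t - y₂ t)))]
  exact h

end WellPosedness

/-! ### Uniqueness and the final assembly -/

section Uniqueness

variable {Ω : Set Space3} {A B : L2 Ω →ₗ.[ℝ] L2 Ω} {EA : EigenSystem A} {EB : EigenSystem B}
  {r σ : ℝ} {hr : 0 < r} {βhat : ℝ → ℝ≥0∞} {πhat : ℝ → ℝ}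

/-- Equal y have equal weak derivatives, so the first equations subtract to (A^r(μ₁ - μ₂), A^r v) =
0 for every v, in particular for v = μ₁ - μ₂. -/
theorem op_ae_eq_of_isSolution {T τ : ℝ} {u : ℝ → L2 Ω} {y₀ : GraphSpace (EB.pow σ)}
    {y₁ y₂ : ℝ → GraphSpace (EB.pow σ)} {μ₁ μ₂ : ℝ → EA.SpecSpace r}
    {dy₁ dy₂ : ℝ → EA.NegSpace r} {dyH₁ dyH₂ : ℝ → L2 Ω}
    (h₁ : IsSolution EA EB hr σ T τ βhat πhat u y₀ y₁ μ₁ dy₁ dyH₁)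
    (h₂ : IsSolution EA EB hr σ T τ βhat πhat u y₀ y₂ μ₂ dy₂ dyH₂)
    (hy : y₁ =ᵐ[timeMeasure T] y₂) :
    ∀ᵐ t ∂timeMeasure T, EigenSystem.SpecSpace.op (μ₁ t) = EigenSystem.SpecSpace.op (μ₂ t) := by
  have hw : HasWeakTimeDeriv T (fun t => EA.toNeg hr (GraphSpace.toH (y₁ t))) dy₂ :=
    h₂.memH1_y.weakDeriv.congr_left (hy.mono fun t ht => by
      simp only [ht])
  have hdy := h₁.memH1_y.weakDeriv.ae_eq hw (h₁.memH1_y.memLp.integrable (by norm_num))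
    (h₁.memH1_y.memLp_deriv.integrable (by norm_num))
    (h₂.memH1_y.memLp_deriv.integrable (by norm_num))
  filter_upwards [hdy, h₁.first_equation, h₂.first_equation] with t e f₁ f₂
  have g₁ := f₁ (μ₁ t - μ₂ t)
  have g₂ := f₂ (μ₁ t - μ₂ t)
  rw [e] at g₁
  rw [← sub_eq_zero, ← norm_eq_zero, ← sq_eq_zero_iff, ← real_inner_self_eq_norm_sq,
    inner_sub_left, ← map_sub]
  linarith

end Uniqueness

theorem theorem2p1
    (Ω : Set Space3) (hΩo : IsOpen Ω) (hΩb : Bornology.IsBounded Ω) (hΩc : IsConnected Ω)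
    (hΩs : HasSmoothBoundary Ω)
    (A B : L2 Ω →ₗ.[ℝ] L2 Ω)
    (hA : IsMonotoneSelfAdjointCompact A) (hB : IsMonotoneSelfAdjointCompact B)
    (r σ : ℝ) (hr : 0 < r) (hσ : 0 < σ)
    (hsimple : 0 < hA.eigenSystem.val 0 ∨
      (hA.eigenSystem.val 0 = 0 ∧ 0 < hA.eigenSystem.val 1 ∧ IsConstFun (hA.eigenSystem.vec 0)))
    (hVB : hA.eigenSystem.val 0 = 0 →
      ∀ v : L2 Ω, IsConstFun v → v ∈ (hB.eigenSystem.pow σ).domain)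
    (T : ℝ) (hT : 0 < T) :
    -- existence of a solution satisfying the estimate
    (∀ (βhat : ℝ → ℝ≥0∞) (πhat : ℝ → ℝ) (L : ℝ≥0), IsAdmissiblePotential βhat πhat L →
      ∀ (τmax : ℝ) (M : ℝ≥0) (δ₀ : ℝ), 0 < δ₀ → ∃ K₁ : ℝ≥0,
      ∀ τ : ℝ, 0 ≤ τ → τ ≤ τmax →
      ∀ (u du : ℝ → L2 Ω) (y₀ : GraphSpace (hB.eigenSystem.pow σ)),
        IsH1 T u du → h1Norm T u du ≤ M →
        ‖y₀‖ ≤ M → betaIntegral βhat (GraphSpace.toH y₀) ≤ M →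
        (hA.eigenSystem.val 0 = 0 →
          (⨍ x in Ω, GraphSpace.toH y₀ x) ∈ interior (subdiffDomain βhat) ∧
          Icc ((⨍ x in Ω, GraphSpace.toH y₀ x) - δ₀) ((⨍ x in Ω, GraphSpace.toH y₀ x) + δ₀)
            ⊆ subdiffDomain βhat) →
        ∃ (y : ℝ → GraphSpace (hB.eigenSystem.pow σ)) (μ : ℝ → hA.eigenSystem.SpecSpace r)
          (dy : ℝ → hA.eigenSystem.NegSpace r) (dyH : ℝ → L2 Ω),
          IsSolution hA.eigenSystem hB.eigenSystem hr σ T τ βhat πhat u y₀ y μ dy dyH ∧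
          h1Norm T (fun t => hA.eigenSystem.toNeg hr (GraphSpace.toH (y t))) dy
            + eLpNorm y ∞ (timeMeasure T)
            + eLpNorm μ 2 (timeMeasure T)
            + (∫⁻ t, betaIntegral βhat (GraphSpace.toH (y t)) ∂timeMeasure T)
            + eLpNorm (fun t => √τ • dyH t) 2 (timeMeasure T) ≤ K₁) ∧
    -- continuous dependence on `u`
    (∀ L : ℝ≥0, ∃ K₂ : ℝ≥0,
      ∀ (βhat : ℝ → ℝ≥0∞) (πhat : ℝ → ℝ), IsAdmissiblePotential βhat πhat L →
      ∀ τ : ℝ, 0 ≤ τ →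
      ∀ y₀ : GraphSpace (hB.eigenSystem.pow σ), betaIntegral βhat (GraphSpace.toH y₀) < ∞ →
        (hA.eigenSystem.val 0 = 0 →
          (⨍ x in Ω, GraphSpace.toH y₀ x) ∈ interior (subdiffDomain βhat)) →
      ∀ u₁ du₁ u₂ du₂ : ℝ → L2 Ω, IsH1 T u₁ du₁ → IsH1 T u₂ du₂ →
      ∀ (y₁ y₂ : ℝ → GraphSpace (hB.eigenSystem.pow σ)) (μ₁ μ₂ : ℝ → hA.eigenSystem.SpecSpace r)
        (dy₁ dy₂ : ℝ → hA.eigenSystem.NegSpace r) (dyH₁ dyH₂ : ℝ → L2 Ω),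
        IsSolution hA.eigenSystem hB.eigenSystem hr σ T τ βhat πhat u₁ y₀ y₁ μ₁ dy₁ dyH₁ →
        IsSolution hA.eigenSystem hB.eigenSystem hr σ T τ βhat πhat u₂ y₀ y₂ μ₂ dy₂ dyH₂ →
        eLpNorm (fun t => hA.eigenSystem.toNeg hr (GraphSpace.toH (y₁ t - y₂ t))) ∞ (timeMeasure T)
          + eLpNorm (fun t => y₁ t - y₂ t) 2 (timeMeasure T)
          + eLpNorm (fun t => √τ • GraphSpace.toH (y₁ t - y₂ t)) ∞ (timeMeasure T)
          ≤ K₂ * eLpNorm (fun t => u₁ t - u₂ t) 2 (timeMeasure T)) ∧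
    -- uniqueness of `y` and `A ^ r μ`, and of `μ` if `λ₁ > 0`
    (∀ (βhat : ℝ → ℝ≥0∞) (πhat : ℝ → ℝ) (L : ℝ≥0), IsAdmissiblePotential βhat πhat L →
      ∀ τ : ℝ, 0 ≤ τ →
      ∀ y₀ : GraphSpace (hB.eigenSystem.pow σ), betaIntegral βhat (GraphSpace.toH y₀) < ∞ →
        (hA.eigenSystem.val 0 = 0 →
          (⨍ x in Ω, GraphSpace.toH y₀ x) ∈ interior (subdiffDomain βhat)) →
      ∀ u du : ℝ → L2 Ω, IsH1 T u du →
      ∀ (y₁ y₂ : ℝ → GraphSpace (hB.eigenSystem.pow σ)) (μ₁ μ₂ : ℝ → hA.eigenSystem.SpecSpace r)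
        (dy₁ dy₂ : ℝ → hA.eigenSystem.NegSpace r) (dyH₁ dyH₂ : ℝ → L2 Ω),
        IsSolution hA.eigenSystem hB.eigenSystem hr σ T τ βhat πhat u y₀ y₁ μ₁ dy₁ dyH₁ →
        IsSolution hA.eigenSystem hB.eigenSystem hr σ T τ βhat πhat u y₀ y₂ μ₂ dy₂ dyH₂ →
        y₁ =ᵐ[timeMeasure T] y₂ ∧
        (∀ᵐ t ∂timeMeasure T,
          EigenSystem.SpecSpace.op (μ₁ t) = EigenSystem.SpecSpace.op (μ₂ t)) ∧
        (0 < hA.eigenSystem.val 0 → μ₁ =ᵐ[timeMeasure T] μ₂)) := by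
  have : IsFiniteMeasure (volume.restrict Ω) := ⟨by
    rw [Measure.restrict_apply_univ]
    exact hΩb.measure_lt_top⟩
  have := EigenSystem.SpecSpace.completeSpace (E := hA.eigenSystem) hr
  have := GraphSpace.completeSpace_pow hB.eigenSystem σ
  have hA' : 0 < hA.eigenSystem.val 0 ∨
      (hA.eigenSystem.val 0 = 0 ∧ 0 < hA.eigenSystem.val 1) :=
    hsimple.imp_right fun h => ⟨h.1, h.2.1⟩
  have hconst : hA.eigenSystem.val 0 = 0 → IsConstFun (hA.eigenSystem.vec 0) := fun h0 =>
    (hsimple.resolve_left fun h => h.ne' h0).2.2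
  refine ⟨?_, ?_, ?_⟩
  · intro βhat πhat L hp τmax M δ₀ hδ
    obtain ⟨K, hK⟩ := exists_solution_bound (hr := hr) hp hσ hA' hconst hVB hT τmax M hδ
    exact ⟨K, fun τ hτ hτ' u du y₀ hu hu' hy₀ hΦ hD =>
      hK τ hτ hτ' u du y₀ hu hu' hy₀ hΦ fun h0 => (hD h0).2⟩
  · intro L
    obtain ⟨K, hK⟩ := exists_continuous_dependence (EB := hB.eigenSystem) (hr := hr) hσ hA' hT L
    exact ⟨K, fun βhat πhat hp τ hτ y₀ hy₀ _ u₁ du₁ u₂ du₂ hu₁ hu₂ =>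
      hK βhat πhat hp τ hτ y₀ hy₀ u₁ u₂ hu₁.memLp hu₂.memLp⟩
  · intro βhat πhat L hp τ hτ y₀ hy₀ _ u du hu y₁ y₂ μ₁ μ₂ dy₁ dy₂ dyH₁ dyH₂ h₁ h₂
    obtain ⟨K, hK⟩ := exists_continuous_dependence (EB := hB.eigenSystem) (hr := hr) hσ hA' hT L
    have hy : y₁ =ᵐ[timeMeasure T] y₂ := by
      have h := hK βhat πhat hp τ hτ y₀ hy₀ u u hu.memLp hu.memLp y₁ y₂ μ₁ μ₂ dy₁ dy₂ dyH₁ dyH₂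
        h₁ h₂
      -- With equal data the right-hand side of the stability estimate is zero, hence so is each
      -- norm on the left.
      simp only [sub_self (u _), eLpNorm_zero', mul_zero, nonpos_iff_eq_zero, add_eq_zero] at h
      exact (sub_ae_eq_zero _ _).1 ((eLpNorm_eq_zero_iff (h₁.memLinfty_y.1.sub h₂.memLinfty_y.1)
        two_ne_zero).1 h.1.2)
    have hop := op_ae_eq_of_isSolution h₁ h₂ hy
    refine ⟨hy, hop, fun hpos => hop.mono fun t ht => ?_⟩
    -- If λ₁ > 0, the norm of V_A^r is ‖A^r ·‖ alone, so A^r μ determines μ.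
    have hz : hA.eigenSystem.zeroIndices = ∅ := by
      rw [EigenSystem.zeroIndices_eq hA', if_neg hpos.ne']
    have h := EigenSystem.SpecSpace.norm_sq_eq (μ₁ t - μ₂ t)
    rw [hz, Finset.sum_empty, map_sub, ht, sub_self, norm_zero] at h
    rw [← sub_eq_zero, ← norm_eq_zero, ← sq_eq_zero_iff, h]
    norm_num
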